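/- Let $\mathcal V$ be a bicategory with set of 0-cells $\mathcal V^0$. Define $\mathsf{Span}|\mathcal V$ as follows. * A 0-cell is a set $X$ with a map $x:X\to\mathcal V^0$. * A 1-cell from $(X,x)$ to $(Y,y)$ is a span of maps $Y\xleftarrow{\,l\,}A\xrightarrow{\,r\,}X$ together with, for each $c\in A$, a 1-cell $a(c):x(r(c))\to y(l(c))$ of $\mathcal V$. * A 2-cell from $(A,l,r,a)$ to $(A',l',r',a')$ is a map $f:A\to A'$ with $l'f=l$, $r'f=r$, together with, for each $c\in A$, a 2-cell $\varphi_c:a(c)\Rightarrow a'(f(c))$ of $\mathcal V$. The vertical composite of 2-cells is $(g,\psi)\cdot(f,\varphi)=(gf,\{\psi_{f(c)}\cdot\varphi_c\}_c)$. The composite of $(Y\leftarrow A\to X,a)$ and $(Z\leftarrow B\to Y,b)$ is the pullback span on $\{(d,c)\in B\times A: r(d)=l(c)\}$, with the label $b(d)\circ a(c)$ at $(d,c)$; 2-cells are composed horizontally in the same way. The identity 1-cell of $(X,x)$ is the trivial span $X=X=X$ labelled by the identity 1-cells $1_{x(p)}$. The associator and the unitors are the canonical isomorphisms of spans, labelled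 by the associators and unitors of $\mathcal V$. A monoidal bicategory is a one-object tricategory: a bicategory with a pseudofunctor $\otimes$, a unit object $K$, pseudonatural equivalences $(A\otimes B)\otimes C\to A\otimes(B\otimes C)$, $K\otimes A\to A$, $A\to A\otimes K$, and invertible modifications $\pi,\mu,\lambda,\rho$ that satisfy the non-abelian 4-cocycle condition and the left and right normalization conditions. If $\mathcal V$ is monoidal, define a monoidal structure on $\mathsf{Span}|\mathcal V$ thus: on 0-, 1- and 2-cells $\otimes$ is the Cartesian product of sets, spans and maps of spans, labelled by the tensor products of the labels in $\mathcal V$; the unit is the one-element set labelled by $K$; the compatibilities of $\otimes$ with compositions and identities, the associativity and unitality 1-cells, their naturality 2-cells and the modifications $\pi,\mu,\lambda,\rho$ are the canonical maps between Cartesian products of sets (respectively between spans), labelled by the corresponding cells of $\mathcal V$. For a lax functor $F:\mathcal V\to\mathcal W$ of bicategories, let $\mathsf{Span}|F:\mathsf{Span}|\mathcal V\to\mathsf{Span}|\mathcal W$ leave sets, spans and maps of spans unchanged and apply $F$ to all labels; its comparison 2-cells for composition and identities are labelled by those of $F$. A monoidal lax functor between monoidal bicategories consists of a lax functor $F$,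 a lax natural transformation $\chi:FA\otimes FB\to F(A\otimes B)$, a 1-cell $\iota:K\to FK$, and invertible 2-cells $$\omega:\ \chi\circ(1\otimes\chi)\circ\alpha\ \cong\ F\alpha\circ\chi\circ(\chi\otimes1),\qquad \gamma:\ l\ \cong\ Fl\circ\chi\circ(\iota\otimes1),\qquad \delta:\ \chi\circ(1\otimes\iota)\circ r\ \cong\ Fr,$$ (where $\alpha,l,r$ are the associativity and unitality 1-cells), which are compatible with the 2-cells of naturality and satisfy the associativity axiom (relating $\omega$ to $\pi$) and the unit axiom (relating $\omega,\gamma,\delta$ to $\mu$) of functors of tricategories, all these equations being read after composition with the comparison 2-cells $Fg\circ Ff\Rightarrow F(g\circ f)$ and $1\Rightarrow F1$ of $F$. Given such data, equip $\mathsf{Span}|F$ with the compatibilities $\chi,\iota$ given by identity maps of the underlying sets labelled by the cells $\chi,\iota$ of $F$, and with the canonical 2-cells labelled by the naturality 2-cells of $\chi$ and by $\omega,\gamma,\delta$. **Theorem.** Let $\mathcal V$ and $\mathcal W$ be bicategories. 1. $\mathsf{Span}|\mathcal V$ is a bicategory. 2. If $\mathcal V$ is a monoidal bicategory, then $\mathsf{Span}|\mathcal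 V$ with the above structure is a monoidal bicategory. 3. If $F:\mathcal V\to\mathcal W$ is a lax functor, then $\mathsf{Span}|F$ is a lax functor; if $F$ is a pseudofunctor, then so is $\mathsf{Span}|F$. 4. If $\mathcal V$ and $\mathcal W$ are monoidal bicategories and $F$ is a monoidal lax functor, then $\mathsf{Span}|F$ with the above structure is a monoidal lax functor. If moreover the product compatibility $\chi$ of $F$ is pseudonatural, then so is that of $\mathsf{Span}|F$. -/

import Mathlib

open CategoryTheory Bicategory
open scoped CategoryTheory.Prod

universe s w v u w₁ v₁ u₁ w₂ v₂ u₂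

/-! ## The bicategory `Span|V` -/

section SpanV

/-- The 0-cells of `Span|V`: a set `X` with a map `x : X → V⁰` to the 0-cells of `V`. -/
structure LabelledSet (V : Type u) : Type (max u (s + 1)) where
  carrier : Type s
  label : carrier → V

variable {V : Type u} [Bicategory.{w, v} V]

/-- The 1-cells of `Span|V` from `(X, x)` to `(Y, y)`: a span `Y ←l- A -r→ X` together with a map
`a` from `A` to the 1-cells of `V` such that `a c` goes from `x (r c)` to `y (l c)`.
The endpoint conditions are kept as equations: `lab c hi hj` is the 1-cell `a c`, seen as a 1-cell
`x i ⟶ y j` whenever `r c = i` and `l c = j` (so `lab` amounts to the values `lab c rfl rfl`). -/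
structure LabelledSpan (X Y : LabelledSet.{s} V) : Type (max v (s + 1)) where
  apex : Type s
  l : apex → Y.carrier
  r : apex → X.carrier
  lab (c : apex) {i : X.carrier} {j : Y.carrier} (hi : r c = i) (hj : l c = j) :
    X.label i ⟶ Y.label j

/-- The 2-cells of `Span|V`: a map of spans `f : A → A'` and 2-cells `a c ⟶ a' (f c)` of `V`. -/
structure SpanMap {X Y : LabelledSet.{s} V} (A A' : LabelledSpan X Y) : Type (max w s) where
  map : A.apex → A'.apex
  l_map (c : A.apex) : A'.l (map c) = A.l c
  r_map (c : A.apex) : A'.r (map c) = A.r c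
  lab (c : A.apex) {i : X.carrier} {j : Y.carrier} (hi : A.r c = i) (hj : A.l c = j) :
    A.lab c hi hj ⟶ A'.lab (map c) ((r_map c).trans hi) ((l_map c).trans hj)

/-- The pullback `B ∧ A = {(d, c) ∈ B × A | r d = l c}`, with the common value recorded. -/
@[ext] structure SpanPullback {X Y Z : LabelledSet.{s} V} (A : LabelledSpan X Y)
    (B : LabelledSpan Y Z) : Type s where
  fst : B.apex
  snd : A.apex
  mid : Y.carrier
  fst_r : B.r fst = mid
  snd_l : A.l snd = mid

namespace LabelledSpan

variable {X Y Z U : LabelledSet.{s} V}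

/-- The 1-cell with span `Y ←p- X =1= X` given by a map `p` and 1-cells `a i : x i ⟶ y (p i)`. -/
def graph (p : X.carrier → Y.carrier) (a : ∀ i, X.label i ⟶ Y.label (p i)) :
    LabelledSpan X Y where
  apex := X.carrier
  l := p
  r := fun i => i
  lab := fun k _ _ hi hj => match hi, hj with
    | rfl, rfl => a k

/-- The identity 1-cell: the trivial span, labelled by identity 1-cells. -/
def id (X : LabelledSet.{s} V) : LabelledSpan X X := graph (fun i => i) fun i => 𝟙 (X.label i)

/-- Horizontal composition of 1-cells: `(d, c) ↦ b d ∘ a c` on the pullback span. -/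
def comp (A : LabelledSpan X Y) (B : LabelledSpan Y Z) : LabelledSpan X Z where
  apex := SpanPullback A B
  l := fun p => B.l p.fst
  r := fun p => A.r p.snd
  lab := fun p _ _ hi hj => A.lab p.snd hi p.snd_l ≫ B.lab p.fst p.fst_r hj

theorem snd_bijective (A : LabelledSpan X Y) (B : LabelledSpan Y Z) (h : Function.Bijective B.r) :
    Function.Bijective (SpanPullback.snd : SpanPullback A B → A.apex) := by
  constructor
  · rintro ⟨d, c, m, h₁, h₂⟩ ⟨d', c', m', h₁', h₂'⟩ (rfl : c = c')
    subst h₂ h₂'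
    obtain rfl : d = d' := h.1 (h₁.trans h₁'.symm)
    rfl
  · intro c
    obtain ⟨d, hd⟩ := h.2 (A.l c)
    exact ⟨⟨d, c, _, hd, rfl⟩, rfl⟩

theorem fst_bijective (A : LabelledSpan X Y) (B : LabelledSpan Y Z) (h : Function.Bijective A.l) :
    Function.Bijective (SpanPullback.fst : SpanPullback A B → B.apex) := by
  constructor
  · rintro ⟨d, c, m, h₁, h₂⟩ ⟨d', c', m', h₁', h₂'⟩ (rfl : d = d')
    subst h₁ h₁'
    obtain rfl : c = c' := h.1 (h₂.trans h₂'.symm)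
    rfl
  · intro d
    obtain ⟨c, hc⟩ := h.2 (B.r d)
    exact ⟨⟨d, c, _, rfl, hc⟩, rfl⟩

theorem comp_r_bijective (A : LabelledSpan X Y) (B : LabelledSpan Y Z)
    (hA : Function.Bijective A.r) (hB : Function.Bijective B.r) :
    Function.Bijective (A.comp B).r :=
  hA.comp (snd_bijective A B hB)

end LabelledSpan

namespace SpanMap

variable {X Y Z U : LabelledSet.{s} V}

/-- The identity 2-cell. -/
def id (A : LabelledSpan X Y) : SpanMap A A where
  map := fun c => c
  l_map := fun _ => rfl
  r_map := fun _ => rfl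
  lab := fun c _ _ hi hj => 𝟙 (A.lab c hi hj)

/-- Vertical composition of 2-cells. -/
def comp {A A' A'' : LabelledSpan X Y} (f : SpanMap A A') (g : SpanMap A' A'') :
    SpanMap A A'' where
  map := fun c => g.map (f.map c)
  l_map := fun c => (g.l_map _).trans (f.l_map c)
  r_map := fun c => (g.r_map _).trans (f.r_map c)
  lab := fun c _ _ hi hj =>
    f.lab c hi hj ≫ g.lab (f.map c) ((f.r_map c).trans hi) ((f.l_map c).trans hj)

theorem ext_lab {A A' : LabelledSpan X Y} {f g : SpanMap A A'} (h : ∀ c, f.map c = g.map c)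
    (h' : ∀ c {i j} (hi : A.r c = i) (hj : A.l c = j), HEq (f.lab c hi hj) (g.lab c hi hj)) :
    f = g := by
  obtain ⟨fm, fl, fr, fφ⟩ := f
  obtain ⟨gm, gl, gr, gφ⟩ := g
  obtain rfl : fm = gm := funext h
  obtain rfl : @fφ = @gφ := by
    funext c i j hi hj
    exact eq_of_heq (h' c hi hj)
  rfl

end SpanMap

instance LabelledSet.categoryStruct : CategoryStruct.{max v (s + 1)} (LabelledSet.{s} V) where
  Hom X Y := LabelledSpan X Y
  id X := LabelledSpan.id X
  comp A B := LabelledSpan.comp A B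

instance LabelledSpan.category (X Y : LabelledSet.{s} V) : Category.{max w s} (X ⟶ Y) where
  Hom A B := SpanMap A B
  id A := SpanMap.id A
  comp f g := SpanMap.comp f g
  id_comp _ := SpanMap.ext_lab (fun _ => rfl) fun _ _ _ _ _ => heq_of_eq (Category.id_comp _)
  comp_id _ := SpanMap.ext_lab (fun _ => rfl) fun _ _ _ _ _ => heq_of_eq (Category.comp_id _)
  assoc _ _ _ := SpanMap.ext_lab (fun _ => rfl) fun _ _ _ _ _ => heq_of_eq (Category.assoc _ _ _)

namespace SpanMap

variable {X Y Z U : LabelledSet.{s} V}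

theorem lab_congr {A : LabelledSpan X Y} {c d : A.apex} (h : c = d) {i j} (hi : A.r c = i)
    (hj : A.l c = j) : A.lab c hi hj = A.lab d (h ▸ hi) (h ▸ hj) := by
  subst h; rfl

/-- A 2-cell whose map of spans is bijective and whose labels are invertible is invertible. -/
noncomputable def iso {A B : X ⟶ Y} (f : SpanMap A B) (hf : Function.Bijective f.map)
    (h : ∀ c {i j} (hi : LabelledSpan.r A c = i) (hj : LabelledSpan.l A c = j),
      IsIso (f.lab c hi hj)) : A ≅ B :=
  let e := Equiv.ofBijective f.map hf
  have he : ∀ d, f.map (e.symm d) = d := fun d => e.apply_symm_apply d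
  have hl : ∀ d, A.l (e.symm d) = B.l d := fun d => by rw [← f.l_map, he]
  have hr : ∀ d, A.r (e.symm d) = B.r d := fun d => by rw [← f.r_map, he]
  let g : SpanMap B A :=
    { map := e.symm
      l_map := hl
      r_map := hr
      lab := fun d _ _ hi hj =>
        haveI := h (e.symm d) ((hr d).trans hi) ((hl d).trans hj)
        eqToHom (lab_congr (he d).symm hi hj) ≫
          inv (f.lab (e.symm d) ((hr d).trans hi) ((hl d).trans hj)) }
  { hom := f
    inv := g
    hom_inv_id := by
      refine ext_lab (fun c => e.symm_apply_apply c) fun c i j hi hj => ?_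
      have key : ∀ (c' : A.apex) (_ : c' = c) (hi' : A.r c' = i) (hj' : A.l c' = j)
          (q : B.lab (f.map c) ((f.r_map c).trans hi) ((f.l_map c).trans hj) =
            B.lab (f.map c') ((f.r_map c').trans hi') ((f.l_map c').trans hj')),
          haveI := h c' hi' hj'
          HEq (f.lab c hi hj ≫ eqToHom q ≫ inv (f.lab c' hi' hj')) (𝟙 (A.lab c hi hj)) := by
        rintro c' rfl hi' hj' q
        simp
      exact key (e.symm (f.map c)) (e.symm_apply_apply c) _ _ _
    inv_hom_id := by
      refine ext_lab he fun d i j hi hj => ?_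
      have h1 : HEq (eqToHom (lab_congr (he d).symm hi hj)) (𝟙 (B.lab d hi hj)) := by
        generalize_proofs _ _ q
        revert q
        generalize B.lab (f.map (e.symm d)) _ _ = z
        rintro rfl
        rfl
      have h2 := h (e.symm d) ((hr d).trans hi) ((hl d).trans hj)
      change HEq ((eqToHom _ ≫ inv (f.lab _ _ _)) ≫ f.lab _ _ _) _
      rw [Category.assoc, IsIso.inv_hom_id, Category.comp_id]
      exact h1 }

@[simp] theorem iso_hom {A B : X ⟶ Y} (f : SpanMap A B) (hf : Function.Bijective f.map)
    (h : ∀ c {i j} (hi : LabelledSpan.r A c = i) (hj : LabelledSpan.l A c = j),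
      IsIso (f.lab c hi hj)) : (f.iso hf h).hom = f := rfl

theorem bijective_of_r {A B : X ⟶ Y} (f : SpanMap A B)
    (hA : Function.Bijective (LabelledSpan.r A)) (hB : Function.Bijective (LabelledSpan.r B)) :
    Function.Bijective f.map := by
  have h : LabelledSpan.r B ∘ f.map = LabelledSpan.r A := funext f.r_map
  exact Function.Bijective.of_comp_left (h ▸ hA) hB.1

/-- Left whiskering. -/
def whiskerLeft (A : X ⟶ Y) {B B' : Y ⟶ Z} (g : B ⟶ B') : A ≫ B ⟶ A ≫ B' where
  map := fun p => ⟨SpanMap.map g p.fst, p.snd, p.mid, (g.r_map _).trans p.fst_r, p.snd_l⟩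
  l_map := fun p => g.l_map p.fst
  r_map := fun _ => rfl
  lab := fun p _ _ hi hj => LabelledSpan.lab A p.snd hi p.snd_l ◁ SpanMap.lab g p.fst p.fst_r hj

/-- Right whiskering. -/
def whiskerRight {A A' : X ⟶ Y} (f : A ⟶ A') (B : Y ⟶ Z) : A ≫ B ⟶ A' ≫ B where
  map := fun p => ⟨p.fst, SpanMap.map f p.snd, p.mid, p.fst_r, (f.l_map _).trans p.snd_l⟩
  l_map := fun _ => rfl
  r_map := fun p => f.r_map p.snd
  lab := fun p _ _ hi hj => SpanMap.lab f p.snd hi p.snd_l ▷ LabelledSpan.lab B p.fst p.fst_r hj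

/-- The associativity 2-cell, combining those of `Span` and `V`. -/
def associator (A : X ⟶ Y) (B : Y ⟶ Z) (C : Z ⟶ U) : (A ≫ B) ≫ C ⟶ A ≫ (B ≫ C) where
  map := fun p =>
    ⟨⟨p.fst, p.snd.fst, p.mid, p.fst_r, p.snd_l⟩, p.snd.snd, p.snd.mid, p.snd.fst_r, p.snd.snd_l⟩
  l_map := fun _ => rfl
  r_map := fun _ => rfl
  lab := fun _ _ _ _ _ => (α_ _ _ _).hom

/-- The left unit 2-cell, combining those of `Span` and `V`. -/
def leftUnitor (A : X ⟶ Y) : 𝟙 X ≫ A ⟶ A where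
  map := fun p => p.fst
  l_map := fun _ => rfl
  r_map := fun p => p.fst_r.trans p.snd_l.symm
  lab := fun p i _ hi _ => by
    obtain ⟨d, c, m, h, h'⟩ := p
    change c = i at hi
    change c = m at h'
    subst hi h'
    exact (λ_ _).hom

/-- The right unit 2-cell, combining those of `Span` and `V`. -/
def rightUnitor (A : X ⟶ Y) : A ≫ 𝟙 Y ⟶ A where
  map := fun p => p.snd
  l_map := fun p => p.snd_l.trans p.fst_r.symm
  r_map := fun _ => rfl
  lab := fun p _ j _ hj => by
    obtain ⟨d, c, m, h, h'⟩ := p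
    change d = m at h
    change d = j at hj
    subst hj h
    exact (ρ_ _).hom

theorem associator_bijective (A : X ⟶ Y) (B : Y ⟶ Z) (C : Z ⟶ U) :
    Function.Bijective (SpanMap.map (associator A B C)) :=
  Function.bijective_iff_has_inverse.2 ⟨fun q =>
    ⟨q.fst.fst, ⟨q.fst.snd, q.snd, q.mid, q.fst_r, q.snd_l⟩, q.fst.mid, q.fst.fst_r, q.fst.snd_l⟩,
    fun _ => rfl, fun _ => rfl⟩

theorem leftUnitor_bijective (A : X ⟶ Y) : Function.Bijective (SpanMap.map (leftUnitor A)) :=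
  Function.bijective_iff_has_inverse.2 ⟨fun c =>
    ⟨c, LabelledSpan.r A c, LabelledSpan.r A c, rfl, rfl⟩, by
      rintro ⟨d, c, m, h, h'⟩
      change c = m at h'
      subst h'
      change LabelledSpan.r A d = c at h
      subst h
      rfl, fun _ => rfl⟩

theorem rightUnitor_bijective (A : X ⟶ Y) : Function.Bijective (SpanMap.map (rightUnitor A)) :=
  Function.bijective_iff_has_inverse.2 ⟨fun c =>
    ⟨LabelledSpan.l A c, c, LabelledSpan.l A c, rfl, rfl⟩, by
      rintro ⟨d, c, m, h, h'⟩
      change d = m at h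
      subst h
      change LabelledSpan.l A c = d at h'
      subst h'
      rfl, fun _ => rfl⟩

/-- The associator as an invertible 2-cell. -/
noncomputable def associatorIso (A : X ⟶ Y) (B : Y ⟶ Z) (C : Z ⟶ U) :
    (A ≫ B) ≫ C ≅ A ≫ (B ≫ C) :=
  (associator A B C).iso (associator_bijective A B C) fun _ _ _ _ _ =>
    inferInstanceAs (IsIso (α_ _ _ _).hom)

/-- The left unitor as an invertible 2-cell. -/
noncomputable def leftUnitorIso (A : X ⟶ Y) : 𝟙 X ≫ A ≅ A :=
  (leftUnitor A).iso (leftUnitor_bijective A) fun p i _ hi _ => by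
    obtain ⟨d, c, m, h, h'⟩ := p
    change c = i at hi
    change c = m at h'
    subst hi h'
    exact inferInstanceAs (IsIso (λ_ _).hom)

/-- The right unitor as an invertible 2-cell. -/
noncomputable def rightUnitorIso (A : X ⟶ Y) : A ≫ 𝟙 Y ≅ A :=
  (rightUnitor A).iso (rightUnitor_bijective A) fun p _ j _ hj => by
    obtain ⟨d, c, m, h, h'⟩ := p
    change d = m at h
    change d = j at hj
    subst hj h
    exact inferInstanceAs (IsIso (ρ_ _).hom)

end SpanMap

/-- The bicategory `Span|V` of labelled sets, labelled spans and labelled span maps. -/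
noncomputable instance LabelledSet.bicategory :
    Bicategory.{max w s, max v (s + 1)} (LabelledSet.{s} V) where
  homCategory X Y := LabelledSpan.category X Y
  whiskerLeft A _ _ g := SpanMap.whiskerLeft A g
  whiskerRight f B := SpanMap.whiskerRight f B
  associator A B C := SpanMap.associatorIso A B C
  leftUnitor A := SpanMap.leftUnitorIso A
  rightUnitor A := SpanMap.rightUnitorIso A
  whiskerLeft_id _ _ := SpanMap.ext_lab (fun _ => rfl) fun _ _ _ _ _ =>
    heq_of_eq (Bicategory.whiskerLeft_id _ _)
  whiskerLeft_comp _ _ _ _ _ _ := SpanMap.ext_lab (fun _ => rfl) fun _ _ _ _ _ =>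
    heq_of_eq (Bicategory.whiskerLeft_comp _ _ _)
  id_whiskerLeft {X Y A B} f := by
    rw [← Category.assoc, Iso.eq_comp_inv]
    refine SpanMap.ext_lab (fun _ => rfl) fun p i j hi hj => heq_of_eq ?_
    obtain ⟨d, c, m, h, h'⟩ := p
    change c = i at hi
    change c = m at h'
    subst hi h'
    have := Bicategory.id_whiskerLeft (SpanMap.lab f d h hj)
    rw [← Category.assoc, Iso.eq_comp_inv] at this
    exact this
  comp_whiskerLeft A B _ _ f := by
    rw [← Category.assoc, Iso.eq_comp_inv]
    refine SpanMap.ext_lab (fun _ => rfl) fun p i j hi hj => heq_of_eq ?_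
    have := Bicategory.comp_whiskerLeft (LabelledSpan.lab A p.snd.snd hi p.snd.snd_l)
      (LabelledSpan.lab B p.snd.fst p.snd.fst_r p.snd_l) (SpanMap.lab f p.fst p.fst_r hj)
    rw [← Category.assoc, Iso.eq_comp_inv] at this
    exact this
  id_whiskerRight _ _ := SpanMap.ext_lab (fun _ => rfl) fun _ _ _ _ _ =>
    heq_of_eq (Bicategory.id_whiskerRight _ _)
  comp_whiskerRight _ _ _ := SpanMap.ext_lab (fun _ => rfl) fun _ _ _ _ _ =>
    heq_of_eq (Bicategory.comp_whiskerRight _ _ _)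
  whiskerRight_id {X Y A B} f := by
    rw [← Category.assoc, Iso.eq_comp_inv]
    refine SpanMap.ext_lab (fun _ => rfl) fun p i j hi hj => heq_of_eq ?_
    obtain ⟨d, c, m, h, h'⟩ := p
    change d = m at h
    change d = j at hj
    subst hj h
    have := Bicategory.whiskerRight_id (SpanMap.lab f c hi h')
    rw [← Category.assoc, Iso.eq_comp_inv] at this
    exact this
  whiskerRight_comp f B C := by
    rw [Iso.eq_inv_comp]
    refine SpanMap.ext_lab (fun _ => rfl) fun p i j hi hj => heq_of_eq ?_
    have := Bicategory.whiskerRight_comp (SpanMap.lab f p.snd.snd hi p.snd.snd_l)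
      (LabelledSpan.lab B p.snd.fst p.snd.fst_r p.snd_l) (LabelledSpan.lab C p.fst p.fst_r hj)
    rw [Iso.eq_inv_comp] at this
    exact this
  whisker_assoc A _ _ g C := by
    rw [← Category.assoc, Iso.eq_comp_inv]
    refine SpanMap.ext_lab (fun _ => rfl) fun p i j hi hj => heq_of_eq ?_
    have := Bicategory.whisker_assoc (LabelledSpan.lab A p.snd.snd hi p.snd.snd_l)
      (SpanMap.lab g p.snd.fst p.snd.fst_r p.snd_l) (LabelledSpan.lab C p.fst p.fst_r hj)
    rw [← Category.assoc, Iso.eq_comp_inv] at this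
    exact this
  whisker_exchange _ _ := SpanMap.ext_lab (fun _ => rfl) fun _ _ _ _ _ =>
    heq_of_eq (Bicategory.whisker_exchange _ _)
  pentagon _ _ _ _ := SpanMap.ext_lab (fun _ => rfl) fun _ _ _ _ _ =>
    heq_of_eq (Bicategory.pentagon _ _ _ _)
  triangle A B := by
    refine SpanMap.ext_lab (fun p => ?_) fun p i j hi hj => ?_
    · obtain ⟨d, ⟨k, c, m, h, h'⟩, n, g, g'⟩ := p
      change k = m at h
      change k = n at g'
      subst h g'
      rfl
    · obtain ⟨d, ⟨k, c, m, h, h'⟩, n, g, g'⟩ := p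
      change k = m at h
      change k = n at g'
      subst h g'
      exact heq_of_eq (Bicategory.triangle _ _)

end SpanV

/-! ## Lax functors, pseudofunctors and their transformations: data and laws -/

section Functors

set_option linter.checkUnivs false in
/-- The operations of a bicategory with 0-cells `B`. -/
structure BicategoryData (B : Type u) where
  Hom : B → B → Type v
  Hom₂ {X Y : B} : Hom X Y → Hom X Y → Type w
  id (X : B) : Hom X X
  comp {X Y Z : B} : Hom X Y → Hom Y Z → Hom X Z
  id₂ {X Y : B} (f : Hom X Y) : Hom₂ f f
  vcomp {X Y : B} {f g h : Hom X Y} : Hom₂ f g → Hom₂ g h → Hom₂ f h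
  hcomp {X Y Z : B} {f f' : Hom X Y} {g g' : Hom Y Z} :
    Hom₂ f f' → Hom₂ g g' → Hom₂ (comp f g) (comp f' g')
  associator {X Y Z U : B} (f : Hom X Y) (g : Hom Y Z) (h : Hom Z U) :
    Hom₂ (comp (comp f g) h) (comp f (comp g h))
  leftUnitor {X Y : B} (f : Hom X Y) : Hom₂ (comp (id X) f) f
  rightUnitor {X Y : B} (f : Hom X Y) : Hom₂ (comp f (id Y)) f

/-- The operations of a bicategory. -/
def BicategoryData.of {B : Type u} (i : Bicategory.{w, v} B) : BicategoryData.{w, v} B where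
  Hom X Y := X ⟶ Y
  Hom₂ f g := f ⟶ g
  id X := 𝟙 X
  comp f g := f ≫ g
  id₂ f := 𝟙 f
  vcomp φ ψ := φ ≫ ψ
  hcomp {_ _ _ _ f' g _} φ ψ := φ ▷ g ≫ f' ◁ ψ
  associator f g h := (α_ f g h).hom
  leftUnitor f := (λ_ f).hom
  rightUnitor f := (ρ_ f).hom

variable {B : Type u₁} [Bicategory.{w₁, v₁} B] {C : Type u₂} [Bicategory.{w₂, v₂} C]
  {D : Type u} [Bicategory.{w, v} D] {E : Type*} [Bicategory E]

variable (B C) in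
/-- The data of a lax functor (no laws). -/
structure LaxFunctorData extends PrelaxFunctorStruct B C where
  mapId (a : B) : 𝟙 (obj a) ⟶ map (𝟙 a)
  mapComp {a b c : B} (f : a ⟶ b) (g : b ⟶ c) : map f ≫ map g ⟶ map (f ≫ g)

variable (B C) in
/-- The data of a pseudofunctor (no laws). -/
structure PseudofunctorData extends PrelaxFunctorStruct B C where
  mapId (a : B) : map (𝟙 a) ≅ 𝟙 (obj a)
  mapComp {a b c : B} (f : a ⟶ b) (g : b ⟶ c) : map (f ≫ g) ≅ map f ≫ map g

namespace LaxFunctorData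

/-- The data of a lax functor. -/
def of (F : B ⥤ᴸ C) : LaxFunctorData B C where
  toPrelaxFunctorStruct := F.toPrelaxFunctorStruct
  mapId := F.mapId
  mapComp := F.mapComp

/-- The data satisfy the laws of a lax functor. -/
def IsLaxFunctor (F : LaxFunctorData B C) : Prop := ∃ G : B ⥤ᴸ C, of G = F

/-- The data satisfy the laws of a pseudofunctor. -/
def IsPseudofunctor (F : LaxFunctorData B C) : Prop := ∃ G : B ⥤ᵖ C, of G.toLax = F

variable (B) in
/-- The identity functor. -/
def id : LaxFunctorData B B where
  toPrelaxFunctorStruct := PrelaxFunctorStruct.id B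
  mapId a := 𝟙 (𝟙 a)
  mapComp f g := 𝟙 (f ≫ g)

/-- Composition of lax functors. -/
def comp (F : LaxFunctorData B C) (G : LaxFunctorData C D) : LaxFunctorData B D where
  toPrelaxFunctorStruct := PrelaxFunctorStruct.comp F.toPrelaxFunctorStruct G.toPrelaxFunctorStruct
  mapId a := G.mapId (F.obj a) ≫ G.map₂ (F.mapId a)
  mapComp f g := G.mapComp (F.map f) (F.map g) ≫ G.map₂ (F.mapComp f g)

/-- The product `F × F` of a lax functor with itself. -/
def square (F : LaxFunctorData B C) : LaxFunctorData (B × B) (C × C) where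
  obj p := (F.obj p.1, F.obj p.2)
  map f := F.map f.1 ×ₘ F.map f.2
  map₂ φ := F.map₂ φ.1 ×ₘ F.map₂ φ.2
  mapId p := F.mapId p.1 ×ₘ F.mapId p.2
  mapComp f g := F.mapComp f.1 g.1 ×ₘ F.mapComp f.2 g.2

end LaxFunctorData

namespace PseudofunctorData

/-- The data of a pseudofunctor. -/
def of (F : B ⥤ᵖ C) : PseudofunctorData B C where
  toPrelaxFunctorStruct := F.toPrelaxFunctorStruct
  mapId := F.mapId
  mapComp := F.mapComp

/-- The data satisfy the laws of a pseudofunctor. -/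
def IsPseudofunctor (F : PseudofunctorData B C) : Prop := ∃ G : B ⥤ᵖ C, of G = F

/-- A pseudofunctor as a lax functor. -/
def toLax (F : PseudofunctorData B C) : LaxFunctorData B C where
  toPrelaxFunctorStruct := F.toPrelaxFunctorStruct
  mapId a := (F.mapId a).inv
  mapComp f g := (F.mapComp f g).inv

end PseudofunctorData

/-- The data of a lax natural transformation between lax functors (no laws): 2-cells
`app b ∘ F f ⟶ G f ∘ app a`. (In Mathlib's terminology this direction is called oplax.) -/
structure LaxTransData (F G : LaxFunctorData B C) where
  app (a : B) : F.obj a ⟶ G.obj a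
  naturality {a b : B} (f : a ⟶ b) : F.map f ≫ app b ⟶ app a ≫ G.map f

/-- The laws of a lax natural transformation; they are those of `CategoryTheory.Lax.OplaxTrans`. -/
structure LaxTransData.IsLaxNatural {F G : LaxFunctorData B C} (θ : LaxTransData F G) : Prop where
  naturality_naturality {a b : B} {f g : a ⟶ b} (η : f ⟶ g) :
    F.map₂ η ▷ θ.app b ≫ θ.naturality g = θ.naturality f ≫ θ.app a ◁ G.map₂ η
  naturality_id (a : B) :
    F.mapId a ▷ θ.app a ≫ θ.naturality (𝟙 a) =
      (λ_ (θ.app a)).hom ≫ (ρ_ (θ.app a)).inv ≫ θ.app a ◁ G.mapId a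
  naturality_comp {a b c : B} (f : a ⟶ b) (g : b ⟶ c) :
    F.mapComp f g ▷ θ.app c ≫ θ.naturality (f ≫ g) =
      (α_ _ _ _).hom ≫ F.map f ◁ θ.naturality g ≫ (α_ _ _ _).inv ≫
        θ.naturality f ▷ G.map g ≫ (α_ _ _ _).hom ≫ θ.app a ◁ G.mapComp f g

/-- The data of a pseudonatural transformation (no laws). -/
structure PseudoTransData (F G : LaxFunctorData B C) where
  app (a : B) : F.obj a ⟶ G.obj a
  naturality {a b : B} (f : a ⟶ b) : F.map f ≫ app b ≅ app a ≫ G.map f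

/-- A pseudonatural transformation as a lax natural transformation. -/
def PseudoTransData.toLaxTransData {F G : LaxFunctorData B C} (θ : PseudoTransData F G) :
    LaxTransData F G where
  app := θ.app
  naturality f := (θ.naturality f).hom

/-- A 1-cell is an equivalence. -/
def IsEquivalenceCell {a b : B} (f : a ⟶ b) : Prop := ∃ e : a ≌ b, e.hom = f

/-- The laws of a pseudonatural equivalence: a pseudonatural transformation whose components are
equivalences. -/
structure PseudoTransData.IsPseudonaturalEquivalence {F G : LaxFunctorData B C}
    (θ : PseudoTransData F G) : Prop where
  natural : θ.toLaxTransData.IsLaxNatural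
  equivalence (a : B) : IsEquivalenceCell (θ.app a)

end Functors

/-! ## Monoidal bicategories (one-object tricategories) -/

section Monoidal

/-- The data of a tensor product on a bicategory (no laws), with a unit object. -/
structure TensorData (V : Type u) [Bicategory.{w, v} V] where
  tensor : PseudofunctorData (V × V) V
  unit : V

namespace TensorData

variable {V : Type u} [Bicategory.{w, v} V] (T : TensorData V)

/-- The tensor product of 0-cells. -/
abbrev ob (A B : V) : V := T.tensor.obj (A, B)

/-- The tensor product of 1-cells. -/
abbrev hom {A A' B B' : V} (f : A ⟶ A') (g : B ⟶ B') : T.ob A B ⟶ T.ob A' B' :=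
  T.tensor.map (f ×ₘ g)

/-- The tensor product of 2-cells. -/
abbrev hom₂ {A A' B B' : V} {f f' : A ⟶ A'} {g g' : B ⟶ B'} (φ : f ⟶ f') (ψ : g ⟶ g') :
    T.hom f g ⟶ T.hom f' g' :=
  T.tensor.map₂ (φ ×ₘ ψ)

local infixl:90 " ⊠ " => TensorData.ob T
local infixl:90 " ⊠₁ " => TensorData.hom T
local infixl:90 " ⊠₂ " => TensorData.hom₂ T

/-- Compatibility of the tensor product with identities. -/
def idIso (A B : V) : 𝟙 A ⊠₁ 𝟙 B ≅ 𝟙 (A ⊠ B) := T.tensor.mapId (A, B)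

/-- Compatibility of the tensor product with composition. -/
def compIso {A A' A'' B B' B'' : V} (f : A ⟶ A') (f' : A' ⟶ A'') (g : B ⟶ B') (g' : B' ⟶ B'') :
    (f ≫ f') ⊠₁ (g ≫ g') ≅ (f ⊠₁ g) ≫ (f' ⊠₁ g') :=
  T.tensor.mapComp (f ×ₘ g) (f' ×ₘ g')

/-- The functor `((A, B), C) ↦ (A ⊗ B) ⊗ C`. -/
def leftTriple : LaxFunctorData ((V × V) × V) V where
  obj p := p.1.1 ⊠ p.1.2 ⊠ p.2
  map f := f.1.1 ⊠₁ f.1.2 ⊠₁ f.2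
  map₂ φ := φ.1.1 ⊠₂ φ.1.2 ⊠₂ φ.2
  mapId p := (T.idIso (p.1.1 ⊠ p.1.2) p.2).inv ≫ ((T.idIso p.1.1 p.1.2).inv ⊠₂ 𝟙 (𝟙 p.2))
  mapComp f g := (T.compIso _ _ _ _).inv ≫ ((T.compIso f.1.1 g.1.1 f.1.2 g.1.2).inv ⊠₂ 𝟙 _)

/-- The functor `((A, B), C) ↦ A ⊗ (B ⊗ C)`. -/
def rightTriple : LaxFunctorData ((V × V) × V) V where
  obj p := p.1.1 ⊠ (p.1.2 ⊠ p.2)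
  map f := f.1.1 ⊠₁ (f.1.2 ⊠₁ f.2)
  map₂ φ := φ.1.1 ⊠₂ (φ.1.2 ⊠₂ φ.2)
  mapId p := (T.idIso p.1.1 (p.1.2 ⊠ p.2)).inv ≫ (𝟙 (𝟙 p.1.1) ⊠₂ (T.idIso p.1.2 p.2).inv)
  mapComp f g := (T.compIso _ _ _ _).inv ≫ (𝟙 _ ⊠₂ (T.compIso f.1.2 g.1.2 f.2 g.2).inv)

/-- `(1 ⊗ f) (1 ⊗ g) ⟶ 1 ⊗ f g`. -/
def joinL (A : V) {B B' B'' : V} (f : B ⟶ B') (g : B' ⟶ B'') :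
    (𝟙 A ⊠₁ f) ≫ (𝟙 A ⊠₁ g) ⟶ 𝟙 A ⊠₁ (f ≫ g) :=
  (T.compIso _ _ _ _).inv ≫ ((λ_ (𝟙 A)).hom ⊠₂ 𝟙 (f ≫ g))

/-- `1 ⊗ f g ⟶ (1 ⊗ f) (1 ⊗ g)`. -/
def splitL (A : V) {B B' B'' : V} (f : B ⟶ B') (g : B' ⟶ B'') :
    𝟙 A ⊠₁ (f ≫ g) ⟶ (𝟙 A ⊠₁ f) ≫ (𝟙 A ⊠₁ g) :=
  ((λ_ (𝟙 A)).inv ⊠₂ 𝟙 (f ≫ g)) ≫ (T.compIso _ _ _ _).hom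

/-- `(f ⊗ 1) (g ⊗ 1) ⟶ f g ⊗ 1`. -/
def joinR {B B' B'' : V} (f : B ⟶ B') (g : B' ⟶ B'') (A : V) :
    (f ⊠₁ 𝟙 A) ≫ (g ⊠₁ 𝟙 A) ⟶ (f ≫ g) ⊠₁ 𝟙 A :=
  (T.compIso _ _ _ _).inv ≫ (𝟙 (f ≫ g) ⊠₂ (λ_ (𝟙 A)).hom)

/-- `f g ⊗ 1 ⟶ (f ⊗ 1) (g ⊗ 1)`. -/
def splitR {B B' B'' : V} (f : B ⟶ B') (g : B' ⟶ B'') (A : V) :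
    (f ≫ g) ⊠₁ 𝟙 A ⟶ (f ⊠₁ 𝟙 A) ≫ (g ⊠₁ 𝟙 A) :=
  (𝟙 (f ≫ g) ⊠₂ (λ_ (𝟙 A)).inv) ≫ (T.compIso _ _ _ _).hom

/-- `(1 ⊗ f) (1 ⊗ g) (1 ⊗ h) ⟶ 1 ⊗ f g h`. -/
def joinL₃ (A : V) {B B' B'' C : V} (f : B ⟶ B') (g : B' ⟶ B'') (h : B'' ⟶ C) :
    (𝟙 A ⊠₁ f) ≫ (𝟙 A ⊠₁ g) ≫ (𝟙 A ⊠₁ h) ⟶ 𝟙 A ⊠₁ (f ≫ g ≫ h) :=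
  (𝟙 A ⊠₁ f) ◁ T.joinL A g h ≫ T.joinL A f (g ≫ h)

/-- `1 ⊗ f g h ⟶ (1 ⊗ f) (1 ⊗ g) (1 ⊗ h)`. -/
def splitL₃ (A : V) {B B' B'' C : V} (f : B ⟶ B') (g : B' ⟶ B'') (h : B'' ⟶ C) :
    𝟙 A ⊠₁ (f ≫ g ≫ h) ⟶ (𝟙 A ⊠₁ f) ≫ (𝟙 A ⊠₁ g) ≫ (𝟙 A ⊠₁ h) :=
  T.splitL A f (g ≫ h) ≫ (𝟙 A ⊠₁ f) ◁ T.splitL A g h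

/-- `(f ⊗ 1) (g ⊗ 1) (h ⊗ 1) ⟶ f g h ⊗ 1`. -/
def joinR₃ {B B' B'' C : V} (f : B ⟶ B') (g : B' ⟶ B'') (h : B'' ⟶ C) (A : V) :
    (f ⊠₁ 𝟙 A) ≫ (g ⊠₁ 𝟙 A) ≫ (h ⊠₁ 𝟙 A) ⟶ (f ≫ g ≫ h) ⊠₁ 𝟙 A :=
  (f ⊠₁ 𝟙 A) ◁ T.joinR g h A ≫ T.joinR f (g ≫ h) A

/-- `f g h ⊗ 1 ⟶ (f ⊗ 1) (g ⊗ 1) (h ⊗ 1)`. -/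
def splitR₃ {B B' B'' C : V} (f : B ⟶ B') (g : B' ⟶ B'') (h : B'' ⟶ C) (A : V) :
    (f ≫ g ≫ h) ⊠₁ 𝟙 A ⟶ (f ⊠₁ 𝟙 A) ≫ (g ⊠₁ 𝟙 A) ≫ (h ⊠₁ 𝟙 A) :=
  T.splitR f (g ≫ h) A ≫ (f ⊠₁ 𝟙 A) ◁ T.splitR g h A

/-- The square `k ⊗ θ`, for a 2-cell `θ` filling a square. -/
def squareL {A A' B B' C C' : V} (k : C ⟶ C') {p : A ⟶ A'} {b : A' ⟶ B'} {a : A ⟶ B} {q : B ⟶ B'}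
    (θ : p ≫ b ⟶ a ≫ q) : (k ⊠₁ p) ≫ (𝟙 C' ⊠₁ b) ⟶ (𝟙 C ⊠₁ a) ≫ (k ⊠₁ q) :=
  (T.compIso _ _ _ _).inv ≫ (((ρ_ k).hom ≫ (λ_ k).inv) ⊠₂ θ) ≫ (T.compIso _ _ _ _).hom

/-- The square `θ ⊗ k`, for a 2-cell `θ` filling a square. -/
def squareR {A A' B B' C C' : V} {p : A ⟶ A'} {b : A' ⟶ B'} {a : A ⟶ B} {q : B ⟶ B'}
    (θ : p ≫ b ⟶ a ≫ q) (k : C ⟶ C') : (p ⊠₁ k) ≫ (b ⊠₁ 𝟙 C') ⟶ (a ⊠₁ 𝟙 C) ≫ (q ⊠₁ k) :=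
  (T.compIso _ _ _ _).inv ≫ (θ ⊠₂ ((ρ_ k).hom ≫ (λ_ k).inv)) ≫ (T.compIso _ _ _ _).hom

/-- The interchange `(1 ⊗ g) (f ⊗ 1) ⟶ (f ⊗ 1) (1 ⊗ g)`. -/
def interchange {A A' B B' : V} (f : A ⟶ A') (g : B ⟶ B') :
    (𝟙 A ⊠₁ g) ≫ (f ⊠₁ 𝟙 B') ⟶ (f ⊠₁ 𝟙 B) ≫ (𝟙 A' ⊠₁ g) :=
  (T.compIso _ _ _ _).inv ≫
    (((λ_ f).hom ≫ (ρ_ f).inv) ⊠₂ ((ρ_ g).hom ≫ (λ_ g).inv)) ≫ (T.compIso _ _ _ _).hom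

/-- The functor `K ⊗ -`. -/
def unitLeft : LaxFunctorData V V where
  obj A := T.unit ⊠ A
  map f := 𝟙 T.unit ⊠₁ f
  map₂ φ := 𝟙 (𝟙 T.unit) ⊠₂ φ
  mapId A := (T.idIso T.unit A).inv
  mapComp f g := T.joinL T.unit f g

/-- The functor `- ⊗ K`. -/
def unitRight : LaxFunctorData V V where
  obj A := A ⊠ T.unit
  map f := f ⊠₁ 𝟙 T.unit
  map₂ φ := φ ⊠₂ 𝟙 (𝟙 T.unit)
  mapId A := (T.idIso A T.unit).inv
  mapComp f g := T.joinR f g T.unit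

end TensorData

/-- The data of the transformations of a monoidal bicategory (no laws): associativity
`a : (A ⊗ B) ⊗ C → A ⊗ (B ⊗ C)` and unitalities `l : K ⊗ A → A`, `r : A → A ⊗ K`. -/
structure PremonoidalData (V : Type u) [Bicategory.{w, v} V] extends TensorData V where
  assoc : PseudoTransData toTensorData.leftTriple toTensorData.rightTriple
  left : PseudoTransData toTensorData.unitLeft (LaxFunctorData.id V)
  right : PseudoTransData (LaxFunctorData.id V) toTensorData.unitRight

namespace PremonoidalData

variable {V : Type u} [Bicategory.{w, v} V] (M : PremonoidalData V)

local infixl:90 " ⊠ " => TensorData.ob (PremonoidalData.toTensorData M)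
local infixl:90 " ⊠₁ " => TensorData.hom (PremonoidalData.toTensorData M)
local infixl:90 " ⊠₂ " => TensorData.hom₂ (PremonoidalData.toTensorData M)

/-- The associativity 1-cell. -/
def a (A B C : V) : A ⊠ B ⊠ C ⟶ A ⊠ (B ⊠ C) := M.assoc.app ((A, B), C)

/-- Naturality of the associativity 1-cell. -/
def aNat {A A' B B' C C' : V} (f : A ⟶ A') (g : B ⟶ B') (h : C ⟶ C') :
    (f ⊠₁ g ⊠₁ h) ≫ M.a A' B' C' ≅ M.a A B C ≫ (f ⊠₁ (g ⊠₁ h)) :=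
  M.assoc.naturality (a := ((A, B), C)) (b := ((A', B'), C')) ((f ×ₘ g) ×ₘ h)

/-- The left unit 1-cell. -/
def l (A : V) : M.unit ⊠ A ⟶ A := M.left.app A

/-- Naturality of the left unit 1-cell. -/
def lNat {A A' : V} (f : A ⟶ A') : (𝟙 M.unit ⊠₁ f) ≫ M.l A' ≅ M.l A ≫ f := M.left.naturality f

/-- The right unit 1-cell. -/
def r (A : V) : A ⟶ A ⊠ M.unit := M.right.app A

/-- Naturality of the right unit 1-cell. -/
def rNat {A A' : V} (f : A ⟶ A') : f ≫ M.r A' ≅ M.r A ≫ (f ⊠₁ 𝟙 M.unit) := M.right.naturality f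

/-- Naturality of the associativity 1-cell in the first variable. -/
def aNatL {A A' : V} (f : A ⟶ A') (B C : V) :
    (f ⊠₁ 𝟙 B ⊠₁ 𝟙 C) ≫ M.a A' B C ⟶ M.a A B C ≫ (f ⊠₁ 𝟙 (B ⊠ C)) :=
  (M.aNat f (𝟙 B) (𝟙 C)).hom ≫ M.a A B C ◁ (𝟙 f ⊠₂ (M.idIso B C).hom)

/-- The inverse of `aNatL`. -/
def aNatLInv {A A' : V} (f : A ⟶ A') (B C : V) :
    M.a A B C ≫ (f ⊠₁ 𝟙 (B ⊠ C)) ⟶ (f ⊠₁ 𝟙 B ⊠₁ 𝟙 C) ≫ M.a A' B C :=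
  M.a A B C ◁ (𝟙 f ⊠₂ (M.idIso B C).inv) ≫ (M.aNat f (𝟙 B) (𝟙 C)).inv

/-- The inverse of naturality of the associativity 1-cell in the third variable. -/
def aNatRInv (A B : V) {C C' : V} (h : C ⟶ C') :
    M.a A B C ≫ (𝟙 A ⊠₁ (𝟙 B ⊠₁ h)) ⟶ (𝟙 (A ⊠ B) ⊠₁ h) ≫ M.a A B C' :=
  (M.aNat (𝟙 A) (𝟙 B) h).inv ≫ ((M.idIso A B).hom ⊠₂ 𝟙 h) ▷ M.a A B C'

end PremonoidalData

/-- The data of a monoidal bicategory (no laws). -/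
structure MonoidalBicategoryData (V : Type u) [Bicategory.{w, v} V] extends PremonoidalData V where
  /-- the pentagon modification -/
  π (A B C D : V) :
    toPremonoidalData.hom (toPremonoidalData.a A B C) (𝟙 D) ≫
      toPremonoidalData.a A (toPremonoidalData.ob B C) D ≫
        toPremonoidalData.hom (𝟙 A) (toPremonoidalData.a B C D) ≅
    toPremonoidalData.a (toPremonoidalData.ob A B) C D ≫
      toPremonoidalData.a A B (toPremonoidalData.ob C D)
  /-- the middle unit modification -/
  μ (A B : V) :
    toPremonoidalData.hom (toPremonoidalData.r A) (𝟙 B) ≫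
      toPremonoidalData.a A toPremonoidalData.unit B ≫
        toPremonoidalData.hom (𝟙 A) (toPremonoidalData.l B) ≅
    𝟙 (toPremonoidalData.ob A B)
  /-- the left unit modification -/
  lam (A B : V) :
    toPremonoidalData.hom (toPremonoidalData.l A) (𝟙 B) ≅
    toPremonoidalData.a toPremonoidalData.unit A B ≫
      toPremonoidalData.l (toPremonoidalData.ob A B)
  /-- the right unit modification -/
  rho (A B : V) :
    toPremonoidalData.hom (𝟙 A) (toPremonoidalData.r B) ≅
    toPremonoidalData.r (toPremonoidalData.ob A B) ≫
      toPremonoidalData.a A B toPremonoidalData.unit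

namespace MonoidalBicategoryData

variable {V : Type u} [Bicategory.{w, v} V] (M : MonoidalBicategoryData V)

local infixl:90 " ⊠ " => TensorData.ob (PremonoidalData.toTensorData (toPremonoidalData M))
local infixl:90 " ⊠₁ " => TensorData.hom (PremonoidalData.toTensorData (toPremonoidalData M))
local infixl:90 " ⊠₂ " => TensorData.hom₂ (PremonoidalData.toTensorData (toPremonoidalData M))

/-- The laws of a monoidal bicategory, that is, of a tricategory with one object: the tensor product
is a pseudofunctor, `a`, `l`, `r` are pseudonatural equivalences, `π`, `μ`, `lam`, `rho` are
modifications, and the three tricategory axioms (the non-abelian 4-cocycle condition and the left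
and right normalization conditions) hold. -/
structure IsMonoidalBicategory : Prop where
  tensor : M.tensor.IsPseudofunctor
  assoc : M.assoc.IsPseudonaturalEquivalence
  left : M.left.IsPseudonaturalEquivalence
  right : M.right.IsPseudonaturalEquivalence
  π_naturality {A A' B B' C C' D D' : V} (f : A ⟶ A') (g : B ⟶ B') (h : C ⟶ C') (k : D ⟶ D') :
    (f ⊠₁ g ⊠₁ h ⊠₁ k) ◁ (M.π A' B' C' D').hom
      ⊗≫ (M.aNat (f ⊠₁ g) h k).hom ▷ M.a A' B' (C' ⊠ D')
      ⊗≫ M.a (A ⊠ B) C D ◁ (M.aNat f g (h ⊠₁ k)).hom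
      ⊗≫ 𝟙 (M.a (A ⊠ B) C D ≫ M.a A B (C ⊠ D) ≫ (f ⊠₁ (g ⊠₁ (h ⊠₁ k)))) =
    𝟙 ((f ⊠₁ g ⊠₁ h ⊠₁ k) ≫
        (M.a A' B' C' ⊠₁ 𝟙 D') ≫ M.a A' (B' ⊠ C') D' ≫ (𝟙 A' ⊠₁ M.a B' C' D'))
      ⊗≫ M.squareR (M.aNat f g h).hom k ▷ (M.a A' (B' ⊠ C') D' ≫ (𝟙 A' ⊠₁ M.a B' C' D'))
      ⊗≫ (M.a A B C ⊠₁ 𝟙 D) ◁ (M.aNat f (g ⊠₁ h) k).hom ▷ (𝟙 A' ⊠₁ M.a B' C' D')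
      ⊗≫ (M.a A B C ⊠₁ 𝟙 D) ◁ M.a A (B ⊠ C) D ◁ M.squareL f (M.aNat g h k).hom
      ⊗≫ (M.π A B C D).hom ▷ (f ⊠₁ (g ⊠₁ (h ⊠₁ k)))
      ⊗≫ 𝟙 (M.a (A ⊠ B) C D ≫ M.a A B (C ⊠ D) ≫ (f ⊠₁ (g ⊠₁ (h ⊠₁ k))))
  μ_naturality {A A' B B' : V} (f : A ⟶ A') (g : B ⟶ B') :
    (f ⊠₁ g) ◁ (M.μ A' B').hom ⊗≫ 𝟙 (f ⊠₁ g) =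
    𝟙 ((f ⊠₁ g) ≫ (M.r A' ⊠₁ 𝟙 B') ≫ M.a A' M.unit B' ≫ (𝟙 A' ⊠₁ M.l B'))
      ⊗≫ M.squareR (M.rNat f).hom g ▷ (M.a A' M.unit B' ≫ (𝟙 A' ⊠₁ M.l B'))
      ⊗≫ (M.r A ⊠₁ 𝟙 B) ◁ (M.aNat f (𝟙 M.unit) g).hom ▷ (𝟙 A' ⊠₁ M.l B')
      ⊗≫ (M.r A ⊠₁ 𝟙 B) ◁ M.a A M.unit B ◁ M.squareL f (M.lNat g).hom
      ⊗≫ (M.μ A B).hom ▷ (f ⊠₁ g)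
      ⊗≫ 𝟙 (f ⊠₁ g)
  lam_naturality {A A' B B' : V} (f : A ⟶ A') (g : B ⟶ B') :
    (𝟙 M.unit ⊠₁ f ⊠₁ g) ◁ (M.lam A' B').hom
      ⊗≫ (M.aNat (𝟙 M.unit) f g).hom ▷ M.l (A' ⊠ B')
      ⊗≫ M.a M.unit A B ◁ (M.lNat (f ⊠₁ g)).hom
      ⊗≫ 𝟙 (M.a M.unit A B ≫ M.l (A ⊠ B) ≫ (f ⊠₁ g)) =
    M.squareR (M.lNat f).hom g
      ⊗≫ (M.lam A B).hom ▷ (f ⊠₁ g)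
      ⊗≫ 𝟙 (M.a M.unit A B ≫ M.l (A ⊠ B) ≫ (f ⊠₁ g))
  rho_naturality {A A' B B' : V} (f : A ⟶ A') (g : B ⟶ B') :
    (f ⊠₁ g) ◁ (M.rho A' B').hom
      ⊗≫ (M.rNat (f ⊠₁ g)).hom ▷ M.a A' B' M.unit
      ⊗≫ M.r (A ⊠ B) ◁ (M.aNat f g (𝟙 M.unit)).hom
      ⊗≫ 𝟙 (M.r (A ⊠ B) ≫ M.a A B M.unit ≫ (f ⊠₁ (g ⊠₁ 𝟙 M.unit))) =
    M.squareL f (M.rNat g).hom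
      ⊗≫ (M.rho A B).hom ▷ (f ⊠₁ (g ⊠₁ 𝟙 M.unit))
      ⊗≫ 𝟙 (M.r (A ⊠ B) ≫ M.a A B M.unit ≫ (f ⊠₁ (g ⊠₁ 𝟙 M.unit)))
  cocycle (A B C D E : V) :
    𝟙 ((M.a A B C ⊠₁ 𝟙 D ⊠₁ 𝟙 E) ≫ (M.a A (B ⊠ C) D ⊠₁ 𝟙 E) ≫ (𝟙 A ⊠₁ M.a B C D ⊠₁ 𝟙 E) ≫
        M.a A (B ⊠ (C ⊠ D)) E ≫ (𝟙 A ⊠₁ M.a B (C ⊠ D) E) ≫ (𝟙 A ⊠₁ (𝟙 B ⊠₁ M.a C D E)))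
      ⊗≫ (M.joinR₃ (M.a A B C ⊠₁ 𝟙 D) (M.a A (B ⊠ C) D) (𝟙 A ⊠₁ M.a B C D) E ≫
          ((M.π A B C D).hom ⊠₂ 𝟙 (𝟙 E)) ≫ M.splitR (M.a (A ⊠ B) C D) (M.a A B (C ⊠ D)) E) ▷
        (M.a A (B ⊠ (C ⊠ D)) E ≫ (𝟙 A ⊠₁ M.a B (C ⊠ D) E) ≫ (𝟙 A ⊠₁ (𝟙 B ⊠₁ M.a C D E)))
      ⊗≫ (M.a (A ⊠ B) C D ⊠₁ 𝟙 E) ◁ (M.π A B (C ⊠ D) E).hom ▷ (𝟙 A ⊠₁ (𝟙 B ⊠₁ M.a C D E))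
      ⊗≫ (M.a (A ⊠ B) C D ⊠₁ 𝟙 E) ◁ M.a (A ⊠ B) (C ⊠ D) E ◁ M.aNatRInv A B (M.a C D E)
      ⊗≫ (M.π (A ⊠ B) C D E).hom ▷ M.a A B (C ⊠ (D ⊠ E))
      ⊗≫ 𝟙 (M.a (A ⊠ B ⊠ C) D E ≫ M.a (A ⊠ B) C (D ⊠ E) ≫ M.a A B (C ⊠ (D ⊠ E))) =
    𝟙 ((M.a A B C ⊠₁ 𝟙 D ⊠₁ 𝟙 E) ≫ (M.a A (B ⊠ C) D ⊠₁ 𝟙 E) ≫ (𝟙 A ⊠₁ M.a B C D ⊠₁ 𝟙 E) ≫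
        M.a A (B ⊠ (C ⊠ D)) E ≫ (𝟙 A ⊠₁ M.a B (C ⊠ D) E) ≫ (𝟙 A ⊠₁ (𝟙 B ⊠₁ M.a C D E)))
      ⊗≫ (M.a A B C ⊠₁ 𝟙 D ⊠₁ 𝟙 E) ◁ (M.a A (B ⊠ C) D ⊠₁ 𝟙 E) ◁
        (M.aNat (𝟙 A) (M.a B C D) (𝟙 E)).hom ▷
          ((𝟙 A ⊠₁ M.a B (C ⊠ D) E) ≫ (𝟙 A ⊠₁ (𝟙 B ⊠₁ M.a C D E)))
      ⊗≫ (M.a A B C ⊠₁ 𝟙 D ⊠₁ 𝟙 E) ◁ (M.a A (B ⊠ C) D ⊠₁ 𝟙 E) ◁ M.a A (B ⊠ C ⊠ D) E ◁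
        (M.joinL₃ A (M.a B C D ⊠₁ 𝟙 E) (M.a B (C ⊠ D) E) (𝟙 B ⊠₁ M.a C D E) ≫
          (𝟙 (𝟙 A) ⊠₂ (M.π B C D E).hom) ≫ M.splitL A (M.a (B ⊠ C) D E) (M.a B C (D ⊠ E)))
      ⊗≫ (M.a A B C ⊠₁ 𝟙 D ⊠₁ 𝟙 E) ◁ (M.π A (B ⊠ C) D E).hom ▷ (𝟙 A ⊠₁ M.a B C (D ⊠ E))
      ⊗≫ M.aNatL (M.a A B C) D E ▷ (M.a A (B ⊠ C) (D ⊠ E) ≫ (𝟙 A ⊠₁ M.a B C (D ⊠ E)))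
      ⊗≫ M.a (A ⊠ B ⊠ C) D E ◁ (M.π A B C (D ⊠ E)).hom
      ⊗≫ 𝟙 (M.a (A ⊠ B ⊠ C) D E ≫ M.a (A ⊠ B) C (D ⊠ E) ≫ M.a A B (C ⊠ (D ⊠ E)))
  left_normalization (A B C : V) :
    𝟙 ((M.r A ⊠₁ 𝟙 B ⊠₁ 𝟙 C) ≫ (M.a A M.unit B ⊠₁ 𝟙 C) ≫ M.a A (M.unit ⊠ B) C ≫
        (𝟙 A ⊠₁ M.a M.unit B C) ≫ (𝟙 A ⊠₁ M.l (B ⊠ C)))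
      ⊗≫ (M.r A ⊠₁ 𝟙 B ⊠₁ 𝟙 C) ◁ (M.π A M.unit B C).hom ▷ (𝟙 A ⊠₁ M.l (B ⊠ C))
      ⊗≫ M.aNatL (M.r A) B C ▷ (M.a A M.unit (B ⊠ C) ≫ (𝟙 A ⊠₁ M.l (B ⊠ C)))
      ⊗≫ M.a A B C ◁ (M.μ A (B ⊠ C)).hom
      ⊗≫ 𝟙 (M.a A B C) =
    𝟙 ((M.r A ⊠₁ 𝟙 B ⊠₁ 𝟙 C) ≫ (M.a A M.unit B ⊠₁ 𝟙 C) ≫ M.a A (M.unit ⊠ B) C ≫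
        (𝟙 A ⊠₁ M.a M.unit B C) ≫ (𝟙 A ⊠₁ M.l (B ⊠ C)))
      ⊗≫ (M.r A ⊠₁ 𝟙 B ⊠₁ 𝟙 C) ◁ (M.a A M.unit B ⊠₁ 𝟙 C) ◁ M.a A (M.unit ⊠ B) C ◁
        (M.joinL A (M.a M.unit B C) (M.l (B ⊠ C)) ≫ (𝟙 (𝟙 A) ⊠₂ (M.lam B C).inv))
      ⊗≫ (M.r A ⊠₁ 𝟙 B ⊠₁ 𝟙 C) ◁ (M.a A M.unit B ⊠₁ 𝟙 C) ◁
        (M.aNat (𝟙 A) (M.l B) (𝟙 C)).inv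
      ⊗≫ (M.joinR₃ (M.r A ⊠₁ 𝟙 B) (M.a A M.unit B) (𝟙 A ⊠₁ M.l B) C ≫
          ((M.μ A B).hom ⊠₂ 𝟙 (𝟙 C)) ≫ (M.idIso (A ⊠ B) C).hom) ▷ M.a A B C
      ⊗≫ 𝟙 (M.a A B C)
  right_normalization (A B C : V) :
    𝟙 ((M.r (A ⊠ B) ⊠₁ 𝟙 C) ≫ (M.a A B M.unit ⊠₁ 𝟙 C) ≫ M.a A (B ⊠ M.unit) C ≫
        (𝟙 A ⊠₁ M.a B M.unit C) ≫ (𝟙 A ⊠₁ (𝟙 B ⊠₁ M.l C)))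
      ⊗≫ (M.r (A ⊠ B) ⊠₁ 𝟙 C) ◁ (M.π A B M.unit C).hom ▷ (𝟙 A ⊠₁ (𝟙 B ⊠₁ M.l C))
      ⊗≫ (M.r (A ⊠ B) ⊠₁ 𝟙 C) ◁ M.a (A ⊠ B) M.unit C ◁ M.aNatRInv A B (M.l C)
      ⊗≫ (M.μ (A ⊠ B) C).hom ▷ M.a A B C
      ⊗≫ 𝟙 (M.a A B C) =
    𝟙 ((M.r (A ⊠ B) ⊠₁ 𝟙 C) ≫ (M.a A B M.unit ⊠₁ 𝟙 C) ≫ M.a A (B ⊠ M.unit) C ≫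
        (𝟙 A ⊠₁ M.a B M.unit C) ≫ (𝟙 A ⊠₁ (𝟙 B ⊠₁ M.l C)))
      ⊗≫ (M.joinR (M.r (A ⊠ B)) (M.a A B M.unit) C ≫ ((M.rho A B).inv ⊠₂ 𝟙 (𝟙 C))) ▷
        (M.a A (B ⊠ M.unit) C ≫ (𝟙 A ⊠₁ M.a B M.unit C) ≫ (𝟙 A ⊠₁ (𝟙 B ⊠₁ M.l C)))
      ⊗≫ (M.aNat (𝟙 A) (M.r B) (𝟙 C)).hom ▷
        ((𝟙 A ⊠₁ M.a B M.unit C) ≫ (𝟙 A ⊠₁ (𝟙 B ⊠₁ M.l C)))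
      ⊗≫ M.a A B C ◁ (M.joinL₃ A (M.r B ⊠₁ 𝟙 C) (M.a B M.unit C) (𝟙 B ⊠₁ M.l C) ≫
          (𝟙 (𝟙 A) ⊠₂ (M.μ B C).hom) ≫ (M.idIso A (B ⊠ C)).hom)
      ⊗≫ 𝟙 (M.a A B C)

end MonoidalBicategoryData

end Monoidal

/-! ## Monoidal lax functors -/

section MonoidalLax

variable {V : Type u₁} [Bicategory.{w₁, v₁} V] {W : Type u₂} [Bicategory.{w₂, v₂} W]

/-- The product compatibility of a monoidal lax functor: the data of a lax natural transformation
`F A ⊗ F B → F (A ⊗ B)`. -/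
abbrev ProductCompatibility (M : TensorData V) (N : TensorData W) (F : LaxFunctorData V W) :=
  LaxTransData (F.square.comp N.tensor.toLax) (M.tensor.toLax.comp F)

namespace ProductCompatibility

variable {M : TensorData V} {N : TensorData W} {F : LaxFunctorData V W}
  (χ : ProductCompatibility M N F)

/-- The component `F A ⊗ F B ⟶ F (A ⊗ B)`. -/
def comp (A B : V) : N.ob (F.obj A) (F.obj B) ⟶ F.obj (M.ob A B) := χ.app (A, B)

/-- The naturality 2-cell. -/
def nat {A A' B B' : V} (f : A ⟶ A') (g : B ⟶ B') :
    N.hom (F.map f) (F.map g) ≫ χ.comp A' B' ⟶ χ.comp A B ≫ F.map (M.hom f g) :=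
  χ.naturality (a := (A, B)) (b := (A', B')) (f ×ₘ g)

/-- The naturality 2-cell for `F f ⊗ 1`, using the unit comparison of `F`. -/
def natL {A A' : V} (f : A ⟶ A') (B : V) :
    N.hom (F.map f) (𝟙 (F.obj B)) ≫ χ.comp A' B ⟶ χ.comp A B ≫ F.map (M.hom f (𝟙 B)) :=
  N.hom₂ (𝟙 (F.map f)) (F.mapId B) ▷ χ.comp A' B ≫ χ.nat f (𝟙 B)

/-- The naturality 2-cell for `1 ⊗ F g`, using the unit comparison of `F`. -/
def natR (A : V) {B B' : V} (g : B ⟶ B') :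
    N.hom (𝟙 (F.obj A)) (F.map g) ≫ χ.comp A B' ⟶ χ.comp A B ≫ F.map (M.hom (𝟙 A) g) :=
  N.hom₂ (F.mapId A) (𝟙 (F.map g)) ▷ χ.comp A B' ≫ χ.nat (𝟙 A) g

end ProductCompatibility

/-- The data of a monoidal lax functor (no laws): a lax functor `F`, the product compatibility `χ`
and the unit compatibility `ι : K → F K`, and invertible 2-cells `ω`, `γ`, `δ` relating them to the
associativity and unitality 1-cells. (The naturality 2-cell of the unit compatibility, at the
identity 1-cell of the unit object, is determined by the unit law of lax natural transformations,
hence not listed.) -/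
structure MonoidalLaxFunctorData (M : MonoidalBicategoryData V) (N : MonoidalBicategoryData W) where
  F : LaxFunctorData V W
  χ : ProductCompatibility M.toTensorData N.toTensorData F
  ι : N.unit ⟶ F.obj M.unit
  ω (A B C : V) :
    N.a (F.obj A) (F.obj B) (F.obj C) ≫ N.hom (𝟙 (F.obj A)) (χ.comp B C) ≫ χ.comp A (M.ob B C) ≅
    N.hom (χ.comp A B) (𝟙 (F.obj C)) ≫ χ.comp (M.ob A B) C ≫ F.map (M.a A B C)
  γ (A : V) :
    N.l (F.obj A) ≅ N.hom ι (𝟙 (F.obj A)) ≫ χ.comp M.unit A ≫ F.map (M.l A)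
  δ (A : V) :
    N.r (F.obj A) ≫ N.hom (𝟙 (F.obj A)) ι ≫ χ.comp A M.unit ≅ F.map (M.r A)

namespace MonoidalLaxFunctorData

variable {M : MonoidalBicategoryData V} {N : MonoidalBicategoryData W}
  (H : MonoidalLaxFunctorData M N)

/-- The naturality square of the unit compatibility at an identity 1-cell. -/
def ιNat : 𝟙 N.unit ≫ H.ι ⟶ H.ι ≫ 𝟙 (H.F.obj M.unit) := (λ_ H.ι).hom ≫ (ρ_ H.ι).inv

/-- The laws of a monoidal lax functor: `F` is a lax functor, `χ` is lax natural, `ω`, `γ`, `δ` are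
modifications, and the associativity and unit axioms hold. As `F` is only lax, both sides of each
equation are compared after composing with `F x ≫ F y ⟶ F (x ≫ y)`. -/
structure IsMonoidalLaxFunctor : Prop where
  lax : H.F.IsLaxFunctor
  χ_natural : H.χ.IsLaxNatural
  ω_naturality {A A' B B' C C' : V} (f : A ⟶ A') (g : B ⟶ B') (h : C ⟶ C') :
    𝟙 (N.hom (N.hom (H.F.map f) (H.F.map g)) (H.F.map h) ≫
        N.a (H.F.obj A') (H.F.obj B') (H.F.obj C') ≫
        N.hom (𝟙 (H.F.obj A')) (H.χ.comp B' C') ≫ H.χ.comp A' (M.ob B' C'))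
      ⊗≫ (N.aNat (H.F.map f) (H.F.map g) (H.F.map h)).hom ▷
        (N.hom (𝟙 (H.F.obj A')) (H.χ.comp B' C') ≫ H.χ.comp A' (M.ob B' C'))
      ⊗≫ N.a (H.F.obj A) (H.F.obj B) (H.F.obj C) ◁
        N.squareL (H.F.map f) (H.χ.nat g h) ▷ H.χ.comp A' (M.ob B' C')
      ⊗≫ N.a (H.F.obj A) (H.F.obj B) (H.F.obj C) ◁
        N.hom (𝟙 (H.F.obj A)) (H.χ.comp B C) ◁ H.χ.nat f (M.hom g h)
      ⊗≫ (H.ω A B C).hom ▷ H.F.map (M.hom f (M.hom g h))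
      ⊗≫ N.hom (H.χ.comp A B) (𝟙 (H.F.obj C)) ◁ H.χ.comp (M.ob A B) C ◁
        H.F.mapComp (M.a A B C) (M.hom f (M.hom g h)) =
    N.hom (N.hom (H.F.map f) (H.F.map g)) (H.F.map h) ◁ (H.ω A' B' C').hom
      ⊗≫ N.squareR (H.χ.nat f g) (H.F.map h) ▷
        (H.χ.comp (M.ob A' B') C' ≫ H.F.map (M.a A' B' C'))
      ⊗≫ N.hom (H.χ.comp A B) (𝟙 (H.F.obj C)) ◁ H.χ.nat (M.hom f g) h ▷ H.F.map (M.a A' B' C')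
      ⊗≫ N.hom (H.χ.comp A B) (𝟙 (H.F.obj C)) ◁ H.χ.comp (M.ob A B) C ◁
        (H.F.mapComp (M.hom (M.hom f g) h) (M.a A' B' C') ≫ H.F.map₂ (M.aNat f g h).hom)
  γ_naturality {A A' : V} (f : A ⟶ A') :
    (N.lNat (H.F.map f)).hom
      ⊗≫ (H.γ A).hom ▷ H.F.map f
      ⊗≫ N.hom H.ι (𝟙 (H.F.obj A)) ◁ H.χ.comp M.unit A ◁ H.F.mapComp (M.l A) f =
    N.hom (𝟙 N.unit) (H.F.map f) ◁ (H.γ A').hom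
      ⊗≫ N.squareR H.ιNat (H.F.map f) ▷ (H.χ.comp M.unit A' ≫ H.F.map (M.l A'))
      ⊗≫ N.hom H.ι (𝟙 (H.F.obj A)) ◁ H.χ.natR M.unit f ▷ H.F.map (M.l A')
      ⊗≫ N.hom H.ι (𝟙 (H.F.obj A)) ◁ H.χ.comp M.unit A ◁
        (H.F.mapComp (M.hom (𝟙 M.unit) f) (M.l A') ≫ H.F.map₂ (M.lNat f).hom)
  δ_naturality {A A' : V} (f : A ⟶ A') :
    𝟙 (H.F.map f ≫ N.r (H.F.obj A') ≫ N.hom (𝟙 (H.F.obj A')) H.ι ≫ H.χ.comp A' M.unit)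
      ⊗≫ (N.rNat (H.F.map f)).hom ▷ (N.hom (𝟙 (H.F.obj A')) H.ι ≫ H.χ.comp A' M.unit)
      ⊗≫ N.r (H.F.obj A) ◁ N.squareL (H.F.map f) H.ιNat ▷ H.χ.comp A' M.unit
      ⊗≫ N.r (H.F.obj A) ◁ N.hom (𝟙 (H.F.obj A)) H.ι ◁ H.χ.natL f M.unit
      ⊗≫ (H.δ A).hom ▷ H.F.map (M.hom f (𝟙 M.unit))
      ⊗≫ H.F.mapComp (M.r A) (M.hom f (𝟙 M.unit)) =
    H.F.map f ◁ (H.δ A').hom ≫ H.F.mapComp f (M.r A') ≫ H.F.map₂ (M.rNat f).hom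
  associativity (A B C D : V) :
    𝟙 (N.hom (N.a (H.F.obj A) (H.F.obj B) (H.F.obj C)) (𝟙 (H.F.obj D)) ≫
        N.a (H.F.obj A) (N.ob (H.F.obj B) (H.F.obj C)) (H.F.obj D) ≫
        N.hom (𝟙 (H.F.obj A)) (N.a (H.F.obj B) (H.F.obj C) (H.F.obj D)) ≫
        N.hom (𝟙 (H.F.obj A)) (N.hom (𝟙 (H.F.obj B)) (H.χ.comp C D)) ≫
        N.hom (𝟙 (H.F.obj A)) (H.χ.comp B (M.ob C D)) ≫ H.χ.comp A (M.ob B (M.ob C D)))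
      ⊗≫ (N.π (H.F.obj A) (H.F.obj B) (H.F.obj C) (H.F.obj D)).hom ▷
        (N.hom (𝟙 (H.F.obj A)) (N.hom (𝟙 (H.F.obj B)) (H.χ.comp C D)) ≫
          N.hom (𝟙 (H.F.obj A)) (H.χ.comp B (M.ob C D)) ≫ H.χ.comp A (M.ob B (M.ob C D)))
      ⊗≫ N.a (N.ob (H.F.obj A) (H.F.obj B)) (H.F.obj C) (H.F.obj D) ◁
        N.aNatRInv (H.F.obj A) (H.F.obj B) (H.χ.comp C D) ▷
          (N.hom (𝟙 (H.F.obj A)) (H.χ.comp B (M.ob C D)) ≫ H.χ.comp A (M.ob B (M.ob C D)))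
      ⊗≫ N.a (N.ob (H.F.obj A) (H.F.obj B)) (H.F.obj C) (H.F.obj D) ◁
        N.hom (𝟙 (N.ob (H.F.obj A) (H.F.obj B))) (H.χ.comp C D) ◁ (H.ω A B (M.ob C D)).hom
      ⊗≫ N.a (N.ob (H.F.obj A) (H.F.obj B)) (H.F.obj C) (H.F.obj D) ◁
        N.interchange (H.χ.comp A B) (H.χ.comp C D) ▷
          (H.χ.comp (M.ob A B) (M.ob C D) ≫ H.F.map (M.a A B (M.ob C D)))
      ⊗≫ N.aNatLInv (H.χ.comp A B) (H.F.obj C) (H.F.obj D) ▷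
        (N.hom (𝟙 (H.F.obj (M.ob A B))) (H.χ.comp C D) ≫
          H.χ.comp (M.ob A B) (M.ob C D) ≫ H.F.map (M.a A B (M.ob C D)))
      ⊗≫ N.hom (N.hom (H.χ.comp A B) (𝟙 (H.F.obj C))) (𝟙 (H.F.obj D)) ◁
        (H.ω (M.ob A B) C D).hom ▷ H.F.map (M.a A B (M.ob C D))
      ⊗≫ N.hom (N.hom (H.χ.comp A B) (𝟙 (H.F.obj C))) (𝟙 (H.F.obj D)) ◁
        N.hom (H.χ.comp (M.ob A B) C) (𝟙 (H.F.obj D)) ◁ H.χ.comp (M.ob (M.ob A B) C) D ◁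
          H.F.mapComp (M.a (M.ob A B) C D) (M.a A B (M.ob C D)) =
    𝟙 (N.hom (N.a (H.F.obj A) (H.F.obj B) (H.F.obj C)) (𝟙 (H.F.obj D)) ≫
        N.a (H.F.obj A) (N.ob (H.F.obj B) (H.F.obj C)) (H.F.obj D) ≫
        N.hom (𝟙 (H.F.obj A)) (N.a (H.F.obj B) (H.F.obj C) (H.F.obj D)) ≫
        N.hom (𝟙 (H.F.obj A)) (N.hom (𝟙 (H.F.obj B)) (H.χ.comp C D)) ≫
        N.hom (𝟙 (H.F.obj A)) (H.χ.comp B (M.ob C D)) ≫ H.χ.comp A (M.ob B (M.ob C D)))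
      ⊗≫ N.hom (N.a (H.F.obj A) (H.F.obj B) (H.F.obj C)) (𝟙 (H.F.obj D)) ◁
        N.a (H.F.obj A) (N.ob (H.F.obj B) (H.F.obj C)) (H.F.obj D) ◁
          (N.joinL₃ (H.F.obj A) (N.a (H.F.obj B) (H.F.obj C) (H.F.obj D))
              (N.hom (𝟙 (H.F.obj B)) (H.χ.comp C D)) (H.χ.comp B (M.ob C D)) ≫
            N.hom₂ (𝟙 (𝟙 (H.F.obj A))) (H.ω B C D).hom ≫
            N.splitL₃ (H.F.obj A) (N.hom (H.χ.comp B C) (𝟙 (H.F.obj D)))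
              (H.χ.comp (M.ob B C) D) (H.F.map (M.a B C D))) ▷ H.χ.comp A (M.ob B (M.ob C D))
      ⊗≫ N.hom (N.a (H.F.obj A) (H.F.obj B) (H.F.obj C)) (𝟙 (H.F.obj D)) ◁
        N.a (H.F.obj A) (N.ob (H.F.obj B) (H.F.obj C)) (H.F.obj D) ◁
          N.hom (𝟙 (H.F.obj A)) (N.hom (H.χ.comp B C) (𝟙 (H.F.obj D))) ◁
            N.hom (𝟙 (H.F.obj A)) (H.χ.comp (M.ob B C) D) ◁ H.χ.natR A (M.a B C D)
      ⊗≫ N.hom (N.a (H.F.obj A) (H.F.obj B) (H.F.obj C)) (𝟙 (H.F.obj D)) ◁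
        (N.aNat (𝟙 (H.F.obj A)) (H.χ.comp B C) (𝟙 (H.F.obj D))).inv ▷
          (N.hom (𝟙 (H.F.obj A)) (H.χ.comp (M.ob B C) D) ≫ H.χ.comp A (M.ob (M.ob B C) D) ≫
            H.F.map (M.hom (𝟙 A) (M.a B C D)))
      ⊗≫ N.hom (N.a (H.F.obj A) (H.F.obj B) (H.F.obj C)) (𝟙 (H.F.obj D)) ◁
        N.hom (N.hom (𝟙 (H.F.obj A)) (H.χ.comp B C)) (𝟙 (H.F.obj D)) ◁
          (H.ω A (M.ob B C) D).hom ▷ H.F.map (M.hom (𝟙 A) (M.a B C D))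
      ⊗≫ (N.joinR₃ (N.a (H.F.obj A) (H.F.obj B) (H.F.obj C))
            (N.hom (𝟙 (H.F.obj A)) (H.χ.comp B C)) (H.χ.comp A (M.ob B C)) (H.F.obj D) ≫
          N.hom₂ (H.ω A B C).hom (𝟙 (𝟙 (H.F.obj D))) ≫
          N.splitR₃ (N.hom (H.χ.comp A B) (𝟙 (H.F.obj C))) (H.χ.comp (M.ob A B) C)
            (H.F.map (M.a A B C)) (H.F.obj D)) ▷
        (H.χ.comp (M.ob A (M.ob B C)) D ≫ H.F.map (M.a A (M.ob B C) D) ≫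
          H.F.map (M.hom (𝟙 A) (M.a B C D)))
      ⊗≫ N.hom (N.hom (H.χ.comp A B) (𝟙 (H.F.obj C))) (𝟙 (H.F.obj D)) ◁
        N.hom (H.χ.comp (M.ob A B) C) (𝟙 (H.F.obj D)) ◁ H.χ.natL (M.a A B C) D ▷
          (H.F.map (M.a A (M.ob B C) D) ≫ H.F.map (M.hom (𝟙 A) (M.a B C D)))
      ⊗≫ N.hom (N.hom (H.χ.comp A B) (𝟙 (H.F.obj C))) (𝟙 (H.F.obj D)) ◁
        N.hom (H.χ.comp (M.ob A B) C) (𝟙 (H.F.obj D)) ◁ H.χ.comp (M.ob (M.ob A B) C) D ◁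
          (H.F.map (M.hom (M.a A B C) (𝟙 D)) ◁
              H.F.mapComp (M.a A (M.ob B C) D) (M.hom (𝟙 A) (M.a B C D)) ≫
            H.F.mapComp (M.hom (M.a A B C) (𝟙 D))
              (M.a A (M.ob B C) D ≫ M.hom (𝟙 A) (M.a B C D)) ≫
            H.F.map₂ (M.π A B C D).hom)
  unitality (A B : V) :
    𝟙 (N.hom (N.r (H.F.obj A)) (𝟙 (H.F.obj B)) ≫ N.a (H.F.obj A) N.unit (H.F.obj B) ≫
        N.hom (𝟙 (H.F.obj A)) (N.l (H.F.obj B)) ≫ H.χ.comp A B)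
      ⊗≫ (N.μ (H.F.obj A) (H.F.obj B)).hom ▷ H.χ.comp A B
      ⊗≫ H.χ.comp A B ◁ H.F.mapId (M.ob A B) =
    𝟙 (N.hom (N.r (H.F.obj A)) (𝟙 (H.F.obj B)) ≫ N.a (H.F.obj A) N.unit (H.F.obj B) ≫
        N.hom (𝟙 (H.F.obj A)) (N.l (H.F.obj B)) ≫ H.χ.comp A B)
      ⊗≫ N.hom (N.r (H.F.obj A)) (𝟙 (H.F.obj B)) ◁ N.a (H.F.obj A) N.unit (H.F.obj B) ◁
        (N.hom₂ (𝟙 (𝟙 (H.F.obj A))) (H.γ B).hom ≫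
          N.splitL₃ (H.F.obj A) (N.hom H.ι (𝟙 (H.F.obj B))) (H.χ.comp M.unit B)
            (H.F.map (M.l B))) ▷ H.χ.comp A B
      ⊗≫ N.hom (N.r (H.F.obj A)) (𝟙 (H.F.obj B)) ◁ N.a (H.F.obj A) N.unit (H.F.obj B) ◁
        N.hom (𝟙 (H.F.obj A)) (N.hom H.ι (𝟙 (H.F.obj B))) ◁
          N.hom (𝟙 (H.F.obj A)) (H.χ.comp M.unit B) ◁ H.χ.natR A (M.l B)
      ⊗≫ N.hom (N.r (H.F.obj A)) (𝟙 (H.F.obj B)) ◁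
        (N.aNat (𝟙 (H.F.obj A)) H.ι (𝟙 (H.F.obj B))).inv ▷
          (N.hom (𝟙 (H.F.obj A)) (H.χ.comp M.unit B) ≫ H.χ.comp A (M.ob M.unit B) ≫
            H.F.map (M.hom (𝟙 A) (M.l B)))
      ⊗≫ N.hom (N.r (H.F.obj A)) (𝟙 (H.F.obj B)) ◁
        N.hom (N.hom (𝟙 (H.F.obj A)) H.ι) (𝟙 (H.F.obj B)) ◁
          (H.ω A M.unit B).hom ▷ H.F.map (M.hom (𝟙 A) (M.l B))
      ⊗≫ (N.joinR₃ (N.r (H.F.obj A)) (N.hom (𝟙 (H.F.obj A)) H.ι) (H.χ.comp A M.unit)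
            (H.F.obj B) ≫
          N.hom₂ (H.δ A).hom (𝟙 (𝟙 (H.F.obj B)))) ▷
        (H.χ.comp (M.ob A M.unit) B ≫ H.F.map (M.a A M.unit B) ≫
          H.F.map (M.hom (𝟙 A) (M.l B)))
      ⊗≫ H.χ.natL (M.r A) B ▷ (H.F.map (M.a A M.unit B) ≫ H.F.map (M.hom (𝟙 A) (M.l B)))
      ⊗≫ H.χ.comp A B ◁
        (H.F.map (M.hom (M.r A) (𝟙 B)) ◁
            H.F.mapComp (M.a A M.unit B) (M.hom (𝟙 A) (M.l B)) ≫
          H.F.mapComp (M.hom (M.r A) (𝟙 B)) (M.a A M.unit B ≫ M.hom (𝟙 A) (M.l B)) ≫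
          H.F.map₂ (M.μ A B).hom)

end MonoidalLaxFunctorData

end MonoidalLax

/-! ## The induced structures on `Span|V` -/

section Induced

/-- The operations of `Span|V`. -/
def LabelledSet.bicategoryData (V : Type u) [Bicategory.{w, v} V] :
    BicategoryData.{max w s, max v (s + 1)} (LabelledSet.{s} V) where
  Hom X Y := LabelledSpan X Y
  Hom₂ A B := SpanMap A B
  id X := LabelledSpan.id X
  comp A B := LabelledSpan.comp A B
  id₂ A := SpanMap.id A
  vcomp f g := SpanMap.comp f g
  hcomp {_ _ _ _ A' B _} f g :=
    { map := fun p => ⟨g.map p.fst, f.map p.snd, p.mid, (g.r_map _).trans p.fst_r,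
        (f.l_map _).trans p.snd_l⟩
      l_map := fun p => g.l_map p.fst
      r_map := fun p => f.r_map p.snd
      lab := fun p _ _ hi hj =>
        f.lab p.snd hi p.snd_l ▷ B.lab p.fst p.fst_r hj ≫
          A'.lab (f.map p.snd) ((f.r_map _).trans hi) ((f.l_map _).trans p.snd_l) ◁
            g.lab p.fst p.fst_r hj }
  associator A B C := SpanMap.associator A B C
  leftUnitor A := SpanMap.leftUnitor A
  rightUnitor A := SpanMap.rightUnitor A

section Tensor

variable {V : Type u} [Bicategory.{w, v} V]

namespace TensorData

variable (T : TensorData V)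

/-- The tensor product of labelled sets. -/
def spanOb (X Y : LabelledSet.{s} V) : LabelledSet.{s} V where
  carrier := X.carrier × Y.carrier
  label := fun k => T.ob (X.label k.1) (Y.label k.2)

/-- The tensor product of labelled spans. -/
def spanHom {X X' Y Y' : LabelledSet.{s} V} (A : X ⟶ X') (B : Y ⟶ Y') :
    T.spanOb X Y ⟶ T.spanOb X' Y' where
  apex := LabelledSpan.apex A × LabelledSpan.apex B
  l := fun c => (LabelledSpan.l A c.1, LabelledSpan.l B c.2)
  r := fun c => (LabelledSpan.r A c.1, LabelledSpan.r B c.2)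
  lab := fun c _ _ hi hj =>
    T.hom (LabelledSpan.lab A c.1 (congrArg Prod.fst hi) (congrArg Prod.fst hj))
      (LabelledSpan.lab B c.2 (congrArg Prod.snd hi) (congrArg Prod.snd hj))

/-- The tensor product of labelled span maps. -/
def spanHom₂ {X X' Y Y' : LabelledSet.{s} V} {A A' : X ⟶ X'} {B B' : Y ⟶ Y'} (f : A ⟶ A')
    (g : B ⟶ B') : T.spanHom A B ⟶ T.spanHom A' B' where
  map := fun c => (SpanMap.map f c.1, SpanMap.map g c.2)
  l_map := fun c => Prod.ext (f.l_map c.1) (g.l_map c.2)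
  r_map := fun c => Prod.ext (f.r_map c.1) (g.r_map c.2)
  lab := fun c _ _ hi hj =>
    T.hom₂ (SpanMap.lab f c.1 (congrArg Prod.fst hi) (congrArg Prod.fst hj))
      (SpanMap.lab g c.2 (congrArg Prod.snd hi) (congrArg Prod.snd hj))

theorem spanHom_r_bijective {X X' Y Y' : LabelledSet.{s} V} (A : X ⟶ X') (B : Y ⟶ Y')
    (hA : Function.Bijective (LabelledSpan.r A)) (hB : Function.Bijective (LabelledSpan.r B)) :
    Function.Bijective (LabelledSpan.r (T.spanHom A B)) :=
  hA.prodMap hB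

/-- Compatibility of the tensor product with identities. -/
def spanId (X Y : LabelledSet.{s} V) : T.spanHom (𝟙 X) (𝟙 Y) ⟶ 𝟙 (T.spanOb X Y) where
  map := fun c => c
  l_map := fun _ => rfl
  r_map := fun _ => rfl
  lab := fun c i j hi hj => by
    change c = i at hi
    change c = j at hj
    subst hi hj
    exact (T.idIso _ _).hom

/-- Compatibility of the tensor product with composition. -/
def spanComp {X X' X'' Y Y' Y'' : LabelledSet.{s} V} (A : X ⟶ X') (A' : X' ⟶ X'') (B : Y ⟶ Y')
    (B' : Y' ⟶ Y'') : T.spanHom (A ≫ A') (B ≫ B') ⟶ T.spanHom A B ≫ T.spanHom A' B' where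
  map := fun c => ⟨(c.1.fst, c.2.fst), (c.1.snd, c.2.snd), (c.1.mid, c.2.mid),
    Prod.ext c.1.fst_r c.2.fst_r, Prod.ext c.1.snd_l c.2.snd_l⟩
  l_map := fun _ => rfl
  r_map := fun _ => rfl
  lab := fun _ _ _ _ _ => (T.compIso _ _ _ _).hom

/-- The tensor product of `Span|V`. -/
noncomputable def spanTensor : TensorData (LabelledSet.{s} V) where
  tensor :=
    { obj := fun p => T.spanOb p.1 p.2
      map := fun f => T.spanHom f.1 f.2
      map₂ := fun φ => T.spanHom₂ φ.1 φ.2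
      mapId := fun p => (T.spanId p.1 p.2).iso Function.bijective_id fun c i j hi hj => by
        change c = i at hi
        change c = j at hj
        subst hi hj
        exact inferInstanceAs (IsIso (T.idIso _ _).hom)
      mapComp := fun f g => (T.spanComp f.1 g.1 f.2 g.2).iso
        (Function.bijective_iff_has_inverse.2 ⟨fun q =>
          (⟨q.fst.1, q.snd.1, q.mid.1, congrArg Prod.fst q.fst_r, congrArg Prod.fst q.snd_l⟩,
            ⟨q.fst.2, q.snd.2, q.mid.2, congrArg Prod.snd q.fst_r, congrArg Prod.snd q.snd_l⟩),
          fun _ => rfl, fun _ => rfl⟩)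
        fun _ _ _ _ _ => inferInstanceAs (IsIso (T.compIso _ _ _ _).hom) }
  unit := ⟨PUnit, fun _ => T.unit⟩

end TensorData

namespace PremonoidalData

variable (M : PremonoidalData V)

/-- The associativity 1-cell of `Span|V`: the bijection `(X × Y) × Z → X × (Y × Z)`, labelled by
the associativity 1-cells of `V`. -/
def spanA (X Y Z : LabelledSet.{s} V) :
    M.spanTensor.ob (M.spanTensor.ob X Y) Z ⟶ M.spanTensor.ob X (M.spanTensor.ob Y Z) :=
  LabelledSpan.graph (X := M.spanOb (M.spanOb X Y) Z) (Y := M.spanOb X (M.spanOb Y Z))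
    (fun k => (k.1.1, (k.1.2, k.2))) fun _ => M.a _ _ _

/-- The left unit 1-cell of `Span|V`. -/
noncomputable def spanL (X : LabelledSet.{s} V) : M.spanTensor.ob M.spanTensor.unit X ⟶ X :=
  LabelledSpan.graph (X := M.spanOb M.spanTensor.unit X) (fun k => k.2) fun _ => M.l _

/-- The right unit 1-cell of `Span|V`. -/
noncomputable def spanR (X : LabelledSet.{s} V) : X ⟶ M.spanTensor.ob X M.spanTensor.unit :=
  LabelledSpan.graph (Y := M.spanOb X M.spanTensor.unit) (fun k => (k, PUnit.unit)) fun _ => M.r _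

/-- Naturality of the associativity 1-cell of `Span|V`. -/
def spanANat {X X' Y Y' Z Z' : LabelledSet.{s} V} (A : X ⟶ X') (B : Y ⟶ Y') (C : Z ⟶ Z') :
    M.spanTensor.hom (M.spanTensor.hom A B) C ≫ M.spanA X' Y' Z' ⟶
      M.spanA X Y Z ≫ M.spanTensor.hom A (M.spanTensor.hom B C) where
  map := fun p => ⟨(p.snd.1.1, (p.snd.1.2, p.snd.2)),
    ((LabelledSpan.r A p.snd.1.1, LabelledSpan.r B p.snd.1.2), LabelledSpan.r C p.snd.2),
    (LabelledSpan.r A p.snd.1.1, (LabelledSpan.r B p.snd.1.2, LabelledSpan.r C p.snd.2)), rfl, rfl⟩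
  l_map := fun p => by
    obtain ⟨k, c, m, h, h'⟩ := p
    change k = m at h
    subst h
    change ((LabelledSpan.l A c.1.1, LabelledSpan.l B c.1.2), LabelledSpan.l C c.2) = k at h'
    subst h'
    rfl
  r_map := fun _ => rfl
  lab := fun p i j hi hj => by
    obtain ⟨k, ⟨⟨a, b⟩, c⟩, m, h, h'⟩ := p
    change k = m at h
    subst h
    change ((LabelledSpan.l A a, LabelledSpan.l B b), LabelledSpan.l C c) = k at h'
    subst h'
    change ((LabelledSpan.r A a, LabelledSpan.r B b), LabelledSpan.r C c) = i at hi
    subst hi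
    change (LabelledSpan.l A a, (LabelledSpan.l B b, LabelledSpan.l C c)) = j at hj
    subst hj
    exact (M.aNat (LabelledSpan.lab A a rfl rfl) (LabelledSpan.lab B b rfl rfl)
      (LabelledSpan.lab C c rfl rfl)).hom

theorem spanA_l_bijective (X Y Z : LabelledSet.{s} V) :
    Function.Bijective (LabelledSpan.l (M.spanA X Y Z)) :=
  (Equiv.prodAssoc X.carrier Y.carrier Z.carrier).bijective

theorem spanL_l_bijective (X : LabelledSet.{s} V) :
    Function.Bijective (LabelledSpan.l (M.spanL X)) :=
  (Equiv.punitProd X.carrier).bijective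

theorem spanR_l_bijective (X : LabelledSet.{s} V) :
    Function.Bijective (LabelledSpan.l (M.spanR X)) :=
  (Equiv.prodPUnit X.carrier).symm.bijective

theorem spanANat_bijective {X X' Y Y' Z Z' : LabelledSet.{s} V} (A : X ⟶ X') (B : Y ⟶ Y')
    (C : Z ⟶ Z') : Function.Bijective (SpanMap.map (M.spanANat A B C)) :=
  Function.Bijective.of_comp_left (f := SpanPullback.fst)
    ((Equiv.prodAssoc _ _ _).bijective.comp
      (LabelledSpan.snd_bijective _ (M.spanA X' Y' Z') Function.bijective_id))
    (LabelledSpan.fst_bijective (M.spanA X Y Z) _ (M.spanA_l_bijective X Y Z)).1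

/-- Naturality of the left unit 1-cell of `Span|V`. -/
def spanLNat {X Y : LabelledSet.{s} V} (A : X ⟶ Y) :
    M.spanTensor.hom (𝟙 M.spanTensor.unit) A ≫ M.spanL Y ⟶ M.spanL X ≫ A where
  map := fun p => ⟨p.snd.2, (PUnit.unit, LabelledSpan.r A p.snd.2), LabelledSpan.r A p.snd.2,
    rfl, rfl⟩
  l_map := fun p => by
    obtain ⟨k, c, m, h, h'⟩ := p
    change k = m at h
    subst h
    change (c.1, LabelledSpan.l A c.2) = k at h'
    subst h'
    rfl
  r_map := fun _ => rfl
  lab := fun p i j hi hj => by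
    obtain ⟨k, ⟨t, c⟩, m, h, h'⟩ := p
    change k = m at h
    subst h
    change (t, LabelledSpan.l A c) = k at h'
    subst h'
    change (t, LabelledSpan.r A c) = i at hi
    subst hi
    change LabelledSpan.l A c = j at hj
    subst hj
    exact (M.lNat (LabelledSpan.lab A c rfl rfl)).hom

theorem spanLNat_bijective {X Y : LabelledSet.{s} V} (A : X ⟶ Y) :
    Function.Bijective (SpanMap.map (M.spanLNat A)) :=
  Function.Bijective.of_comp_left (f := SpanPullback.fst)
    ((Equiv.punitProd _).bijective.comp
      (LabelledSpan.snd_bijective _ (M.spanL Y) Function.bijective_id))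
    (LabelledSpan.fst_bijective (M.spanL X) _ (M.spanL_l_bijective X)).1

/-- Naturality of the right unit 1-cell of `Span|V`. -/
def spanRNat {X Y : LabelledSet.{s} V} (A : X ⟶ Y) :
    A ≫ M.spanR Y ⟶ M.spanR X ≫ M.spanTensor.hom A (𝟙 M.spanTensor.unit) where
  map := fun p => ⟨(p.snd, PUnit.unit), LabelledSpan.r A p.snd,
    (LabelledSpan.r A p.snd, PUnit.unit), rfl, rfl⟩
  l_map := fun p => by
    obtain ⟨k, c, m, h, h'⟩ := p
    change k = m at h
    subst h
    change LabelledSpan.l A c = k at h'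
    subst h'
    rfl
  r_map := fun _ => rfl
  lab := fun p i j hi hj => by
    obtain ⟨k, c, m, h, h'⟩ := p
    change k = m at h
    subst h
    change LabelledSpan.l A c = k at h'
    subst h'
    change LabelledSpan.r A c = i at hi
    subst hi
    change (LabelledSpan.l A c, PUnit.unit) = j at hj
    subst hj
    exact (M.rNat (LabelledSpan.lab A c rfl rfl)).hom

theorem spanRNat_bijective {X Y : LabelledSet.{s} V} (A : X ⟶ Y) :
    Function.Bijective (SpanMap.map (M.spanRNat A)) :=
  Function.Bijective.of_comp_left (f := SpanPullback.fst)
    ((Equiv.prodPUnit _).symm.bijective.comp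
      (LabelledSpan.snd_bijective _ (M.spanR Y) Function.bijective_id))
    (LabelledSpan.fst_bijective (M.spanR X) _ (M.spanR_l_bijective X)).1

/-- The transformations of the monoidal bicategory `Span|V`. -/
noncomputable def spanPremonoidal : PremonoidalData (LabelledSet.{s} V) where
  toTensorData := M.spanTensor
  assoc :=
    { app := fun p => M.spanA p.1.1 p.1.2 p.2
      naturality := fun f => (M.spanANat f.1.1 f.1.2 f.2).iso (M.spanANat_bijective _ _ _)
        fun p i j hi hj => by
          obtain ⟨k, ⟨⟨a, b⟩, c⟩, m, h, h'⟩ := p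
          change k = m at h
          subst h
          change ((LabelledSpan.l f.1.1 a, LabelledSpan.l f.1.2 b), LabelledSpan.l f.2 c) = k at h'
          subst h'
          change ((LabelledSpan.r f.1.1 a, LabelledSpan.r f.1.2 b), LabelledSpan.r f.2 c) = i at hi
          subst hi
          change (LabelledSpan.l f.1.1 a, (LabelledSpan.l f.1.2 b, LabelledSpan.l f.2 c)) = j at hj
          subst hj
          exact inferInstanceAs (IsIso (M.aNat _ _ _).hom) }
  left :=
    { app := fun X => M.spanL X
      naturality := fun f => (M.spanLNat f).iso (M.spanLNat_bijective f) fun p i j hi hj => by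
        obtain ⟨k, ⟨t, c⟩, m, h, h'⟩ := p
        change k = m at h
        subst h
        change (t, LabelledSpan.l f c) = k at h'
        subst h'
        change (t, LabelledSpan.r f c) = i at hi
        subst hi
        change LabelledSpan.l f c = j at hj
        subst hj
        exact inferInstanceAs (IsIso (M.lNat _).hom) }
  right :=
    { app := fun X => M.spanR X
      naturality := fun f => (M.spanRNat f).iso (M.spanRNat_bijective f) fun p i j hi hj => by
        obtain ⟨k, c, m, h, h'⟩ := p
        change k = m at h
        subst h
        change LabelledSpan.l f c = k at h'
        subst h'
        change LabelledSpan.r f c = i at hi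
        subst hi
        change (LabelledSpan.l f c, PUnit.unit) = j at hj
        subst hj
        exact inferInstanceAs (IsIso (M.rNat _).hom) }

end PremonoidalData

namespace MonoidalBicategoryData

variable (M : MonoidalBicategoryData V)

/-- The pentagon 2-cell of `Span|V`. -/
noncomputable def spanπ (X Y Z U : LabelledSet.{s} V) :
    M.spanTensor.hom (M.spanA X Y Z) (𝟙 U) ≫ M.spanA X (M.spanTensor.ob Y Z) U ≫
        M.spanTensor.hom (𝟙 X) (M.spanA Y Z U) ⟶
      M.spanA (M.spanTensor.ob X Y) Z U ≫ M.spanA X Y (M.spanTensor.ob Z U) where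
  map := fun p => ⟨(p.snd.1.1, (p.snd.1.2, p.snd.2)), p.snd, (p.snd.1.1, (p.snd.1.2, p.snd.2)),
    rfl, rfl⟩
  l_map := fun p => by
    obtain ⟨⟨k₃, k₂, n, g, g'⟩, ⟨k₁, k⟩, m, h, h'⟩ := p
    change k₃ = n at g
    subst g
    change (k₂.1.1, (k₂.1.2, k₂.2)) = k₃ at g'
    subst g'
    change k₂ = m at h
    subst h
    change ((k₁.1.1, (k₁.1.2, k₁.2)), k) = k₂ at h'
    subst h'
    rfl
  r_map := fun _ => rfl
  lab := fun p i j hi hj => by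
    obtain ⟨⟨k₃, k₂, n, g, g'⟩, ⟨k₁, k⟩, m, h, h'⟩ := p
    change k₃ = n at g
    subst g
    change (k₂.1.1, (k₂.1.2, k₂.2)) = k₃ at g'
    subst g'
    change k₂ = m at h
    subst h
    change ((k₁.1.1, (k₁.1.2, k₁.2)), k) = k₂ at h'
    subst h'
    change (k₁, k) = i at hi
    subst hi
    change (k₁.1.1, (k₁.1.2, (k₁.2, k))) = j at hj
    subst hj
    exact (M.π _ _ _ _).hom

theorem spanπ_bijective (X Y Z U : LabelledSet.{s} V) :
    Function.Bijective (SpanMap.map (M.spanπ X Y Z U)) :=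
  SpanMap.bijective_of_r _
    (LabelledSpan.comp_r_bijective _ _
      (M.spanHom_r_bijective _ _ Function.bijective_id Function.bijective_id)
      (LabelledSpan.comp_r_bijective _ _ Function.bijective_id
        (M.spanHom_r_bijective _ _ Function.bijective_id Function.bijective_id)))
    (LabelledSpan.comp_r_bijective _ _ Function.bijective_id Function.bijective_id)

/-- The middle unit 2-cell of `Span|V`. -/
noncomputable def spanμ (X Y : LabelledSet.{s} V) :
    M.spanTensor.hom (M.spanR X) (𝟙 Y) ≫ M.spanA X M.spanTensor.unit Y ≫
        M.spanTensor.hom (𝟙 X) (M.spanL Y) ⟶ 𝟙 (M.spanTensor.ob X Y) where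
  map := fun p => p.snd
  l_map := fun p => by
    obtain ⟨⟨k₃, k₂, n, g, g'⟩, ⟨k₁, k⟩, m, h, h'⟩ := p
    change k₃ = n at g
    subst g
    change (k₂.1.1, (k₂.1.2, k₂.2)) = k₃ at g'
    subst g'
    change k₂ = m at h
    subst h
    change ((k₁, PUnit.unit), k) = k₂ at h'
    subst h'
    rfl
  r_map := fun _ => rfl
  lab := fun p i j hi hj => by
    obtain ⟨⟨k₃, k₂, n, g, g'⟩, ⟨k₁, k⟩, m, h, h'⟩ := p
    change k₃ = n at g
    subst g
    change (k₂.1.1, (k₂.1.2, k₂.2)) = k₃ at g'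
    subst g'
    change k₂ = m at h
    subst h
    change ((k₁, PUnit.unit), k) = k₂ at h'
    subst h'
    change (k₁, k) = i at hi
    subst hi
    change (k₁, k) = j at hj
    subst hj
    exact (M.μ _ _).hom

theorem spanμ_bijective (X Y : LabelledSet.{s} V) :
    Function.Bijective (SpanMap.map (M.spanμ X Y)) :=
  SpanMap.bijective_of_r _
    (LabelledSpan.comp_r_bijective _ _
      (M.spanHom_r_bijective _ _ Function.bijective_id Function.bijective_id)
      (LabelledSpan.comp_r_bijective _ _ Function.bijective_id
        (M.spanHom_r_bijective _ _ Function.bijective_id Function.bijective_id)))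
    Function.bijective_id

/-- The left unit 2-cell of `Span|V`. -/
noncomputable def spanLam (X Y : LabelledSet.{s} V) :
    M.spanTensor.hom (M.spanL X) (𝟙 Y) ⟶
      M.spanA M.spanTensor.unit X Y ≫ M.spanL (M.spanTensor.ob X Y) where
  map := fun p => ⟨(p.1.1, (p.1.2, p.2)), p, (p.1.1, (p.1.2, p.2)), rfl, rfl⟩
  l_map := fun _ => rfl
  r_map := fun _ => rfl
  lab := fun p i j hi hj => by
    obtain ⟨k₁, k⟩ := p
    change (k₁, k) = i at hi
    subst hi
    change (k₁.2, k) = j at hj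
    subst hj
    exact (M.lam _ _).hom

theorem spanLam_bijective (X Y : LabelledSet.{s} V) :
    Function.Bijective (SpanMap.map (M.spanLam X Y)) :=
  SpanMap.bijective_of_r _
    (M.spanHom_r_bijective _ _ Function.bijective_id Function.bijective_id)
    (LabelledSpan.comp_r_bijective _ _ Function.bijective_id Function.bijective_id)

/-- The right unit 2-cell of `Span|V`. -/
noncomputable def spanRho (X Y : LabelledSet.{s} V) :
    M.spanTensor.hom (𝟙 X) (M.spanR Y) ⟶
      M.spanR (M.spanTensor.ob X Y) ≫ M.spanA X Y M.spanTensor.unit where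
  map := fun p => ⟨(p, PUnit.unit), p, (p, PUnit.unit), rfl, rfl⟩
  l_map := fun _ => rfl
  r_map := fun _ => rfl
  lab := fun p i j hi hj => by
    obtain ⟨k₁, k⟩ := p
    change (k₁, k) = i at hi
    subst hi
    change (k₁, (k, PUnit.unit)) = j at hj
    subst hj
    exact (M.rho _ _).hom

theorem spanRho_bijective (X Y : LabelledSet.{s} V) :
    Function.Bijective (SpanMap.map (M.spanRho X Y)) :=
  SpanMap.bijective_of_r _
    (M.spanHom_r_bijective _ _ Function.bijective_id Function.bijective_id)
    (LabelledSpan.comp_r_bijective _ _ Function.bijective_id Function.bijective_id)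

/-- The monoidal structure of `Span|V`. -/
noncomputable def span : MonoidalBicategoryData (LabelledSet.{s} V) where
  toPremonoidalData := M.spanPremonoidal
  π X Y Z U := (M.spanπ X Y Z U).iso (M.spanπ_bijective X Y Z U) fun p i j hi hj => by
    obtain ⟨⟨k₃, k₂, n, g, g'⟩, ⟨k₁, k⟩, m, h, h'⟩ := p
    change k₃ = n at g
    subst g
    change (k₂.1.1, (k₂.1.2, k₂.2)) = k₃ at g'
    subst g'
    change k₂ = m at h
    subst h
    change ((k₁.1.1, (k₁.1.2, k₁.2)), k) = k₂ at h'
    subst h'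
    change (k₁, k) = i at hi
    subst hi
    change (k₁.1.1, (k₁.1.2, (k₁.2, k))) = j at hj
    subst hj
    exact inferInstanceAs (IsIso (M.π _ _ _ _).hom)
  μ X Y := (M.spanμ X Y).iso (M.spanμ_bijective X Y) fun p i j hi hj => by
    obtain ⟨⟨k₃, k₂, n, g, g'⟩, ⟨k₁, k⟩, m, h, h'⟩ := p
    change k₃ = n at g
    subst g
    change (k₂.1.1, (k₂.1.2, k₂.2)) = k₃ at g'
    subst g'
    change k₂ = m at h
    subst h
    change ((k₁, PUnit.unit), k) = k₂ at h'
    subst h'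
    change (k₁, k) = i at hi
    subst hi
    change (k₁, k) = j at hj
    subst hj
    exact inferInstanceAs (IsIso (M.μ _ _).hom)
  lam X Y := (M.spanLam X Y).iso (M.spanLam_bijective X Y) fun p i j hi hj => by
    obtain ⟨k₁, k⟩ := p
    change (k₁, k) = i at hi
    subst hi
    change (k₁.2, k) = j at hj
    subst hj
    exact inferInstanceAs (IsIso (M.lam _ _).hom)
  rho X Y := (M.spanRho X Y).iso (M.spanRho_bijective X Y) fun p i j hi hj => by
    obtain ⟨k₁, k⟩ := p
    change (k₁, k) = i at hi
    subst hi
    change (k₁, (k, PUnit.unit)) = j at hj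
    subst hj
    exact inferInstanceAs (IsIso (M.rho _ _).hom)

end MonoidalBicategoryData

end Tensor

section Functoriality

variable {V : Type u₁} [Bicategory.{w₁, v₁} V] {W : Type u₂} [Bicategory.{w₂, v₂} W]

/-- The functor `Span|F` induced by a lax functor `F`: it applies `F` to all labels. -/
def LaxFunctorData.span (F : LaxFunctorData V W) :
    LaxFunctorData (LabelledSet.{s} V) (LabelledSet.{s} W) where
  obj X := ⟨X.carrier, fun k => F.obj (X.label k)⟩
  map A :=
    { apex := A.apex
      l := A.l
      r := A.r
      lab := fun c _ _ hi hj => F.map (LabelledSpan.lab A c hi hj) }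
  map₂ f :=
    { map := f.map
      l_map := f.l_map
      r_map := f.r_map
      lab := fun c _ _ hi hj => F.map₂ (SpanMap.lab f c hi hj) }
  mapId X :=
    { map := fun k => k
      l_map := fun _ => rfl
      r_map := fun _ => rfl
      lab := fun k i j hi hj => by
        change k = i at hi
        change k = j at hj
        subst hi hj
        exact F.mapId _ }
  mapComp A B :=
    { map := fun p => ⟨p.fst, p.snd, p.mid, p.fst_r, p.snd_l⟩
      l_map := fun _ => rfl
      r_map := fun _ => rfl
      lab := fun _ _ _ _ _ => F.mapComp _ _ }

namespace MonoidalLaxFunctorData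

variable {M : MonoidalBicategoryData V} {N : MonoidalBicategoryData W}
  (H : MonoidalLaxFunctorData M N)

/-- The component `F X ⊗ F Y → F (X ⊗ Y)` of the product compatibility of `Span|F`. -/
noncomputable def spanχApp (X Y : LabelledSet.{s} V) :
    N.span.ob (H.F.span.obj X) (H.F.span.obj Y) ⟶ H.F.span.obj (M.span.ob X Y) :=
  LabelledSpan.graph (X := N.spanOb (H.F.span.obj X) (H.F.span.obj Y))
    (Y := H.F.span.obj (M.spanOb X Y)) (fun k => k) fun _ => H.χ.comp _ _

/-- The naturality 2-cell of the product compatibility of `Span|F`. -/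
noncomputable def spanχNat {X X' Y Y' : LabelledSet.{s} V} (A : X ⟶ X') (B : Y ⟶ Y') :
    N.span.hom (H.F.span.map A) (H.F.span.map B) ≫ H.spanχApp X' Y' ⟶
      H.spanχApp X Y ≫ H.F.span.map (M.span.hom A B) where
  map := fun p => ⟨p.snd,
    (LabelledSpan.r (X := X) (Y := X') A p.snd.1, LabelledSpan.r (X := Y) (Y := Y') B p.snd.2),
    (LabelledSpan.r (X := X) (Y := X') A p.snd.1, LabelledSpan.r (X := Y) (Y := Y') B p.snd.2),
    rfl, rfl⟩
  l_map := fun p => by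
    obtain ⟨k, c, m, h, h'⟩ := p
    change k = m at h
    subst h
    exact h'
  r_map := fun _ => rfl
  lab := fun p i j hi hj => by
    obtain ⟨k, ⟨a, b⟩, m, h, h'⟩ := p
    change k = m at h
    subst h
    change (LabelledSpan.l A a, LabelledSpan.l B b) = k at h'
    subst h'
    change (LabelledSpan.r A a, LabelledSpan.r B b) = i at hi
    subst hi
    change (LabelledSpan.l A a, LabelledSpan.l B b) = j at hj
    subst hj
    exact H.χ.nat (LabelledSpan.lab A a rfl rfl) (LabelledSpan.lab B b rfl rfl)

/-- The product compatibility of `Span|F`. -/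
noncomputable def spanχ : ProductCompatibility M.span.toTensorData N.span.toTensorData H.F.span where
  app p := H.spanχApp p.1 p.2
  naturality f := H.spanχNat f.1 f.2

/-- The unit compatibility of `Span|F`. -/
noncomputable def spanι : N.span.unit ⟶ H.F.span.obj M.span.unit :=
  LabelledSpan.graph (X := N.span.unit) (Y := H.F.span.obj M.span.unit) (fun k => k) fun _ => H.ι

/-- The associativity 2-cell of `Span|F`. -/
noncomputable def spanω (X Y Z : LabelledSet.{s} V) :
    N.span.a (H.F.span.obj X) (H.F.span.obj Y) (H.F.span.obj Z) ≫
        N.span.hom (𝟙 (H.F.span.obj X)) (H.spanχ.comp Y Z) ≫ H.spanχ.comp X (M.span.ob Y Z) ⟶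
      N.span.hom (H.spanχ.comp X Y) (𝟙 (H.F.span.obj Z)) ≫
        H.spanχ.comp (M.span.ob X Y) Z ≫ H.F.span.map (M.span.a X Y Z) where
  map := fun p => ⟨⟨p.snd, p.snd, p.snd, rfl, rfl⟩, p.snd, p.snd, rfl, rfl⟩
  l_map := fun p => by
    obtain ⟨⟨k₃, k₂, n, g, g'⟩, k₁, m, h, h'⟩ := p
    change k₃ = n at g
    subst g
    change k₂ = k₃ at g'
    subst g'
    change k₂ = m at h
    subst h
    change (k₁.1.1, (k₁.1.2, k₁.2)) = k₂ at h'
    subst h'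
    rfl
  r_map := fun _ => rfl
  lab := fun p i j hi hj => by
    obtain ⟨⟨k₃, k₂, n, g, g'⟩, k₁, m, h, h'⟩ := p
    change k₃ = n at g
    subst g
    change k₂ = k₃ at g'
    subst g'
    change k₂ = m at h
    subst h
    change (k₁.1.1, (k₁.1.2, k₁.2)) = k₂ at h'
    subst h'
    change k₁ = i at hi
    subst hi
    change (k₁.1.1, (k₁.1.2, k₁.2)) = j at hj
    subst hj
    exact (H.ω _ _ _).hom

/-- The left unit 2-cell of `Span|F`. -/
noncomputable def spanγ (X : LabelledSet.{s} V) :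
    N.span.l (H.F.span.obj X) ⟶ N.span.hom H.spanι (𝟙 (H.F.span.obj X)) ≫
      H.spanχ.comp M.span.unit X ≫ H.F.span.map (M.span.l X) where
  map := fun k => ⟨⟨k, k, k, rfl, rfl⟩, k, k, rfl, rfl⟩
  l_map := fun _ => rfl
  r_map := fun _ => rfl
  lab := fun k i j hi hj => by
    change k = i at hi
    subst hi
    change k.2 = j at hj
    subst hj
    exact (H.γ _).hom

/-- The right unit 2-cell of `Span|F`. -/
noncomputable def spanδ (X : LabelledSet.{s} V) :
    N.span.r (H.F.span.obj X) ≫ N.span.hom (𝟙 (H.F.span.obj X)) H.spanι ≫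
      H.spanχ.comp X M.span.unit ⟶ H.F.span.map (M.span.r X) where
  map := fun p => p.snd
  l_map := fun p => by
    obtain ⟨⟨k₃, k₂, n, g, g'⟩, k₁, m, h, h'⟩ := p
    change k₃ = n at g
    subst g
    change k₂ = k₃ at g'
    subst g'
    change k₂ = m at h
    subst h
    change (k₁, PUnit.unit) = k₂ at h'
    subst h'
    rfl
  r_map := fun _ => rfl
  lab := fun p i j hi hj => by
    obtain ⟨⟨k₃, k₂, n, g, g'⟩, k₁, m, h, h'⟩ := p
    change k₃ = n at g
    subst g
    change k₂ = k₃ at g'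
    subst g'
    change k₂ = m at h
    subst h
    change (k₁, PUnit.unit) = k₂ at h'
    subst h'
    change k₁ = i at hi
    subst hi
    change (k₁, PUnit.unit) = j at hj
    subst hj
    exact (H.δ _).hom

theorem spanω_bijective (X Y Z : LabelledSet.{s} V) :
    Function.Bijective (SpanMap.map (H.spanω X Y Z)) :=
  SpanMap.bijective_of_r _
    (LabelledSpan.comp_r_bijective _ _ Function.bijective_id
      (LabelledSpan.comp_r_bijective _ _
        (N.spanHom_r_bijective _ _ Function.bijective_id Function.bijective_id)
        Function.bijective_id))
    (LabelledSpan.comp_r_bijective _ _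
      (N.spanHom_r_bijective _ _ Function.bijective_id Function.bijective_id)
      (LabelledSpan.comp_r_bijective _ _ Function.bijective_id Function.bijective_id))

theorem spanγ_bijective (X : LabelledSet.{s} V) :
    Function.Bijective (SpanMap.map (H.spanγ X)) :=
  SpanMap.bijective_of_r _ Function.bijective_id
    (LabelledSpan.comp_r_bijective _ _
      (N.spanHom_r_bijective _ _ Function.bijective_id Function.bijective_id)
      (LabelledSpan.comp_r_bijective _ _ Function.bijective_id Function.bijective_id))

theorem spanδ_bijective (X : LabelledSet.{s} V) :
    Function.Bijective (SpanMap.map (H.spanδ X)) :=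
  SpanMap.bijective_of_r _
    (LabelledSpan.comp_r_bijective _ _ Function.bijective_id
      (LabelledSpan.comp_r_bijective _ _
        (N.spanHom_r_bijective _ _ Function.bijective_id Function.bijective_id)
        Function.bijective_id))
    Function.bijective_id

/-- The monoidal structure of `Span|F` induced by that of `F`. -/
noncomputable def span :
    MonoidalLaxFunctorData (M.span : MonoidalBicategoryData (LabelledSet.{s} V)) N.span where
  F := H.F.span
  χ := H.spanχ
  ι := H.spanι
  ω X Y Z := (H.spanω X Y Z).iso (H.spanω_bijective X Y Z) fun p i j hi hj => by
    obtain ⟨⟨k₃, k₂, n, g, g'⟩, k₁, m, h, h'⟩ := p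
    change k₃ = n at g
    subst g
    change k₂ = k₃ at g'
    subst g'
    change k₂ = m at h
    subst h
    change (k₁.1.1, (k₁.1.2, k₁.2)) = k₂ at h'
    subst h'
    change k₁ = i at hi
    subst hi
    change (k₁.1.1, (k₁.1.2, k₁.2)) = j at hj
    subst hj
    exact inferInstanceAs (IsIso (H.ω _ _ _).hom)
  γ X := (H.spanγ X).iso (H.spanγ_bijective X) fun k i j hi hj => by
    change k = i at hi
    subst hi
    change k.2 = j at hj
    subst hj
    exact inferInstanceAs (IsIso (H.γ _).hom)
  δ X := (H.spanδ X).iso (H.spanδ_bijective X) fun p i j hi hj => by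
    obtain ⟨⟨k₃, k₂, n, g, g'⟩, k₁, m, h, h'⟩ := p
    change k₃ = n at g
    subst g
    change k₂ = k₃ at g'
    subst g'
    change k₂ = m at h
    subst h
    change (k₁, PUnit.unit) = k₂ at h'
    subst h'
    change k₁ = i at hi
    subst hi
    change (k₁, PUnit.unit) = j at hj
    subst hj
    exact inferInstanceAs (IsIso (H.δ _).hom)

end MonoidalLaxFunctorData

end Functoriality

end Induced

/-! ## Relations between the cells of two bicategories

A relation between the cells of `S` and those of `V` that is compatible with all operations of a
bicategory, and that separates the 2-cells of `S`, transports equations between pasted 2-cells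
from `V` to `S`. For `S = Span|V`, a 0-cell `x` is related to `(X, x)` by the points labelled `x`,
and a 1-cell `a` to a labelled span by the points of its apex labelled `a`. -/

/-! Almost every law to be proved for `Span|V` and `Span|F` is an equation between 2-cells, and a
2-cell of `Span|V` is known once it is known at each point of the apex of its source: where the
point goes, and which 2-cell of `V` is its label. The underlying maps of sets are canonical, so at a
point both sides send the point to the same place, and their labels are the two sides of the
corresponding law of `V`. What makes this laborious is bookkeeping: labels live in hom-types that
depend on endpoints, and the pastings have many factors separated by coherence isomorphisms.

To keep dependent types out of the main argument, the passage from points to labels is axiomatised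
as a `CellRelation` between a bicategory `S` and `V`. One may picture a bicategory of elements lying
over both `S` and `V`: its cells are cells of `S` with a chosen point, and the label of the point is
the cell of `V` below. The axioms say that the operations of `S` act on points as those of `V` act
on labels; that points of identities and of composites arise only in the evident way (`id_cases`,
`comp_cases`); that every 2-cell can be evaluated at every point of its source (`push`); and that
2-cells with common values at all points are equal (`ext`).

Such a relation transports equations from `V` to `S`. By `ext_of_agree` one may work at a point; the
lemmas `allOb_*` and `allMor_*` list the points of the source 1-cell; instance search for `At` and
`AtCoherence` evaluates both sides; and `agree_of` leaves the equation between the values, which is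
the law of `V`. With `TensorRelation`, `PremonoidalRelation`, `MonoidalRelation`,
`LaxFunctorRelation` and `MonoidalLaxFunctorRelation` recording compatibility with further
structure, this proves `MonoidalRelation.isMonoidalBicategory`, `LaxFunctorRelation.isLaxFunctor`
and `MonoidalLaxFunctorRelation.isMonoidalLaxFunctor`, in which spans play no role. The comparison
2-cells of a lax functor are only evaluated in their given direction, so their invertibility is
never needed there.

It remains to exhibit these relations for spans (`spanRelation` and its companions). There, once the
equations expressing labels and endpoints are eliminated, the required identities hold by
definition.

Whatever is not an equation is treated separately. The associativity and unitality 1-cells are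
equivalences because they are graphs of bijections labelled by equivalences
(`LabelledSpan.isEquivalenceCell_graph`). Comparison and naturality 2-cells are invertible when
their maps of spans are bijective and their labels invertible (`SpanMap.isIso`). The bicategory laws
of `Span|V` themselves are verified label by label in `LabelledSet.bicategory`. -/

section CellRelations

/-- A relation between the cells of `S` and the cells of `V`, compatible with the operations of a
bicategory. The 2-cells of `S` are determined by the 2-cells to which they are related. -/
structure CellRelation (S : Type u₁) [Bicategory.{w₁, v₁} S] (V : Type u₂)
    [Bicategory.{w₂, v₂} V] where
  Ob : S → V → Type s
  -- Valued in types, since several points of an apex may share their endpoints and their label.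
  Mor {X Y : S} {x y : V} : (X ⟶ Y) → Ob X x → Ob Y y → (x ⟶ y) → Type s
  Two {X Y : S} {x y : V} {p : Ob X x} {q : Ob Y y} {A B : X ⟶ Y} {a b : x ⟶ y} :
    (A ⟶ B) → Mor A p q a → Mor B p q b → (a ⟶ b) → Prop
  id {X : S} {x : V} (p : Ob X x) : Mor (𝟙 X) p p (𝟙 x)
  comp {X Y Z : S} {x y z : V} {p : Ob X x} {q : Ob Y y} {r : Ob Z z} {A : X ⟶ Y} {B : Y ⟶ Z}
    {a : x ⟶ y} {b : y ⟶ z} : Mor A p q a → Mor B q r b → Mor (A ≫ B) p r (a ≫ b)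
  two_id {X Y : S} {x y : V} {p : Ob X x} {q : Ob Y y} {A : X ⟶ Y} {a : x ⟶ y}
    (P : Mor A p q a) : Two (𝟙 A) P P (𝟙 a)
  two_comp {X Y : S} {x y : V} {p : Ob X x} {q : Ob Y y} {A B C : X ⟶ Y} {a b c : x ⟶ y}
    {P : Mor A p q a} {Q : Mor B p q b} {R : Mor C p q c} {f : A ⟶ B} {g : B ⟶ C} {φ : a ⟶ b}
    {ψ : b ⟶ c} : Two f P Q φ → Two g Q R ψ → Two (f ≫ g) P R (φ ≫ ψ)
  -- This makes inverses evaluable from the forward 2-cells alone; for spans the inverses have no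
  -- convenient explicit labels.
  two_inv {X Y : S} {x y : V} {p : Ob X x} {q : Ob Y y} {A B : X ⟶ Y} {a b : x ⟶ y}
    {P : Mor A p q a} {Q : Mor B p q b} {f : A ≅ B} {φ : a ≅ b} :
    Two f.hom P Q φ.hom → Two f.inv Q P φ.inv
  whiskerLeft {X Y Z : S} {x y z : V} {p : Ob X x} {q : Ob Y y} {r : Ob Z z} {A : X ⟶ Y}
    {B B' : Y ⟶ Z} {a : x ⟶ y} {b b' : y ⟶ z} (P : Mor A p q a) {Q : Mor B q r b}
    {Q' : Mor B' q r b'} {f : B ⟶ B'} {φ : b ⟶ b'} :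
    Two f Q Q' φ → Two (A ◁ f) (comp P Q) (comp P Q') (a ◁ φ)
  whiskerRight {X Y Z : S} {x y z : V} {p : Ob X x} {q : Ob Y y} {r : Ob Z z} {A A' : X ⟶ Y}
    {B : Y ⟶ Z} {a a' : x ⟶ y} {b : y ⟶ z} {P : Mor A p q a} {P' : Mor A' p q a'}
    (Q : Mor B q r b) {f : A ⟶ A'} {φ : a ⟶ a'} :
    Two f P P' φ → Two (f ▷ B) (comp P Q) (comp P' Q) (φ ▷ b)
  associator {X Y Z U : S} {x y z t : V} {p : Ob X x} {q : Ob Y y} {r : Ob Z z} {o : Ob U t}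
    {A : X ⟶ Y} {B : Y ⟶ Z} {C : Z ⟶ U} {a : x ⟶ y} {b : y ⟶ z} {c : z ⟶ t} (P : Mor A p q a)
    (Q : Mor B q r b) (R : Mor C r o c) :
    Two (α_ A B C).hom (comp (comp P Q) R) (comp P (comp Q R)) (α_ a b c).hom
  leftUnitor {X Y : S} {x y : V} {p : Ob X x} {q : Ob Y y} {A : X ⟶ Y} {a : x ⟶ y}
    (P : Mor A p q a) : Two (λ_ A).hom (comp (id p) P) P (λ_ a).hom
  rightUnitor {X Y : S} {x y : V} {p : Ob X x} {q : Ob Y y} {A : X ⟶ Y} {a : x ⟶ y}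
    (P : Mor A p q a) : Two (ρ_ A).hom (comp P (id q)) P (ρ_ a).hom
  -- In both case principles the source point is fixed while the target and the label vary, so a
  -- composite is analysed from left to right. Quantifying over a motive avoids equations between
  -- points of different types.
  id_cases {X : S} {x : V} {p : Ob X x} {C : ∀ y (q : Ob X y) a, Mor (𝟙 X) p q a → Prop} :
    C x p (𝟙 x) (id p) → ∀ y q a P, C y q a P
  comp_cases {X Y Z : S} {x : V} {p : Ob X x} {A : X ⟶ Y} {B : Y ⟶ Z}
    {C : ∀ z (r : Ob Z z) c, Mor (A ≫ B) p r c → Prop} :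
    (∀ y (q : Ob Y y) a (P : Mor A p q a) z (r : Ob Z z) b (Q : Mor B q r b),
      C z r (a ≫ b) (comp P Q)) → ∀ z r c P, C z r c P
  -- Only existence of a value is required; no uniqueness is used in transporting equations.
  push {X Y : S} {x y : V} {p : Ob X x} {q : Ob Y y} {A B : X ⟶ Y} {a : x ⟶ y} (f : A ⟶ B)
    (P : Mor A p q a) : ∃ (b : x ⟶ y) (Q : Mor B p q b) (φ : a ⟶ b), Two f P Q φ
  ext {X Y : S} {A B : X ⟶ Y} {f g : A ⟶ B} :
    (∀ x (p : Ob X x) y (q : Ob Y y) (a : x ⟶ y) (P : Mor A p q a),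
      ∃ (b : x ⟶ y) (Q : Mor B p q b) (φ : a ⟶ b), Two f P Q φ ∧ Two g P Q φ) → f = g

variable {S : Type u₁} [Bicategory.{w₁, v₁} S] {V : Type u₂} [Bicategory.{w₂, v₂} V]

namespace CellRelation

/-- The relation of 2-cells, as a class that evaluates a 2-cell of `S` at a point. -/
class At (R : CellRelation.{s} S V) {X Y : S} {x y : V} {p : R.Ob X x} {q : R.Ob Y y}
    {A B : X ⟶ Y} {a : x ⟶ y} (f : A ⟶ B) (P : R.Mor A p q a) {b : outParam (x ⟶ y)}
    (Q : outParam (R.Mor B p q b)) (φ : outParam (a ⟶ b)) : Prop where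
  two : R.Two f P Q φ

/-- The relation of coherence 2-cells. -/
class AtCoherence (R : CellRelation.{s} S V) {X Y : S} {x y : V} {p : R.Ob X x} {q : R.Ob Y y}
    {A B : X ⟶ Y} {a : x ⟶ y} (i : BicategoricalCoherence A B) (P : R.Mor A p q a)
    {b : outParam (x ⟶ y)} (Q : outParam (R.Mor B p q b))
    (j : outParam (BicategoricalCoherence a b)) : Prop where
  two : R.Two i.iso.hom P Q j.iso.hom

/-- A condition on all 0-cells related to `X`. -/
def AllOb (R : CellRelation.{s} S V) (X : S) (C : ∀ x, R.Ob X x → Prop) : Prop := ∀ x p, C x p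

/-- A condition on all 1-cells related to `A`, with given source. -/
def AllMor (R : CellRelation.{s} S V) {X Y : S} {x : V} (p : R.Ob X x) (A : X ⟶ Y)
    (C : ∀ y (q : R.Ob Y y) a, R.Mor A p q a → Prop) : Prop := ∀ y q a P, C y q a P

/-- Two 2-cells of `S` are related to the same 2-cell at a point. -/
def Agree (R : CellRelation.{s} S V) {X Y : S} {x y : V} {p : R.Ob X x} {q : R.Ob Y y}
    {A B : X ⟶ Y} {a : x ⟶ y} (f g : A ⟶ B) (P : R.Mor A p q a) : Prop :=
  ∃ (b : x ⟶ y) (Q : R.Mor B p q b) (φ : a ⟶ b), R.Two f P Q φ ∧ R.Two g P Q φ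

variable (R : CellRelation.{s} S V)

/-- Meant for a 2-cell that is a variable: destructuring the result puts an evaluation of it into
the local context, from which instance search evaluates every pasting in which it occurs. -/
theorem exists_at {X Y : S} {x y : V} {p : R.Ob X x} {q : R.Ob Y y} {A B : X ⟶ Y} {a : x ⟶ y}
    (f : A ⟶ B) (P : R.Mor A p q a) :
    ∃ (b : x ⟶ y) (Q : R.Mor B p q b) (φ : a ⟶ b), R.At f P Q φ := by
  obtain ⟨b, Q, φ, h⟩ := R.push f P
  exact ⟨b, Q, φ, ⟨h⟩⟩

variable {R}

section

variable {X Y Z U : S} {x y z t : V} {p : R.Ob X x} {q : R.Ob Y y} {r : R.Ob Z z} {o : R.Ob U t}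

/-- Puts extensionality into the nested `AllOb`, `AllMor` form on which the case lemmas act, so that
an enumeration of points becomes a chain of applications. -/
theorem ext_of_agree {A B : X ⟶ Y} {f g : A ⟶ B}
    (h : R.AllOb X fun _ p => R.AllMor p A fun _ _ _ P => R.Agree f g P) : f = g :=
  R.ext h

/-- The step from `S` to `V`. Instance search computes `φ` and `ψ` from `f` and `g`, and the shared
`Q` checks that both sides send the point to the same place; only an equation in `V` is left. -/
theorem agree_of {A B : X ⟶ Y} {f g : A ⟶ B} {a b : x ⟶ y} {P : R.Mor A p q a} {Q : R.Mor B p q b}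
    {φ ψ : a ⟶ b} [hf : R.At f P Q φ] [hg : R.At g P Q ψ] (h : φ = ψ) : R.Agree f g P :=
  ⟨b, Q, φ, hf.two, h ▸ hg.two⟩

theorem allMor_id {C : ∀ y (q : R.Ob X y) a, R.Mor (𝟙 X) p q a → Prop}
    (h : C x p (𝟙 x) (R.id p)) : R.AllMor p (𝟙 X) C :=
  R.id_cases h

/-- The end of the first point is the start of the second, so the target found for one factor is the
source with which the next is analysed. -/
theorem allMor_comp {A : X ⟶ Y} {B : Y ⟶ Z} {C : ∀ z (r : R.Ob Z z) c, R.Mor (A ≫ B) p r c → Prop}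
    (h : R.AllMor p A fun _ q a P => R.AllMor q B fun _ r b Q => C _ r (a ≫ b) (R.comp P Q)) :
    R.AllMor p (A ≫ B) C :=
  R.comp_cases h

instance {A : X ⟶ Y} {a : x ⟶ y} (P : R.Mor A p q a) : R.At (𝟙 A) P P (𝟙 a) := ⟨R.two_id P⟩

instance {A B C : X ⟶ Y} {a b c : x ⟶ y} (f : A ⟶ B) (g : B ⟶ C) (φ : a ⟶ b) (ψ : b ⟶ c)
    (P : R.Mor A p q a) (Q : R.Mor B p q b) (T : R.Mor C p q c) [hf : R.At f P Q φ]
    [hg : R.At g Q T ψ] : R.At (f ≫ g) P T (φ ≫ ψ) := ⟨R.two_comp hf.two hg.two⟩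

instance {A : X ⟶ Y} {B B' : Y ⟶ Z} {a : x ⟶ y} {b b' : y ⟶ z} (f : B ⟶ B') (φ : b ⟶ b')
    (P : R.Mor A p q a) (Q : R.Mor B q r b) (Q' : R.Mor B' q r b') [hf : R.At f Q Q' φ] :
    R.At (A ◁ f) (R.comp P Q) (R.comp P Q') (a ◁ φ) := ⟨R.whiskerLeft P hf.two⟩

instance {A A' : X ⟶ Y} {B : Y ⟶ Z} {a a' : x ⟶ y} {b : y ⟶ z} (f : A ⟶ A') (φ : a ⟶ a')
    (P : R.Mor A p q a) (P' : R.Mor A' p q a') (Q : R.Mor B q r b) [hf : R.At f P P' φ] :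
    R.At (f ▷ B) (R.comp P Q) (R.comp P' Q) (φ ▷ b) := ⟨R.whiskerRight Q hf.two⟩

instance {A : X ⟶ Y} {B : Y ⟶ Z} {C : Z ⟶ U} {a : x ⟶ y} {b : y ⟶ z} {c : z ⟶ t}
    (P : R.Mor A p q a) (Q : R.Mor B q r b) (T : R.Mor C r o c) :
    R.At (α_ A B C).hom (R.comp (R.comp P Q) T) (R.comp P (R.comp Q T)) (α_ a b c).hom :=
  ⟨R.associator P Q T⟩

instance {A : X ⟶ Y} {B : Y ⟶ Z} {C : Z ⟶ U} {a : x ⟶ y} {b : y ⟶ z} {c : z ⟶ t}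
    (P : R.Mor A p q a) (Q : R.Mor B q r b) (T : R.Mor C r o c) :
    R.At (α_ A B C).inv (R.comp P (R.comp Q T)) (R.comp (R.comp P Q) T) (α_ a b c).inv :=
  ⟨R.two_inv (R.associator P Q T)⟩

instance {A : X ⟶ Y} {a : x ⟶ y} (P : R.Mor A p q a) :
    R.At (λ_ A).hom (R.comp (R.id p) P) P (λ_ a).hom := ⟨R.leftUnitor P⟩

instance {A : X ⟶ Y} {a : x ⟶ y} (P : R.Mor A p q a) :
    R.At (λ_ A).inv P (R.comp (R.id p) P) (λ_ a).inv := ⟨R.two_inv (R.leftUnitor P)⟩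

instance {A : X ⟶ Y} {a : x ⟶ y} (P : R.Mor A p q a) :
    R.At (ρ_ A).hom (R.comp P (R.id q)) P (ρ_ a).hom := ⟨R.rightUnitor P⟩

instance {A : X ⟶ Y} {a : x ⟶ y} (P : R.Mor A p q a) :
    R.At (ρ_ A).inv P (R.comp P (R.id q)) (ρ_ a).inv := ⟨R.two_inv (R.rightUnitor P)⟩

/-- From here on, one rule for each way of forming a `BicategoricalCoherence`. The search therefore
rebuilds in `V` the same coherence term that elaboration chose in `S`, and the value of a pasting
has the form in which the law of `V` is stated. -/
instance {A : X ⟶ Y} {a : x ⟶ y} (P : R.Mor A p q a) :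
    R.AtCoherence (.refl A) P P (.refl a) := ⟨R.two_id P⟩

instance {A : X ⟶ Y} {B B' : Y ⟶ Z} {a : x ⟶ y} {b b' : y ⟶ z} (i : BicategoricalCoherence B B')
    (j : BicategoricalCoherence b b') (P : R.Mor A p q a) (Q : R.Mor B q r b)
    (Q' : R.Mor B' q r b') [h : R.AtCoherence i Q Q' j] :
    R.AtCoherence (.whiskerLeft A B B') (R.comp P Q) (R.comp P Q') (.whiskerLeft a b b') :=
  ⟨R.whiskerLeft P h.two⟩

instance {A A' : X ⟶ Y} {B : Y ⟶ Z} {a a' : x ⟶ y} {b : y ⟶ z} (i : BicategoricalCoherence A A')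
    (j : BicategoricalCoherence a a') (P : R.Mor A p q a) (P' : R.Mor A' p q a')
    (Q : R.Mor B q r b) [h : R.AtCoherence i P P' j] :
    R.AtCoherence (.whiskerRight A A' B) (R.comp P Q) (R.comp P' Q) (.whiskerRight a a' b) :=
  ⟨R.whiskerRight Q h.two⟩

instance {A : X ⟶ Y} {B : Y ⟶ Y} {a : x ⟶ y} {b : y ⟶ y} (i : BicategoricalCoherence (𝟙 Y) B)
    (j : BicategoricalCoherence (𝟙 y) b) (P : R.Mor A p q a) (Q : R.Mor B q q b)
    [h : R.AtCoherence i (R.id q) Q j] :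
    R.AtCoherence (.tensorRight A B) P (R.comp P Q) (.tensorRight a b) :=
  ⟨R.two_comp (R.two_inv (R.rightUnitor P)) (R.whiskerLeft P h.two)⟩

instance {A : X ⟶ Y} {B : Y ⟶ Y} {a : x ⟶ y} {b : y ⟶ y} (i : BicategoricalCoherence B (𝟙 Y))
    (j : BicategoricalCoherence b (𝟙 y)) (P : R.Mor A p q a) (Q : R.Mor B q q b)
    [h : R.AtCoherence i Q (R.id q) j] :
    R.AtCoherence (.tensorRight' A B) (R.comp P Q) P (.tensorRight' a b) :=
  ⟨R.two_comp (R.whiskerLeft P h.two) (R.rightUnitor P)⟩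

instance {A B : X ⟶ Y} {a b : x ⟶ y} (i : BicategoricalCoherence A B)
    (j : BicategoricalCoherence a b) (P : R.Mor A p q a) (Q : R.Mor B p q b)
    [h : R.AtCoherence i P Q j] :
    R.AtCoherence (.left A B) (R.comp (R.id p) P) Q (.left a b) :=
  ⟨R.two_comp (R.leftUnitor P) h.two⟩

instance {A B : X ⟶ Y} {a b : x ⟶ y} (i : BicategoricalCoherence A B)
    (j : BicategoricalCoherence a b) (P : R.Mor A p q a) (Q : R.Mor B p q b)
    [h : R.AtCoherence i P Q j] :
    R.AtCoherence (.left' A B) P (R.comp (R.id p) Q) (.left' a b) :=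
  ⟨R.two_comp h.two (R.two_inv (R.leftUnitor Q))⟩

instance {A B : X ⟶ Y} {a b : x ⟶ y} (i : BicategoricalCoherence A B)
    (j : BicategoricalCoherence a b) (P : R.Mor A p q a) (Q : R.Mor B p q b)
    [h : R.AtCoherence i P Q j] :
    R.AtCoherence (.right A B) (R.comp P (R.id q)) Q (.right a b) :=
  ⟨R.two_comp (R.rightUnitor P) h.two⟩

instance {A B : X ⟶ Y} {a b : x ⟶ y} (i : BicategoricalCoherence A B)
    (j : BicategoricalCoherence a b) (P : R.Mor A p q a) (Q : R.Mor B p q b)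
    [h : R.AtCoherence i P Q j] :
    R.AtCoherence (.right' A B) P (R.comp Q (R.id q)) (.right' a b) :=
  ⟨R.two_comp h.two (R.two_inv (R.rightUnitor Q))⟩

instance {A : X ⟶ Y} {B : Y ⟶ Z} {C : Z ⟶ U} {D : X ⟶ U} {a : x ⟶ y} {b : y ⟶ z} {c : z ⟶ t}
    {d : x ⟶ t} (i : BicategoricalCoherence (A ≫ B ≫ C) D)
    (j : BicategoricalCoherence (a ≫ b ≫ c) d) (P : R.Mor A p q a) (Q : R.Mor B q r b)
    (T : R.Mor C r o c) (O : R.Mor D p o d)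
    [h : R.AtCoherence i (R.comp P (R.comp Q T)) O j] :
    R.AtCoherence (.assoc A B C D) (R.comp (R.comp P Q) T) O (.assoc a b c d) :=
  ⟨R.two_comp (R.associator P Q T) h.two⟩

instance {A : X ⟶ Y} {B : Y ⟶ Z} {C : Z ⟶ U} {D : X ⟶ U} {a : x ⟶ y} {b : y ⟶ z} {c : z ⟶ t}
    {d : x ⟶ t} (i : BicategoricalCoherence D (A ≫ B ≫ C))
    (j : BicategoricalCoherence d (a ≫ b ≫ c)) (P : R.Mor A p q a) (Q : R.Mor B q r b)
    (T : R.Mor C r o c) (O : R.Mor D p o d)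
    [h : R.AtCoherence i O (R.comp P (R.comp Q T)) j] :
    R.AtCoherence (.assoc' A B C D) O (R.comp (R.comp P Q) T) (.assoc' a b c d) :=
  ⟨R.two_comp h.two (R.two_inv (R.associator P Q T))⟩

/-- A `⊗≫` composite is a plain composite with the coherence isomorphism inserted in the middle, so
three evaluations suffice. -/
instance {A B C D : X ⟶ Y} {a b c d : x ⟶ y} (i : BicategoricalCoherence B C)
    (j : BicategoricalCoherence b c) (f : A ⟶ B) (g : C ⟶ D) (φ : a ⟶ b) (ψ : c ⟶ d)
    (P : R.Mor A p q a) (Q : R.Mor B p q b) (Q' : R.Mor C p q c) (T : R.Mor D p q d)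
    [hf : R.At f P Q φ] [h : R.AtCoherence i Q Q' j] [hg : R.At g Q' T ψ] :
    R.At (f ⊗≫ g) P T (φ ⊗≫ ψ) :=
  ⟨R.two_comp hf.two (R.two_comp h.two hg.two)⟩

end

end CellRelation

end CellRelations

/-! ### Laws of pseudofunctors and lax functors as lists of equations -/

section FunctorLaws

variable {B : Type u₁} [Bicategory.{w₁, v₁} B] {C : Type u₂} [Bicategory.{w₂, v₂} C]

/-- The laws of a pseudofunctor. -/
structure PseudofunctorData.Laws (F : PseudofunctorData B C) : Prop where
  map₂_id {a b : B} (f : a ⟶ b) : F.map₂ (𝟙 f) = 𝟙 (F.map f)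
  map₂_comp {a b : B} {f g h : a ⟶ b} (η : f ⟶ g) (θ : g ⟶ h) :
    F.map₂ (η ≫ θ) = F.map₂ η ≫ F.map₂ θ
  map₂_whisker_left {a b c : B} (f : a ⟶ b) {g h : b ⟶ c} (η : g ⟶ h) :
    F.map₂ (f ◁ η) = (F.mapComp f g).hom ≫ F.map f ◁ F.map₂ η ≫ (F.mapComp f h).inv
  map₂_whisker_right {a b c : B} {f g : a ⟶ b} (η : f ⟶ g) (h : b ⟶ c) :
    F.map₂ (η ▷ h) = (F.mapComp f h).hom ≫ F.map₂ η ▷ F.map h ≫ (F.mapComp g h).inv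
  map₂_associator {a b c d : B} (f : a ⟶ b) (g : b ⟶ c) (h : c ⟶ d) :
    F.map₂ (α_ f g h).hom = (F.mapComp (f ≫ g) h).hom ≫ (F.mapComp f g).hom ▷ F.map h ≫
      (α_ (F.map f) (F.map g) (F.map h)).hom ≫ F.map f ◁ (F.mapComp g h).inv ≫
        (F.mapComp f (g ≫ h)).inv
  map₂_left_unitor {a b : B} (f : a ⟶ b) :
    F.map₂ (λ_ f).hom =
      (F.mapComp (𝟙 a) f).hom ≫ (F.mapId a).hom ▷ F.map f ≫ (λ_ (F.map f)).hom
  map₂_right_unitor {a b : B} (f : a ⟶ b) :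
    F.map₂ (ρ_ f).hom =
      (F.mapComp f (𝟙 b)).hom ≫ F.map f ◁ (F.mapId b).hom ≫ (ρ_ (F.map f)).hom

/-- Being a pseudofunctor is an existence statement about bundled functors. Passing to the list of
equations and back allows the laws to be transported one at a time. -/
theorem PseudofunctorData.IsPseudofunctor.laws {F : PseudofunctorData B C}
    (h : F.IsPseudofunctor) : F.Laws := by
  obtain ⟨G, rfl⟩ := h
  exact ⟨G.map₂_id, G.map₂_comp, G.map₂_whisker_left, G.map₂_whisker_right, G.map₂_associator,
    G.map₂_left_unitor, G.map₂_right_unitor⟩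

theorem PseudofunctorData.Laws.isPseudofunctor {F : PseudofunctorData B C} (h : F.Laws) :
    F.IsPseudofunctor :=
  ⟨{ toPrelaxFunctorStruct := F.toPrelaxFunctorStruct
     map₂_id := h.map₂_id
     map₂_comp := h.map₂_comp
     mapId := F.mapId
     mapComp := F.mapComp
     map₂_whisker_left := h.map₂_whisker_left
     map₂_whisker_right := h.map₂_whisker_right
     map₂_associator := h.map₂_associator
     map₂_left_unitor := h.map₂_left_unitor
     map₂_right_unitor := h.map₂_right_unitor }, rfl⟩

/-- The laws of a lax functor. -/
structure LaxFunctorData.Laws (F : LaxFunctorData B C) : Prop where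
  map₂_id {a b : B} (f : a ⟶ b) : F.map₂ (𝟙 f) = 𝟙 (F.map f)
  map₂_comp {a b : B} {f g h : a ⟶ b} (η : f ⟶ g) (θ : g ⟶ h) :
    F.map₂ (η ≫ θ) = F.map₂ η ≫ F.map₂ θ
  mapComp_naturality_left {a b c : B} {f f' : a ⟶ b} (η : f ⟶ f') (g : b ⟶ c) :
    F.mapComp f g ≫ F.map₂ (η ▷ g) = F.map₂ η ▷ F.map g ≫ F.mapComp f' g
  mapComp_naturality_right {a b c : B} (f : a ⟶ b) {g g' : b ⟶ c} (η : g ⟶ g') :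
    F.mapComp f g ≫ F.map₂ (f ◁ η) = F.map f ◁ F.map₂ η ≫ F.mapComp f g'
  map₂_associator {a b c d : B} (f : a ⟶ b) (g : b ⟶ c) (h : c ⟶ d) :
    F.mapComp f g ▷ F.map h ≫ F.mapComp (f ≫ g) h ≫ F.map₂ (α_ f g h).hom =
      (α_ (F.map f) (F.map g) (F.map h)).hom ≫ F.map f ◁ F.mapComp g h ≫ F.mapComp f (g ≫ h)
  map₂_leftUnitor {a b : B} (f : a ⟶ b) :
    F.map₂ (λ_ f).inv = (λ_ (F.map f)).inv ≫ F.mapId a ▷ F.map f ≫ F.mapComp (𝟙 a) f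
  map₂_rightUnitor {a b : B} (f : a ⟶ b) :
    F.map₂ (ρ_ f).inv = (ρ_ (F.map f)).inv ≫ F.map f ◁ F.mapId b ≫ F.mapComp f (𝟙 b)

theorem LaxFunctorData.IsLaxFunctor.laws {F : LaxFunctorData B C} (h : F.IsLaxFunctor) :
    F.Laws := by
  obtain ⟨G, rfl⟩ := h
  exact ⟨G.map₂_id, G.map₂_comp, G.mapComp_naturality_left, G.mapComp_naturality_right,
    G.map₂_associator, G.map₂_leftUnitor, G.map₂_rightUnitor⟩

theorem LaxFunctorData.Laws.isLaxFunctor {F : LaxFunctorData B C} (h : F.Laws) :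
    F.IsLaxFunctor :=
  ⟨{ toPrelaxFunctorStruct := F.toPrelaxFunctorStruct
     map₂_id := h.map₂_id
     map₂_comp := h.map₂_comp
     mapId := F.mapId
     mapComp := F.mapComp
     mapComp_naturality_left := h.mapComp_naturality_left
     mapComp_naturality_right := h.mapComp_naturality_right
     map₂_associator := h.map₂_associator
     map₂_leftUnitor := h.map₂_leftUnitor
     map₂_rightUnitor := h.map₂_rightUnitor }, rfl⟩

theorem LaxFunctorData.IsPseudofunctor.isIso {F : LaxFunctorData B C} (h : F.IsPseudofunctor) :
    (∀ a, IsIso (F.mapId a)) ∧ ∀ {a b c} (f : a ⟶ b) (g : b ⟶ c), IsIso (F.mapComp f g) := by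
  obtain ⟨G, rfl⟩ := h
  exact ⟨fun a => inferInstanceAs (IsIso (G.mapId a).inv),
    fun f g => inferInstanceAs (IsIso (G.mapComp f g).inv)⟩

/-- Inverting the comparison 2-cells turns the lax functor into a pseudofunctor whose underlying lax
functor has the original data by definition, since the inverse of an inverse is taken formally. -/
theorem LaxFunctorData.IsLaxFunctor.isPseudofunctor {F : LaxFunctorData B C} (h : F.IsLaxFunctor)
    (h₁ : ∀ a, IsIso (F.mapId a))
    (h₂ : ∀ {a b c} (f : a ⟶ b) (g : b ⟶ c), IsIso (F.mapComp f g)) : F.IsPseudofunctor := by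
  obtain ⟨G, rfl⟩ := h
  -- Restated for `G` itself, so that the construction below finds the invertibility by instance
  -- search.
  have h₁ : ∀ a, IsIso (G.mapId a) := h₁
  have h₂ : ∀ {a b c} (f : a ⟶ b) (g : b ⟶ c), IsIso (G.mapComp f g) := h₂
  exact ⟨Pseudofunctor.mkOfLax' G, rfl⟩

end FunctorLaws

/-! ### Transport of the laws of monoidal bicategories along a relation of cells -/

section MonoidalRelations

variable {S : Type u₁} [Bicategory.{w₁, v₁} S] {V : Type u₂} [Bicategory.{w₂, v₂} V]

open CellRelation

/-- Compatibility of a relation of cells with tensor products. -/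
structure TensorRelation (R : CellRelation.{s} S V) (T : TensorData S) (T' : TensorData V) where
  unit : R.Ob T.unit T'.unit
  ob {X Y : S} {x y : V} : R.Ob X x → R.Ob Y y → R.Ob (T.ob X Y) (T'.ob x y)
  hom {X X' Y Y' : S} {x x' y y' : V} {p : R.Ob X x} {p' : R.Ob X' x'} {q : R.Ob Y y}
    {q' : R.Ob Y' y'} {A : X ⟶ X'} {B : Y ⟶ Y'} {a : x ⟶ x'} {b : y ⟶ y'} :
    R.Mor A p p' a → R.Mor B q q' b → R.Mor (T.hom A B) (ob p q) (ob p' q') (T'.hom a b)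
  hom₂ {X X' Y Y' : S} {x x' y y' : V} {p : R.Ob X x} {p' : R.Ob X' x'} {q : R.Ob Y y}
    {q' : R.Ob Y' y'} {A A' : X ⟶ X'} {B B' : Y ⟶ Y'} {a a' : x ⟶ x'} {b b' : y ⟶ y'}
    {P : R.Mor A p p' a} {P' : R.Mor A' p p' a'} {Q : R.Mor B q q' b} {Q' : R.Mor B' q q' b'}
    {f : A ⟶ A'} {g : B ⟶ B'} {φ : a ⟶ a'} {ψ : b ⟶ b'} :
    R.Two f P P' φ → R.Two g Q Q' ψ → R.Two (T.hom₂ f g) (hom P Q) (hom P' Q') (T'.hom₂ φ ψ)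
  idIso {X Y : S} {x y : V} (p : R.Ob X x) (q : R.Ob Y y) :
    R.Two (T.idIso X Y).hom (hom (R.id p) (R.id q)) (R.id (ob p q)) (T'.idIso x y).hom
  compIso {X X' X'' Y Y' Y'' : S} {x x' x'' y y' y'' : V} {p : R.Ob X x} {p' : R.Ob X' x'}
    {p'' : R.Ob X'' x''} {q : R.Ob Y y} {q' : R.Ob Y' y'} {q'' : R.Ob Y'' y''} {A : X ⟶ X'}
    {A' : X' ⟶ X''} {B : Y ⟶ Y'} {B' : Y' ⟶ Y''} {a : x ⟶ x'} {a' : x' ⟶ x''} {b : y ⟶ y'}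
    {b' : y' ⟶ y''} (P : R.Mor A p p' a) (P' : R.Mor A' p' p'' a') (Q : R.Mor B q q' b)
    (Q' : R.Mor B' q' q'' b') :
    R.Two (T.compIso A A' B B').hom (hom (R.comp P P') (R.comp Q Q'))
      (R.comp (hom P Q) (hom P' Q')) (T'.compIso a a' b b').hom
  -- The abstract form of the fact that points of a Cartesian product are pairs; `hom_cases` says
  -- the same for apexes.
  ob_cases {X Y : S} {C : ∀ x, R.Ob (T.ob X Y) x → Prop} :
    (∀ x (p : R.Ob X x) y (q : R.Ob Y y), C (T'.ob x y) (ob p q)) → ∀ x p, C x p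
  hom_cases {X X' Y Y' : S} {x y : V} {p : R.Ob X x} {q : R.Ob Y y} {A : X ⟶ X'} {B : Y ⟶ Y'}
    {C : ∀ z (r : R.Ob (T.ob X' Y') z) c, R.Mor (T.hom A B) (ob p q) r c → Prop} :
    (∀ x' (p' : R.Ob X' x') a (P : R.Mor A p p' a) y' (q' : R.Ob Y' y') b (Q : R.Mor B q q' b),
      C (T'.ob x' y') (ob p' q') (T'.hom a b) (hom P Q)) → ∀ z r c P, C z r c P

namespace TensorRelation

variable {R : CellRelation.{s} S V} {T : TensorData S} {T' : TensorData V}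
  (τ : TensorRelation R T T')

theorem allOb_ob {X Y : S} {C : ∀ x, R.Ob (T.ob X Y) x → Prop}
    (h : R.AllOb X fun _ p => R.AllOb Y fun _ q => C _ (τ.ob p q)) : R.AllOb (T.ob X Y) C :=
  τ.ob_cases h

section

variable {X X' X'' Y Y' Y'' : S} {x x' x'' y y' y'' : V} {p : R.Ob X x} {p' : R.Ob X' x'}
  {p'' : R.Ob X'' x''} {q : R.Ob Y y} {q' : R.Ob Y' y'} {q'' : R.Ob Y'' y''}

theorem allMor_hom {A : X ⟶ X'} {B : Y ⟶ Y'}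
    {C : ∀ z (r : R.Ob (T.ob X' Y') z) c, R.Mor (T.hom A B) (τ.ob p q) r c → Prop}
    (h : R.AllMor p A fun _ _ _ P => R.AllMor q B fun _ _ _ Q => C _ _ _ (τ.hom P Q)) :
    R.AllMor (τ.ob p q) (T.hom A B) C :=
  τ.hom_cases h

instance {A A' : X ⟶ X'} {B B' : Y ⟶ Y'} {a a' : x ⟶ x'} {b b' : y ⟶ y'}
    (P : R.Mor A p p' a) (P' : R.Mor A' p p' a') (Q : R.Mor B q q' b) (Q' : R.Mor B' q q' b')
    (f : A ⟶ A') (g : B ⟶ B') (φ : a ⟶ a') (ψ : b ⟶ b') [hf : R.At f P P' φ]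
    [hg : R.At g Q Q' ψ] : R.At (T.hom₂ f g) (τ.hom P Q) (τ.hom P' Q') (T'.hom₂ φ ψ) :=
  ⟨τ.hom₂ hf.two hg.two⟩

instance (p : R.Ob X x) (q : R.Ob Y y) :
    R.At (T.idIso X Y).hom (τ.hom (R.id p) (R.id q)) (R.id (τ.ob p q)) (T'.idIso x y).hom :=
  ⟨τ.idIso p q⟩

instance (p : R.Ob X x) (q : R.Ob Y y) :
    R.At (T.idIso X Y).inv (R.id (τ.ob p q)) (τ.hom (R.id p) (R.id q)) (T'.idIso x y).inv :=
  ⟨R.two_inv (τ.idIso p q)⟩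

section

variable {A : X ⟶ X'} {A' : X' ⟶ X''} {B : Y ⟶ Y'} {B' : Y' ⟶ Y''} {a : x ⟶ x'} {a' : x' ⟶ x''}
  {b : y ⟶ y'} {b' : y' ⟶ y''} (P : R.Mor A p p' a) (P' : R.Mor A' p' p'' a') (Q : R.Mor B q q' b)
  (Q' : R.Mor B' q' q'' b')

instance :
    R.At (T.compIso A A' B B').hom (τ.hom (R.comp P P') (R.comp Q Q'))
      (R.comp (τ.hom P Q) (τ.hom P' Q')) (T'.compIso a a' b b').hom :=
  ⟨τ.compIso P P' Q Q'⟩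

instance :
    R.At (T.compIso A A' B B').inv (R.comp (τ.hom P Q) (τ.hom P' Q'))
      (τ.hom (R.comp P P') (R.comp Q Q')) (T'.compIso a a' b b').inv :=
  ⟨R.two_inv (τ.compIso P P' Q Q')⟩

/-- The auxiliary 2-cells built from the tensor product are pastings of cells already evaluated, so
unfolding them is enough, here and for those that follow. -/
instance {Z : S} {z : V} (r : R.Ob Z z) : R.At (T.joinL Z B B') (R.comp (τ.hom (R.id r) Q) (τ.hom (R.id r) Q'))
    (τ.hom (R.id r) (R.comp Q Q')) (T'.joinL z b b') := by
  unfold TensorData.joinL; infer_instance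

instance {Z : S} {z : V} (r : R.Ob Z z) : R.At (T.splitL Z B B') (τ.hom (R.id r) (R.comp Q Q'))
    (R.comp (τ.hom (R.id r) Q) (τ.hom (R.id r) Q')) (T'.splitL z b b') := by
  unfold TensorData.splitL; infer_instance

instance {Z : S} {z : V} (r : R.Ob Z z) : R.At (T.joinR B B' Z)
    (R.comp (τ.hom Q (R.id r)) (τ.hom Q' (R.id r)))
    (τ.hom (R.comp Q Q') (R.id r)) (T'.joinR b b' z) := by
  unfold TensorData.joinR; infer_instance

instance {Z : S} {z : V} (r : R.Ob Z z) : R.At (T.splitR B B' Z) (τ.hom (R.comp Q Q') (R.id r))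
    (R.comp (τ.hom Q (R.id r)) (τ.hom Q' (R.id r))) (T'.splitR b b' z) := by
  unfold TensorData.splitR; infer_instance

section

variable {W : S} {w : V} {o : R.Ob W w} {C : Y'' ⟶ W} {c : y'' ⟶ w} (O : R.Mor C q'' o c)

instance {Z : S} {z : V} (r : R.Ob Z z) : R.At (T.joinL₃ Z B B' C)
    (R.comp (τ.hom (R.id r) Q) (R.comp (τ.hom (R.id r) Q') (τ.hom (R.id r) O)))
    (τ.hom (R.id r) (R.comp Q (R.comp Q' O))) (T'.joinL₃ z b b' c) := by
  unfold TensorData.joinL₃; infer_instance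

instance {Z : S} {z : V} (r : R.Ob Z z) : R.At (T.splitL₃ Z B B' C)
    (τ.hom (R.id r) (R.comp Q (R.comp Q' O)))
    (R.comp (τ.hom (R.id r) Q) (R.comp (τ.hom (R.id r) Q') (τ.hom (R.id r) O)))
    (T'.splitL₃ z b b' c) := by
  unfold TensorData.splitL₃; infer_instance

instance {Z : S} {z : V} (r : R.Ob Z z) : R.At (T.joinR₃ B B' C Z)
    (R.comp (τ.hom Q (R.id r)) (R.comp (τ.hom Q' (R.id r)) (τ.hom O (R.id r))))
    (τ.hom (R.comp Q (R.comp Q' O)) (R.id r)) (T'.joinR₃ b b' c z) := by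
  unfold TensorData.joinR₃; infer_instance

instance {Z : S} {z : V} (r : R.Ob Z z) : R.At (T.splitR₃ B B' C Z)
    (τ.hom (R.comp Q (R.comp Q' O)) (R.id r))
    (R.comp (τ.hom Q (R.id r)) (R.comp (τ.hom Q' (R.id r)) (τ.hom O (R.id r))))
    (T'.splitR₃ b b' c z) := by
  unfold TensorData.splitR₃; infer_instance

end

end

section

variable {Z Z' : S} {z z' : V} {r : R.Ob Z z} {r' : R.Ob Z' z'} {K : Z ⟶ Z'} {k : z ⟶ z'}
  {A : X ⟶ X'} {B : X' ⟶ Y'} {C : X ⟶ Y} {D : Y ⟶ Y'} {a : x ⟶ x'} {b : x' ⟶ y'} {c : x ⟶ y}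
  {d : y ⟶ y'} {P : R.Mor A p p' a} {Q : R.Mor B p' q' b} {P' : R.Mor C p q c}
  {Q' : R.Mor D q q' d} (O : R.Mor K r r' k) (f : A ≫ B ⟶ C ≫ D) (φ : a ≫ b ⟶ c ≫ d)
  [R.At f (R.comp P Q) (R.comp P' Q') φ]

instance : R.At (T.squareL K f) (R.comp (τ.hom O P) (τ.hom (R.id r') Q))
    (R.comp (τ.hom (R.id r) P') (τ.hom O Q')) (T'.squareL k φ) := by
  unfold TensorData.squareL; infer_instance

instance : R.At (T.squareR f K) (R.comp (τ.hom P O) (τ.hom Q (R.id r')))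
    (R.comp (τ.hom P' (R.id r)) (τ.hom Q' O)) (T'.squareR φ k) := by
  unfold TensorData.squareR; infer_instance

end

instance {A : X ⟶ X'} {B : Y ⟶ Y'} {a : x ⟶ x'} {b : y ⟶ y'} (P : R.Mor A p p' a)
    (Q : R.Mor B q q' b) : R.At (T.interchange A B)
      (R.comp (τ.hom (R.id p) Q) (τ.hom P (R.id q')))
      (R.comp (τ.hom P (R.id q)) (τ.hom (R.id p') Q)) (T'.interchange a b) := by
  unfold TensorData.interchange; infer_instance

end

/-- The laws of a pseudofunctor are transported along a relation of tensor products. -/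
theorem isPseudofunctor (τ : TensorRelation R T T') (h : T'.tensor.IsPseudofunctor) :
    T.tensor.IsPseudofunctor := by
  have h := h.laws
  refine PseudofunctorData.Laws.isPseudofunctor ⟨?_, ?_, ?_, ?_, ?_, ?_, ?_⟩
  · rintro ⟨X, Y⟩ ⟨X', Y'⟩ ⟨f, g⟩
    -- The laws concern cells of a product bicategory; rewriting them by components brings them into
    -- the terms that the evaluation instances recognise.
    change T.hom₂ (𝟙 f) (𝟙 g) = 𝟙 (T.hom f g)
    refine ext_of_agree (τ.allOb_ob fun x p y q => τ.allMor_hom fun _ _ _ P _ _ _ Q => agree_of ?_)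
    exact h.map₂_id (a := (_, _)) (b := (_, _)) (_ ×ₘ _)
  · rintro ⟨X, Y⟩ ⟨X', Y'⟩ ⟨f, g⟩ ⟨f', g'⟩ ⟨f'', g''⟩ ⟨η, θ⟩ ⟨η', θ'⟩
    change T.hom₂ (η ≫ η') (θ ≫ θ') = T.hom₂ η θ ≫ T.hom₂ η' θ'
    refine ext_of_agree (τ.allOb_ob fun x p y q => τ.allMor_hom fun _ _ _ P _ _ _ Q => ?_)
    obtain ⟨_, P', φ, hP⟩ := R.exists_at η P
    -- The second 2-cell is evaluated at the image of the point under the first.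
    obtain ⟨_, P'', φ', hP'⟩ := R.exists_at η' P'
    obtain ⟨_, Q', ψ, hQ⟩ := R.exists_at θ Q
    obtain ⟨_, Q'', ψ', hQ'⟩ := R.exists_at θ' Q'
    refine agree_of ?_
    exact h.map₂_comp (a := (_, _)) (b := (_, _)) (_ ×ₘ _) (_ ×ₘ _)
  · rintro ⟨X, Y⟩ ⟨X', Y'⟩ ⟨X'', Y''⟩ ⟨f, g⟩ ⟨f', g'⟩ ⟨f'', g''⟩ ⟨η, θ⟩
    change T.hom₂ (f ◁ η) (g ◁ θ) = (T.compIso f f' g g').hom ≫ T.hom f g ◁ T.hom₂ η θ ≫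
      (T.compIso f f'' g g'').inv
    -- A point of a tensor product of composites is a pair, each member of which is then split into
    -- composable points.
    refine ext_of_agree (τ.allOb_ob fun x p y q => τ.allMor_hom <| allMor_comp
      fun _ _ _ P _ _ _ P' => allMor_comp fun _ _ _ Q _ _ _ Q' => ?_)
    obtain ⟨_, P'', φ, hP⟩ := R.exists_at η P'
    obtain ⟨_, Q'', φ', hQ⟩ := R.exists_at θ Q'
    refine agree_of ?_
    exact h.map₂_whisker_left (a := (_, _)) (b := (_, _)) (c := (_, _)) (_ ×ₘ _) (_ ×ₘ _)
  · rintro ⟨X, Y⟩ ⟨X', Y'⟩ ⟨X'', Y''⟩ ⟨f, g⟩ ⟨f', g'⟩ ⟨η, θ⟩ ⟨f'', g''⟩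
    change T.hom₂ (η ▷ f'') (θ ▷ g'') = (T.compIso f f'' g g'').hom ≫ T.hom₂ η θ ▷ T.hom f'' g'' ≫
      (T.compIso f' f'' g' g'').inv
    refine ext_of_agree (τ.allOb_ob fun x p y q => τ.allMor_hom <| allMor_comp
      fun _ _ _ P _ _ _ P' => allMor_comp fun _ _ _ Q _ _ _ Q' => ?_)
    obtain ⟨_, P'', φ, hP⟩ := R.exists_at η P
    obtain ⟨_, Q'', φ', hQ⟩ := R.exists_at θ Q
    refine agree_of ?_
    exact h.map₂_whisker_right (a := (_, _)) (b := (_, _)) (c := (_, _)) (_ ×ₘ _) (_ ×ₘ _)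
  · rintro ⟨X, Y⟩ ⟨X', Y'⟩ ⟨X'', Y''⟩ ⟨X''', Y'''⟩ ⟨f, g⟩ ⟨f', g'⟩ ⟨f'', g''⟩
    change T.hom₂ (α_ f f' f'').hom (α_ g g' g'').hom =
      (T.compIso (f ≫ f') f'' (g ≫ g') g'').hom ≫ (T.compIso f f' g g').hom ▷ T.hom f'' g'' ≫
        (α_ (T.hom f g) (T.hom f' g') (T.hom f'' g'')).hom ≫
          T.hom f g ◁ (T.compIso f' f'' g' g'').inv ≫ (T.compIso f (f' ≫ f'') g (g' ≫ g'')).inv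
    refine ext_of_agree (τ.allOb_ob fun x p y q => τ.allMor_hom <| allMor_comp <| allMor_comp
      fun _ _ _ P _ _ _ P' _ _ _ P'' => allMor_comp <| allMor_comp
      fun _ _ _ Q _ _ _ Q' _ _ _ Q'' => agree_of ?_)
    exact h.map₂_associator (a := (_, _)) (b := (_, _)) (c := (_, _)) (d := (_, _))
      (_ ×ₘ _) (_ ×ₘ _) (_ ×ₘ _)
  · rintro ⟨X, Y⟩ ⟨X', Y'⟩ ⟨f, g⟩
    change T.hom₂ (λ_ f).hom (λ_ g).hom = (T.compIso (𝟙 X) f (𝟙 Y) g).hom ≫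
      (T.idIso X Y).hom ▷ T.hom f g ≫ (λ_ (T.hom f g)).hom
    refine ext_of_agree (τ.allOb_ob fun x p y q => τ.allMor_hom <| allMor_comp <| allMor_id
      fun _ _ _ P => allMor_comp <| allMor_id fun _ _ _ Q => agree_of ?_)
    exact h.map₂_left_unitor (a := (_, _)) (b := (_, _)) (_ ×ₘ _)
  · rintro ⟨X, Y⟩ ⟨X', Y'⟩ ⟨f, g⟩
    change T.hom₂ (ρ_ f).hom (ρ_ g).hom = (T.compIso f (𝟙 X') g (𝟙 Y')).hom ≫
      T.hom f g ◁ (T.idIso X' Y').hom ≫ (ρ_ (T.hom f g)).hom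
    refine ext_of_agree (τ.allOb_ob fun x p y q => τ.allMor_hom <| allMor_comp
      fun _ _ _ P => allMor_id <| allMor_comp fun _ _ _ Q => allMor_id <| agree_of ?_)
    exact h.map₂_right_unitor (a := (_, _)) (b := (_, _)) (_ ×ₘ _)

end TensorRelation

/-- Compatibility of a relation of cells with associativity and unitality 1-cells. -/
structure PremonoidalRelation (R : CellRelation.{s} S V) (M : PremonoidalData S)
    (M' : PremonoidalData V) extends TensorRelation R M.toTensorData M'.toTensorData where
  a {X Y Z : S} {x y z : V} (p : R.Ob X x) (q : R.Ob Y y) (r : R.Ob Z z) :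
    R.Mor (M.a X Y Z) (ob (ob p q) r) (ob p (ob q r)) (M'.a x y z)
  aNat {X X' Y Y' Z Z' : S} {x x' y y' z z' : V} {p : R.Ob X x} {p' : R.Ob X' x'} {q : R.Ob Y y}
    {q' : R.Ob Y' y'} {r : R.Ob Z z} {r' : R.Ob Z' z'} {A : X ⟶ X'} {B : Y ⟶ Y'} {C : Z ⟶ Z'}
    {a' : x ⟶ x'} {b : y ⟶ y'} {c : z ⟶ z'} (P : R.Mor A p p' a') (Q : R.Mor B q q' b)
    (O : R.Mor C r r' c) :
    R.Two (M.aNat A B C).hom (R.comp (hom (hom P Q) O) (a p' q' r'))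
      (R.comp (a p q r) (hom P (hom Q O))) (M'.aNat a' b c).hom
  -- An associativity 1-cell has exactly one point above a given triple, because its span is the
  -- graph of a map. The same holds for `l_cases` and `r_cases`.
  a_cases {X Y Z : S} {x y z : V} {p : R.Ob X x} {q : R.Ob Y y} {r : R.Ob Z z}
    {C : ∀ t (o : R.Ob (M.ob X (M.ob Y Z)) t) c,
      R.Mor (M.a X Y Z) (ob (ob p q) r) o c → Prop} :
    C _ (ob p (ob q r)) (M'.a x y z) (a p q r) → ∀ t o c P, C t o c P
  l {X : S} {x : V} (p : R.Ob X x) : R.Mor (M.l X) (ob unit p) p (M'.l x)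
  lNat {X X' : S} {x x' : V} {p : R.Ob X x} {p' : R.Ob X' x'} {A : X ⟶ X'} {b : x ⟶ x'}
    (P : R.Mor A p p' b) :
    R.Two (M.lNat A).hom (R.comp (hom (R.id unit) P) (l p')) (R.comp (l p) P) (M'.lNat b).hom
  l_cases {X : S} {x : V} {p : R.Ob X x} {C : ∀ t (o : R.Ob X t) c,
      R.Mor (M.l X) (ob unit p) o c → Prop} : C x p (M'.l x) (l p) → ∀ t o c P, C t o c P
  r {X : S} {x : V} (p : R.Ob X x) : R.Mor (M.r X) p (ob p unit) (M'.r x)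
  rNat {X X' : S} {x x' : V} {p : R.Ob X x} {p' : R.Ob X' x'} {A : X ⟶ X'} {b : x ⟶ x'}
    (P : R.Mor A p p' b) :
    R.Two (M.rNat A).hom (R.comp P (r p')) (R.comp (r p) (hom P (R.id unit))) (M'.rNat b).hom
  r_cases {X : S} {x : V} {p : R.Ob X x} {C : ∀ t (o : R.Ob (M.ob X M.unit) t) c,
      R.Mor (M.r X) p o c → Prop} : C _ (ob p unit) (M'.r x) (r p) → ∀ t o c P, C t o c P
  -- The unit is a one-element set.
  unit_cases {C : ∀ x, R.Ob M.unit x → Prop} : C M'.unit unit → ∀ x p, C x p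

namespace PremonoidalRelation

variable {R : CellRelation.{s} S V} {M : PremonoidalData S} {M' : PremonoidalData V}
  (τ : PremonoidalRelation R M M')

theorem allOb_unit {C : ∀ x, R.Ob M.unit x → Prop} (h : C _ τ.unit) : R.AllOb M.unit C :=
  τ.unit_cases h

variable {X X' Y Y' Z Z' : S} {x x' y y' z z' : V} {p : R.Ob X x} {p' : R.Ob X' x'}
  {q : R.Ob Y y} {q' : R.Ob Y' y'} {r : R.Ob Z z} {r' : R.Ob Z' z'}

theorem allMor_a {C : ∀ t (o : R.Ob (M.ob X (M.ob Y Z)) t) c,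
      R.Mor (M.a X Y Z) (τ.ob (τ.ob p q) r) o c → Prop}
    (h : C _ (τ.ob p (τ.ob q r)) (M'.a x y z) (τ.a p q r)) :
    R.AllMor (τ.ob (τ.ob p q) r) (M.a X Y Z) C :=
  τ.a_cases h

theorem allMor_l {C : ∀ t (o : R.Ob X t) c, R.Mor (M.l X) (τ.ob τ.unit p) o c → Prop}
    (h : C _ p (M'.l x) (τ.l p)) : R.AllMor (τ.ob τ.unit p) (M.l X) C :=
  τ.l_cases h

theorem allMor_r {C : ∀ t (o : R.Ob (M.ob X M.unit) t) c, R.Mor (M.r X) p o c → Prop}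
    (h : C _ (τ.ob p τ.unit) (M'.r x) (τ.r p)) : R.AllMor p (M.r X) C :=
  τ.r_cases h

section

variable {A : X ⟶ X'} {B : Y ⟶ Y'} {C : Z ⟶ Z'} {a : x ⟶ x'} {b : y ⟶ y'} {c : z ⟶ z'}
  (P : R.Mor A p p' a) (Q : R.Mor B q q' b) (O : R.Mor C r r' c)

instance : R.At (M.aNat A B C).hom (R.comp (τ.hom (τ.hom P Q) O) (τ.a p' q' r'))
    (R.comp (τ.a p q r) (τ.hom P (τ.hom Q O))) (M'.aNat a b c).hom :=
  ⟨τ.aNat P Q O⟩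

instance : R.At (M.aNat A B C).inv (R.comp (τ.a p q r) (τ.hom P (τ.hom Q O)))
    (R.comp (τ.hom (τ.hom P Q) O) (τ.a p' q' r')) (M'.aNat a b c).inv :=
  ⟨R.two_inv (τ.aNat P Q O)⟩

instance : R.At (M.lNat A).hom (R.comp (τ.hom (R.id τ.unit) P) (τ.l p')) (R.comp (τ.l p) P)
    (M'.lNat a).hom :=
  ⟨τ.lNat P⟩

instance : R.At (M.rNat A).hom (R.comp P (τ.r p')) (R.comp (τ.r p) (τ.hom P (R.id τ.unit)))
    (M'.rNat a).hom :=
  ⟨τ.rNat P⟩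

instance (q : R.Ob Y y) (r : R.Ob Z z) : R.At (M.aNatL A Y Z)
    (R.comp (τ.hom (τ.hom P (R.id q)) (R.id r)) (τ.a p' q r))
    (R.comp (τ.a p q r) (τ.hom P (R.id (τ.ob q r)))) (M'.aNatL a y z) := by
  unfold PremonoidalData.aNatL; infer_instance

instance (q : R.Ob Y y) (r : R.Ob Z z) : R.At (M.aNatLInv A Y Z)
    (R.comp (τ.a p q r) (τ.hom P (R.id (τ.ob q r))))
    (R.comp (τ.hom (τ.hom P (R.id q)) (R.id r)) (τ.a p' q r)) (M'.aNatLInv a y z) := by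
  unfold PremonoidalData.aNatLInv; infer_instance

instance (p : R.Ob X x) (q : R.Ob Y y) : R.At (M.aNatRInv X Y C)
    (R.comp (τ.a p q r) (τ.hom (R.id p) (τ.hom (R.id q) O)))
    (R.comp (τ.hom (R.id (τ.ob p q)) O) (τ.a p q r')) (M'.aNatRInv x y c) := by
  unfold PremonoidalData.aNatRInv; infer_instance

end

/-- Points of the natural 1-cells are chosen freely, while the point of the associativity 1-cell
after them is forced. What remains at each such choice is the same law in `V`. -/
theorem assoc_isLaxNatural (τ : PremonoidalRelation R M M')
    (h : M'.assoc.toLaxTransData.IsLaxNatural) : M.assoc.toLaxTransData.IsLaxNatural := by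
  constructor
  · rintro ⟨⟨X, Y⟩, Z⟩ ⟨⟨X', Y'⟩, Z'⟩ ⟨⟨f, g⟩, k⟩ ⟨⟨f', g'⟩, k'⟩ ⟨⟨η, θ⟩, κ⟩
    change M.hom₂ (M.hom₂ η θ) κ ▷ M.a X' Y' Z' ≫ (M.aNat f' g' k').hom =
      (M.aNat f g k).hom ≫ M.a X Y Z ◁ M.hom₂ η (M.hom₂ θ κ)
    refine ext_of_agree <| τ.allOb_ob <| τ.allOb_ob fun x p y q z r => allMor_comp <|
      τ.allMor_hom <| τ.allMor_hom fun _ _ _ P _ _ _ Q _ _ _ O => τ.allMor_a ?_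
    obtain ⟨_, P', φ, hP⟩ := R.exists_at η P
    obtain ⟨_, Q', φ', hQ⟩ := R.exists_at θ Q
    obtain ⟨_, O', φ'', hO⟩ := R.exists_at κ O
    refine agree_of ?_
    exact h.naturality_naturality (a := ((_, _), _)) (b := ((_, _), _)) ((_ ×ₘ _) ×ₘ _)
  · rintro ⟨⟨X, Y⟩, Z⟩
    -- The identity comparisons of the two triple tensor functors, written out: each is an outer
    -- comparison followed by an inner one.
    change ((M.idIso (M.ob X Y) Z).inv ≫ M.hom₂ (M.idIso X Y).inv (𝟙 (𝟙 Z))) ▷ M.a X Y Z ≫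
        (M.aNat (𝟙 X) (𝟙 Y) (𝟙 Z)).hom =
      (λ_ (M.a X Y Z)).hom ≫ (ρ_ (M.a X Y Z)).inv ≫ M.a X Y Z ◁
        ((M.idIso X (M.ob Y Z)).inv ≫ M.hom₂ (𝟙 (𝟙 X)) (M.idIso Y Z).inv)
    refine ext_of_agree <| τ.allOb_ob <| τ.allOb_ob fun x p y q z r => allMor_comp <|
      allMor_id <| τ.allMor_a <| agree_of ?_
    exact h.naturality_id ((_, _), _)
  · rintro ⟨⟨X, Y⟩, Z⟩ ⟨⟨X', Y'⟩, Z'⟩ ⟨⟨X'', Y''⟩, Z''⟩ ⟨⟨f, g⟩, k⟩ ⟨⟨f', g'⟩, k'⟩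
    change ((M.compIso (M.hom f g) (M.hom f' g') k k').inv ≫
          M.hom₂ (M.compIso f f' g g').inv (𝟙 (k ≫ k'))) ▷ M.a X'' Y'' Z'' ≫
        (M.aNat (f ≫ f') (g ≫ g') (k ≫ k')).hom =
      (α_ _ _ _).hom ≫ M.hom (M.hom f g) k ◁ (M.aNat f' g' k').hom ≫ (α_ _ _ _).inv ≫
        (M.aNat f g k).hom ▷ M.hom f' (M.hom g' k') ≫ (α_ _ _ _).hom ≫ M.a X Y Z ◁
          ((M.compIso f f' (M.hom g k) (M.hom g' k')).inv ≫
            M.hom₂ (𝟙 (f ≫ f')) (M.compIso g g' k k').inv)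
    refine ext_of_agree <| τ.allOb_ob <| τ.allOb_ob fun x p y q z r => allMor_comp <|
      allMor_comp <| τ.allMor_hom <| τ.allMor_hom fun _ _ _ P _ _ _ Q _ _ _ O =>
      τ.allMor_hom <| τ.allMor_hom fun _ _ _ P' _ _ _ Q' _ _ _ O' => τ.allMor_a <| agree_of ?_
    exact h.naturality_comp (a := ((_, _), _)) (b := ((_, _), _)) (c := ((_, _), _))
      ((_ ×ₘ _) ×ₘ _) ((_ ×ₘ _) ×ₘ _)

theorem left_isLaxNatural (τ : PremonoidalRelation R M M')
    (h : M'.left.toLaxTransData.IsLaxNatural) : M.left.toLaxTransData.IsLaxNatural := by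
  constructor
  · intro X X' f f' η
    change M.hom₂ (𝟙 (𝟙 M.unit)) η ▷ M.l X' ≫ (M.lNat f').hom = (M.lNat f).hom ≫ M.l X ◁ η
    refine ext_of_agree <| τ.allOb_ob <| τ.allOb_unit fun x p => allMor_comp <|
      τ.allMor_hom <| allMor_id fun _ _ _ P => τ.allMor_l ?_
    obtain ⟨_, P', φ, hP⟩ := R.exists_at η P
    refine agree_of ?_
    exact h.naturality_naturality _
  · intro X
    change (M.idIso M.unit X).inv ▷ M.l X ≫ (M.lNat (𝟙 X)).hom =
      (λ_ (M.l X)).hom ≫ (ρ_ (M.l X)).inv ≫ M.l X ◁ 𝟙 (𝟙 X)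
    refine ext_of_agree <| τ.allOb_ob <| τ.allOb_unit fun x p => allMor_comp <|
      allMor_id <| τ.allMor_l <| agree_of ?_
    exact h.naturality_id _
  · intro X X' X'' f f'
    change M.joinL M.unit f f' ▷ M.l X'' ≫ (M.lNat (f ≫ f')).hom =
      (α_ _ _ _).hom ≫ M.hom (𝟙 M.unit) f ◁ (M.lNat f').hom ≫ (α_ _ _ _).inv ≫
        (M.lNat f).hom ▷ f' ≫ (α_ _ _ _).hom ≫ M.l X ◁ 𝟙 (f ≫ f')
    refine ext_of_agree <| τ.allOb_ob <| τ.allOb_unit fun x p => allMor_comp <| allMor_comp <|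
      τ.allMor_hom <| allMor_id fun _ _ _ P => τ.allMor_hom <| allMor_id fun _ _ _ P' =>
      τ.allMor_l <| agree_of ?_
    exact h.naturality_comp _ _

theorem right_isLaxNatural (τ : PremonoidalRelation R M M')
    (h : M'.right.toLaxTransData.IsLaxNatural) : M.right.toLaxTransData.IsLaxNatural := by
  constructor
  · intro X X' f f' η
    change η ▷ M.r X' ≫ (M.rNat f').hom = (M.rNat f).hom ≫ M.r X ◁ M.hom₂ η (𝟙 (𝟙 M.unit))
    refine ext_of_agree fun x p => allMor_comp fun _ _ _ P => τ.allMor_r ?_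
    obtain ⟨_, P', φ, hP⟩ := R.exists_at η P
    refine agree_of ?_
    exact h.naturality_naturality _
  · intro X
    change 𝟙 (𝟙 X) ▷ M.r X ≫ (M.rNat (𝟙 X)).hom =
      (λ_ (M.r X)).hom ≫ (ρ_ (M.r X)).inv ≫ M.r X ◁ (M.idIso X M.unit).inv
    refine ext_of_agree fun x p => allMor_comp <| allMor_id <| τ.allMor_r <| agree_of ?_
    exact h.naturality_id _
  · intro X X' X'' f f'
    change 𝟙 (f ≫ f') ▷ M.r X'' ≫ (M.rNat (f ≫ f')).hom =
      (α_ _ _ _).hom ≫ f ◁ (M.rNat f').hom ≫ (α_ _ _ _).inv ≫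
        (M.rNat f).hom ▷ M.hom f' (𝟙 M.unit) ≫ (α_ _ _ _).hom ≫ M.r X ◁ M.joinR f f' M.unit
    refine ext_of_agree fun x p => allMor_comp <| allMor_comp fun _ _ _ P _ _ _ P' =>
      τ.allMor_r <| agree_of ?_
    exact h.naturality_comp _ _

end PremonoidalRelation

/-- Compatibility of a relation of cells with the data of monoidal bicategories. -/
structure MonoidalRelation (R : CellRelation.{s} S V) (M : MonoidalBicategoryData S)
    (M' : MonoidalBicategoryData V) extends
    PremonoidalRelation R M.toPremonoidalData M'.toPremonoidalData where
  π {X Y Z U : S} {x y z t : V} (p : R.Ob X x) (q : R.Ob Y y) (r : R.Ob Z z) (o : R.Ob U t) :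
    R.Two (M.π X Y Z U).hom
      (R.comp (hom (a p q r) (R.id o)) (R.comp (a p (ob q r) o) (hom (R.id p) (a q r o))))
      (R.comp (a (ob p q) r o) (a p q (ob r o))) (M'.π x y z t).hom
  μ {X Y : S} {x y : V} (p : R.Ob X x) (q : R.Ob Y y) :
    R.Two (M.μ X Y).hom
      (R.comp (hom (r p) (R.id q)) (R.comp (a p unit q) (hom (R.id p) (l q))))
      (R.id (ob p q)) (M'.μ x y).hom
  lam {X Y : S} {x y : V} (p : R.Ob X x) (q : R.Ob Y y) :
    R.Two (M.lam X Y).hom (hom (l p) (R.id q)) (R.comp (a unit p q) (l (ob p q)))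
      (M'.lam x y).hom
  rho {X Y : S} {x y : V} (p : R.Ob X x) (q : R.Ob Y y) :
    R.Two (M.rho X Y).hom (hom (R.id p) (r q)) (R.comp (r (ob p q)) (a p q unit))
      (M'.rho x y).hom

namespace MonoidalRelation

variable {R : CellRelation.{s} S V} {M : MonoidalBicategoryData S}
  {M' : MonoidalBicategoryData V} (τ : MonoidalRelation R M M')

section

variable {X Y Z U : S} {x y z t : V} (p : R.Ob X x) (q : R.Ob Y y) (r : R.Ob Z z) (o : R.Ob U t)

instance : R.At (M.π X Y Z U).hom
    (R.comp (τ.hom (τ.a p q r) (R.id o))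
      (R.comp (τ.a p (τ.ob q r) o) (τ.hom (R.id p) (τ.a q r o))))
    (R.comp (τ.a (τ.ob p q) r o) (τ.a p q (τ.ob r o))) (M'.π x y z t).hom :=
  ⟨τ.π p q r o⟩

instance : R.At (M.μ X Y).hom
    (R.comp (τ.hom (τ.r p) (R.id q)) (R.comp (τ.a p τ.unit q) (τ.hom (R.id p) (τ.l q))))
    (R.id (τ.ob p q)) (M'.μ x y).hom :=
  ⟨τ.μ p q⟩

instance : R.At (M.lam X Y).hom (τ.hom (τ.l p) (R.id q))
    (R.comp (τ.a τ.unit p q) (τ.l (τ.ob p q))) (M'.lam x y).hom :=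
  ⟨τ.lam p q⟩

instance : R.At (M.lam X Y).inv (R.comp (τ.a τ.unit p q) (τ.l (τ.ob p q)))
    (τ.hom (τ.l p) (R.id q)) (M'.lam x y).inv :=
  ⟨R.two_inv (τ.lam p q)⟩

instance : R.At (M.rho X Y).hom (τ.hom (R.id p) (τ.r q))
    (R.comp (τ.r (τ.ob p q)) (τ.a p q τ.unit)) (M'.rho x y).hom :=
  ⟨τ.rho p q⟩

instance : R.At (M.rho X Y).inv (R.comp (τ.r (τ.ob p q)) (τ.a p q τ.unit))
    (τ.hom (R.id p) (τ.r q)) (M'.rho x y).inv :=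
  ⟨R.two_inv (τ.rho p q)⟩

end

/-- The laws of a monoidal bicategory are transported along a relation of cells, apart from the
condition that the components of associativity and unitality are equivalences. -/
theorem isMonoidalBicategory (τ : MonoidalRelation R M M') (h : M'.IsMonoidalBicategory)
    (ha : ∀ X Y Z, IsEquivalenceCell (M.a X Y Z)) (hl : ∀ X, IsEquivalenceCell (M.l X))
    (hr : ∀ X, IsEquivalenceCell (M.r X)) : M.IsMonoidalBicategory where
  tensor := τ.isPseudofunctor h.tensor
  assoc := ⟨τ.assoc_isLaxNatural h.assoc.natural, fun p => ha p.1.1 p.1.2 p.2⟩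
  left := ⟨τ.left_isLaxNatural h.left.natural, hl⟩
  right := ⟨τ.right_isLaxNatural h.right.natural, hr⟩
  π_naturality f g k m := by
    refine ext_of_agree <| τ.allOb_ob <| τ.allOb_ob <| τ.allOb_ob fun _ p _ q _ r _ o => ?_
    -- The cases follow the common source 1-cell of the two sides from left to right. Only `f`, `g`,
    -- `k`, `m` contribute free points; those of the structural factors are determined.
    refine allMor_comp <| τ.allMor_hom <| τ.allMor_hom <| τ.allMor_hom
      fun _ _ _ P _ _ _ Q _ _ _ O _ _ _ T => ?_
    refine allMor_comp <| τ.allMor_hom <| τ.allMor_a <| allMor_id <| allMor_comp <| τ.allMor_a <|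
      τ.allMor_hom <| allMor_id <| τ.allMor_a <| agree_of ?_
    exact h.π_naturality _ _ _ _
  μ_naturality f g := by
    refine ext_of_agree <| τ.allOb_ob fun _ p _ q => allMor_comp <| τ.allMor_hom
      fun _ _ _ P _ _ _ Q => ?_
    refine allMor_comp <| τ.allMor_hom <| τ.allMor_r <| allMor_id <| allMor_comp <| τ.allMor_a <|
      τ.allMor_hom <| allMor_id <| τ.allMor_l <| agree_of ?_
    exact h.μ_naturality _ _
  lam_naturality f g := by
    refine ext_of_agree <| τ.allOb_ob <| τ.allOb_ob <| τ.allOb_unit fun _ p _ q => ?_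
    refine allMor_comp <| τ.allMor_hom <| τ.allMor_hom <| allMor_id fun _ _ _ P _ _ _ Q => ?_
    refine τ.allMor_hom <| τ.allMor_l <| allMor_id <| agree_of ?_
    exact h.lam_naturality _ _
  rho_naturality f g := by
    refine ext_of_agree <| τ.allOb_ob fun _ p _ q => allMor_comp <| τ.allMor_hom
      fun _ _ _ P _ _ _ Q => ?_
    refine τ.allMor_hom <| allMor_id <| τ.allMor_r <| agree_of ?_
    exact h.rho_naturality _ _
  cocycle X Y Z U W := by
    refine ext_of_agree <| τ.allOb_ob <| τ.allOb_ob <| τ.allOb_ob <| τ.allOb_ob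
      fun _ p _ q _ r _ o _ k => ?_
    -- All six factors of the source are structural, so a quintuple of points of the five 0-cells
    -- determines the whole point of the composite.
    refine allMor_comp <| τ.allMor_hom <| τ.allMor_hom <| τ.allMor_a <| allMor_id <| allMor_id ?_
    refine allMor_comp <| τ.allMor_hom <| τ.allMor_a <| allMor_id ?_
    refine allMor_comp <| τ.allMor_hom <| τ.allMor_hom <| allMor_id <| τ.allMor_a <| allMor_id ?_
    refine allMor_comp <| τ.allMor_a <| allMor_comp <| τ.allMor_hom <| allMor_id <| τ.allMor_a ?_
    refine τ.allMor_hom <| allMor_id <| τ.allMor_hom <| allMor_id <| τ.allMor_a <| agree_of ?_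
    exact h.cocycle _ _ _ _ _
  left_normalization X Y Z := by
    refine ext_of_agree <| τ.allOb_ob <| τ.allOb_ob fun _ p _ q _ r => ?_
    refine allMor_comp <| τ.allMor_hom <| τ.allMor_hom <| τ.allMor_r <| allMor_id <| allMor_id ?_
    refine allMor_comp <| τ.allMor_hom <| τ.allMor_a <| allMor_id ?_
    refine allMor_comp <| τ.allMor_a <| allMor_comp <| τ.allMor_hom <| allMor_id <| τ.allMor_a ?_
    refine τ.allMor_hom <| allMor_id <| τ.allMor_l <| agree_of ?_
    exact h.left_normalization _ _ _
  right_normalization X Y Z := by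
    refine ext_of_agree <| τ.allOb_ob <| τ.allOb_ob fun _ p _ q _ r => ?_
    refine allMor_comp <| τ.allMor_hom <| τ.allMor_r <| allMor_id ?_
    refine allMor_comp <| τ.allMor_hom <| τ.allMor_a <| allMor_id ?_
    refine allMor_comp <| τ.allMor_a <| allMor_comp <| τ.allMor_hom <| allMor_id <| τ.allMor_a ?_
    refine τ.allMor_hom <| allMor_id <| τ.allMor_hom <| allMor_id <| τ.allMor_l <| agree_of ?_
    exact h.right_normalization _ _ _

end MonoidalRelation

end MonoidalRelations

/-! ### Transport of the laws of lax and monoidal lax functors -/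

section LaxRelations

universe w₃ v₃ u₃ w₄ v₄ u₄ s'

variable {S : Type u₁} [Bicategory.{w₁, v₁} S] {V : Type u₂} [Bicategory.{w₂, v₂} V]
  {S₁ : Type u₃} [Bicategory.{w₃, v₃} S₁] {V₁ : Type u₄} [Bicategory.{w₄, v₄} V₁]

open CellRelation

/-- Compatibility of relations of cells with lax functors. -/
structure LaxFunctorRelation (R : CellRelation.{s} S V) (R₁ : CellRelation.{s'} S₁ V₁)
    (F : LaxFunctorData S S₁) (F' : LaxFunctorData V V₁) where
  obj {X : S} {x : V} : R.Ob X x → R₁.Ob (F.obj X) (F'.obj x)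
  map {X Y : S} {x y : V} {p : R.Ob X x} {q : R.Ob Y y} {A : X ⟶ Y} {a : x ⟶ y} :
    R.Mor A p q a → R₁.Mor (F.map A) (obj p) (obj q) (F'.map a)
  map₂ {X Y : S} {x y : V} {p : R.Ob X x} {q : R.Ob Y y} {A B : X ⟶ Y} {a b : x ⟶ y}
    {P : R.Mor A p q a} {Q : R.Mor B p q b} {f : A ⟶ B} {φ : a ⟶ b} :
    R.Two f P Q φ → R₁.Two (F.map₂ f) (map P) (map Q) (F'.map₂ φ)
  mapId {X : S} {x : V} (p : R.Ob X x) :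
    R₁.Two (F.mapId X) (R₁.id (obj p)) (map (R.id p)) (F'.mapId x)
  mapComp {X Y Z : S} {x y z : V} {p : R.Ob X x} {q : R.Ob Y y} {r : R.Ob Z z} {A : X ⟶ Y}
    {B : Y ⟶ Z} {a : x ⟶ y} {b : y ⟶ z} (P : R.Mor A p q a) (Q : R.Mor B q r b) :
    R₁.Two (F.mapComp A B) (R₁.comp (map P) (map Q)) (map (R.comp P Q)) (F'.mapComp a b)
  -- The functor on labels may identify cells. A point over the image is nevertheless taken from a
  -- point over the original, so the label before applying `F'` is still available; `map_cases` does
  -- this for 1-cells.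
  obj_cases {X : S} {C : ∀ x, R₁.Ob (F.obj X) x → Prop} :
    (∀ x (p : R.Ob X x), C (F'.obj x) (obj p)) → ∀ x p, C x p
  map_cases {X Y : S} {x : V} {p : R.Ob X x} {A : X ⟶ Y}
    {C : ∀ y (q : R₁.Ob (F.obj Y) y) a, R₁.Mor (F.map A) (obj p) q a → Prop} :
    (∀ y (q : R.Ob Y y) a (P : R.Mor A p q a), C (F'.obj y) (obj q) (F'.map a) (map P)) →
      ∀ y q a P, C y q a P

namespace LaxFunctorRelation

variable {R : CellRelation.{s} S V} {R₁ : CellRelation.{s'} S₁ V₁} {F : LaxFunctorData S S₁}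
  {F' : LaxFunctorData V V₁} (τ : LaxFunctorRelation R R₁ F F')

theorem allOb_obj {X : S} {C : ∀ x, R₁.Ob (F.obj X) x → Prop}
    (h : R.AllOb X fun _ p => C _ (τ.obj p)) : R₁.AllOb (F.obj X) C :=
  τ.obj_cases h

variable {X Y Z : S} {x y z : V} {p : R.Ob X x} {q : R.Ob Y y} {r : R.Ob Z z}

theorem allMor_map {A : X ⟶ Y}
    {C : ∀ y (q : R₁.Ob (F.obj Y) y) a, R₁.Mor (F.map A) (τ.obj p) q a → Prop}
    (h : R.AllMor p A fun _ _ _ P => C _ _ _ (τ.map P)) : R₁.AllMor (τ.obj p) (F.map A) C :=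
  τ.map_cases h

instance {A B : X ⟶ Y} {a b : x ⟶ y} (P : R.Mor A p q a) (Q : R.Mor B p q b) (f : A ⟶ B)
    (φ : a ⟶ b) [hf : R.At f P Q φ] : R₁.At (F.map₂ f) (τ.map P) (τ.map Q) (F'.map₂ φ) :=
  ⟨τ.map₂ hf.two⟩

instance (p : R.Ob X x) : R₁.At (F.mapId X) (R₁.id (τ.obj p)) (τ.map (R.id p)) (F'.mapId x) :=
  ⟨τ.mapId p⟩

instance {A : X ⟶ Y} {B : Y ⟶ Z} {a : x ⟶ y} {b : y ⟶ z} (P : R.Mor A p q a)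
    (Q : R.Mor B q r b) :
    R₁.At (F.mapComp A B) (R₁.comp (τ.map P) (τ.map Q)) (τ.map (R.comp P Q)) (F'.mapComp a b) :=
  ⟨τ.mapComp P Q⟩

/-- The laws of a lax functor are transported along a relation of lax functors. -/
theorem isLaxFunctor (τ : LaxFunctorRelation R R₁ F F') (h : F'.IsLaxFunctor) :
    F.IsLaxFunctor := by
  have h := h.laws
  refine LaxFunctorData.Laws.isLaxFunctor ⟨?_, ?_, ?_, ?_, ?_, ?_, ?_⟩
  · intro X Y f
    refine ext_of_agree <| τ.allOb_obj fun _ p => τ.allMor_map fun _ _ _ P => agree_of ?_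
    exact h.map₂_id _
  · intro X Y f g k η θ
    refine ext_of_agree <| τ.allOb_obj fun _ p => τ.allMor_map fun _ _ _ P => ?_
    obtain ⟨_, P', φ, hP⟩ := R.exists_at η P
    obtain ⟨_, P'', φ', hP'⟩ := R.exists_at θ P'
    refine agree_of ?_
    exact h.map₂_comp _ _
  · intro X Y Z f f' η g
    refine ext_of_agree <| τ.allOb_obj fun _ p => allMor_comp <| τ.allMor_map fun _ _ _ P =>
      τ.allMor_map fun _ _ _ Q => ?_
    obtain ⟨_, P', φ, hP⟩ := R.exists_at η P
    refine agree_of ?_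
    exact h.mapComp_naturality_left _ _
  · intro X Y Z f g g' η
    refine ext_of_agree <| τ.allOb_obj fun _ p => allMor_comp <| τ.allMor_map fun _ _ _ P =>
      τ.allMor_map fun _ _ _ Q => ?_
    obtain ⟨_, P', φ, hP⟩ := R.exists_at η Q
    refine agree_of ?_
    exact h.mapComp_naturality_right _ _
  · intro X Y Z U f g k
    refine ext_of_agree <| τ.allOb_obj fun _ p => allMor_comp <| allMor_comp <| τ.allMor_map
      fun _ _ _ P => τ.allMor_map fun _ _ _ Q => τ.allMor_map fun _ _ _ O => agree_of ?_
    exact h.map₂_associator _ _ _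
  · intro X Y f
    -- The law concerns the inverse unitor, so its source is just the image of `f` and no composite
    -- has to be split.
    refine ext_of_agree <| τ.allOb_obj fun _ p => τ.allMor_map fun _ _ _ P => agree_of ?_
    exact h.map₂_leftUnitor _
  · intro X Y f
    refine ext_of_agree <| τ.allOb_obj fun _ p => τ.allMor_map fun _ _ _ P => agree_of ?_
    exact h.map₂_rightUnitor _

end LaxFunctorRelation

/-- Compatibility of relations of cells with the data of monoidal lax functors. -/
structure MonoidalLaxFunctorRelation {R : CellRelation.{s} S V} {R₁ : CellRelation.{s'} S₁ V₁}
    {M : MonoidalBicategoryData S} {M' : MonoidalBicategoryData V} {N : MonoidalBicategoryData S₁}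
    {N' : MonoidalBicategoryData V₁} (τ : MonoidalRelation R M M') (ν : MonoidalRelation R₁ N N')
    (H : MonoidalLaxFunctorData M N) (H' : MonoidalLaxFunctorData M' N') extends
    LaxFunctorRelation R R₁ H.F H'.F where
  χ {X Y : S} {x y : V} (p : R.Ob X x) (q : R.Ob Y y) :
    R₁.Mor (H.χ.comp X Y) (ν.ob (obj p) (obj q)) (obj (τ.ob p q)) (H'.χ.comp x y)
  χNat {X X' Y Y' : S} {x x' y y' : V} {p : R.Ob X x} {p' : R.Ob X' x'} {q : R.Ob Y y}
    {q' : R.Ob Y' y'} {A : X ⟶ X'} {B : Y ⟶ Y'} {a : x ⟶ x'} {b : y ⟶ y'} (P : R.Mor A p p' a)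
    (Q : R.Mor B q q' b) :
    R₁.Two (H.χ.nat A B) (R₁.comp (ν.hom (map P) (map Q)) (χ p' q'))
      (R₁.comp (χ p q) (map (τ.hom P Q))) (H'.χ.nat a b)
  χ_cases {X Y : S} {x y : V} {p : R.Ob X x} {q : R.Ob Y y}
    {C : ∀ z (r : R₁.Ob (H.F.obj (M.ob X Y)) z) c,
      R₁.Mor (H.χ.comp X Y) (ν.ob (obj p) (obj q)) r c → Prop} :
    C _ (obj (τ.ob p q)) (H'.χ.comp x y) (χ p q) → ∀ z r c P, C z r c P
  ι : R₁.Mor H.ι ν.unit (obj τ.unit) H'.ι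
  ι_cases {C : ∀ z (r : R₁.Ob (H.F.obj M.unit) z) c, R₁.Mor H.ι ν.unit r c → Prop} :
    C _ (obj τ.unit) H'.ι ι → ∀ z r c P, C z r c P
  ω {X Y Z : S} {x y z : V} (p : R.Ob X x) (q : R.Ob Y y) (r : R.Ob Z z) :
    R₁.Two (H.ω X Y Z).hom
      (R₁.comp (ν.a (obj p) (obj q) (obj r))
        (R₁.comp (ν.hom (R₁.id (obj p)) (χ q r)) (χ p (τ.ob q r))))
      (R₁.comp (ν.hom (χ p q) (R₁.id (obj r))) (R₁.comp (χ (τ.ob p q) r) (map (τ.a p q r))))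
      (H'.ω x y z).hom
  γ {X : S} {x : V} (p : R.Ob X x) :
    R₁.Two (H.γ X).hom (ν.l (obj p))
      (R₁.comp (ν.hom ι (R₁.id (obj p))) (R₁.comp (χ τ.unit p) (map (τ.l p)))) (H'.γ x).hom
  δ {X : S} {x : V} (p : R.Ob X x) :
    R₁.Two (H.δ X).hom
      (R₁.comp (ν.r (obj p)) (R₁.comp (ν.hom (R₁.id (obj p)) ι) (χ p τ.unit)))
      (map (τ.r p)) (H'.δ x).hom

namespace MonoidalLaxFunctorRelation

variable {R : CellRelation.{s} S V} {R₁ : CellRelation.{s'} S₁ V₁}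
  {M : MonoidalBicategoryData S} {M' : MonoidalBicategoryData V} {N : MonoidalBicategoryData S₁}
  {N' : MonoidalBicategoryData V₁} {τ : MonoidalRelation R M M'} {ν : MonoidalRelation R₁ N N'}
  {H : MonoidalLaxFunctorData M N} {H' : MonoidalLaxFunctorData M' N'}
  (σ : MonoidalLaxFunctorRelation τ ν H H')

theorem allMor_ι {C : ∀ z (r : R₁.Ob (H.F.obj M.unit) z) c, R₁.Mor H.ι ν.unit r c → Prop}
    (h : C _ (σ.obj τ.unit) H'.ι σ.ι) : R₁.AllMor ν.unit H.ι C :=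
  σ.ι_cases h

section

variable {X X' Y Y' Z : S} {x x' y y' z : V} (p : R.Ob X x) {p' : R.Ob X' x'}
  (q : R.Ob Y y) {q' : R.Ob Y' y'} (r : R.Ob Z z)

theorem allMor_χ {p : R.Ob X x} {q : R.Ob Y y} {C : ∀ z (r : R₁.Ob (H.F.obj (M.ob X Y)) z) c,
      R₁.Mor (H.χ.comp X Y) (ν.ob (σ.obj p) (σ.obj q)) r c → Prop}
    (h : C _ (σ.obj (τ.ob p q)) (H'.χ.comp x y) (σ.χ p q)) :
    R₁.AllMor (ν.ob (σ.obj p) (σ.obj q)) (H.χ.comp X Y) C :=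
  σ.χ_cases h

instance {p : R.Ob X x} {q : R.Ob Y y} {A : X ⟶ X'} {B : Y ⟶ Y'} {a : x ⟶ x'} {b : y ⟶ y'}
    (P : R.Mor A p p' a) (Q : R.Mor B q q' b) :
    R₁.At (H.χ.nat A B) (R₁.comp (ν.hom (σ.map P) (σ.map Q)) (σ.χ p' q'))
      (R₁.comp (σ.χ p q) (σ.map (τ.hom P Q))) (H'.χ.nat a b) :=
  ⟨σ.χNat P Q⟩

instance {p : R.Ob X x} {A : X ⟶ X'} {a : x ⟶ x'} (P : R.Mor A p p' a) :
    R₁.At (H.χ.natL A Y) (R₁.comp (ν.hom (σ.map P) (R₁.id (σ.obj q))) (σ.χ p' q))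
      (R₁.comp (σ.χ p q) (σ.map (τ.hom P (R.id q)))) (H'.χ.natL a y) := by
  unfold ProductCompatibility.natL; infer_instance

instance {q : R.Ob Y y} {B : Y ⟶ Y'} {b : y ⟶ y'} (Q : R.Mor B q q' b) :
    R₁.At (H.χ.natR X B) (R₁.comp (ν.hom (R₁.id (σ.obj p)) (σ.map Q)) (σ.χ p q'))
      (R₁.comp (σ.χ p q) (σ.map (τ.hom (R.id p) Q))) (H'.χ.natR x b) := by
  unfold ProductCompatibility.natR; infer_instance

instance : R₁.At H.ιNat (R₁.comp (R₁.id ν.unit) σ.ι) (R₁.comp σ.ι (R₁.id (σ.obj τ.unit)))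
    H'.ιNat := by
  unfold MonoidalLaxFunctorData.ιNat; infer_instance

instance : R₁.At (H.ω X Y Z).hom
    (R₁.comp (ν.a (σ.obj p) (σ.obj q) (σ.obj r))
      (R₁.comp (ν.hom (R₁.id (σ.obj p)) (σ.χ q r)) (σ.χ p (τ.ob q r))))
    (R₁.comp (ν.hom (σ.χ p q) (R₁.id (σ.obj r)))
      (R₁.comp (σ.χ (τ.ob p q) r) (σ.map (τ.a p q r))))
    (H'.ω x y z).hom :=
  ⟨σ.ω p q r⟩

instance : R₁.At (H.γ X).hom (ν.l (σ.obj p))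
    (R₁.comp (ν.hom σ.ι (R₁.id (σ.obj p))) (R₁.comp (σ.χ τ.unit p) (σ.map (τ.l p))))
    (H'.γ x).hom :=
  ⟨σ.γ p⟩

instance : R₁.At (H.δ X).hom
    (R₁.comp (ν.r (σ.obj p)) (R₁.comp (ν.hom (R₁.id (σ.obj p)) σ.ι) (σ.χ p τ.unit)))
    (σ.map (τ.r p)) (H'.δ x).hom :=
  ⟨σ.δ p⟩

end

theorem χ_isLaxNatural (σ : MonoidalLaxFunctorRelation τ ν H H') (h : H'.χ.IsLaxNatural) :
    H.χ.IsLaxNatural := by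
  constructor
  · rintro ⟨X, Y⟩ ⟨X', Y'⟩ ⟨f, g⟩ ⟨f', g'⟩ ⟨η, θ⟩
    change N.hom₂ (H.F.map₂ η) (H.F.map₂ θ) ▷ H.χ.comp X' Y' ≫ H.χ.nat f' g' =
      H.χ.nat f g ≫ H.χ.comp X Y ◁ H.F.map₂ (M.hom₂ η θ)
    refine ext_of_agree <| ν.allOb_ob <| σ.allOb_obj fun _ p => σ.allOb_obj fun _ q =>
      allMor_comp <| ν.allMor_hom <| σ.allMor_map fun _ _ _ P => σ.allMor_map fun _ _ _ Q =>
      σ.allMor_χ ?_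
    obtain ⟨_, P', φ, hP⟩ := R.exists_at η P
    obtain ⟨_, Q', φ', hQ⟩ := R.exists_at θ Q
    refine agree_of ?_
    exact h.naturality_naturality (a := (_, _)) (b := (_, _)) (_ ×ₘ _)
  · rintro ⟨X, Y⟩
    -- The comparisons of the composites of `F` with the tensor products, written out: on the left
    -- that of `N` precedes those of `F`, on the right that of `F` precedes that of `M`.
    change ((N.idIso (H.F.obj X) (H.F.obj Y)).inv ≫ N.hom₂ (H.F.mapId X) (H.F.mapId Y)) ▷
        H.χ.comp X Y ≫ H.χ.nat (𝟙 X) (𝟙 Y) =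
      (λ_ (H.χ.comp X Y)).hom ≫ (ρ_ (H.χ.comp X Y)).inv ≫ H.χ.comp X Y ◁
        (H.F.mapId (M.ob X Y) ≫ H.F.map₂ (M.idIso X Y).inv)
    refine ext_of_agree <| ν.allOb_ob <| σ.allOb_obj fun _ p => σ.allOb_obj fun _ q =>
      allMor_comp <| allMor_id <| σ.allMor_χ <| agree_of ?_
    exact h.naturality_id (_, _)
  · rintro ⟨X, Y⟩ ⟨X', Y'⟩ ⟨X'', Y''⟩ ⟨f, g⟩ ⟨f', g'⟩
    change ((N.compIso (H.F.map f) (H.F.map f') (H.F.map g) (H.F.map g')).inv ≫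
          N.hom₂ (H.F.mapComp f f') (H.F.mapComp g g')) ▷ H.χ.comp X'' Y'' ≫
        H.χ.nat (f ≫ f') (g ≫ g') =
      (α_ _ _ _).hom ≫ N.hom (H.F.map f) (H.F.map g) ◁ H.χ.nat f' g' ≫ (α_ _ _ _).inv ≫
        H.χ.nat f g ▷ H.F.map (M.hom f' g') ≫ (α_ _ _ _).hom ≫ H.χ.comp X Y ◁
          (H.F.mapComp (M.hom f g) (M.hom f' g') ≫ H.F.map₂ (M.compIso f f' g g').inv)
    refine ext_of_agree <| ν.allOb_ob <| σ.allOb_obj fun _ p => σ.allOb_obj fun _ q =>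
      allMor_comp <| allMor_comp <| ν.allMor_hom <| σ.allMor_map fun _ _ _ P => σ.allMor_map
      fun _ _ _ Q => ν.allMor_hom <| σ.allMor_map fun _ _ _ P' => σ.allMor_map fun _ _ _ Q' =>
      σ.allMor_χ <| agree_of ?_
    exact h.naturality_comp (a := (_, _)) (b := (_, _)) (c := (_, _)) (_ ×ₘ _) (_ ×ₘ _)

/-- The laws of a monoidal lax functor are transported along a relation of monoidal lax
functors. -/
theorem isMonoidalLaxFunctor (σ : MonoidalLaxFunctorRelation τ ν H H')
    (h : H'.IsMonoidalLaxFunctor) : H.IsMonoidalLaxFunctor where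
  lax := σ.isLaxFunctor h.lax
  χ_natural := σ.χ_isLaxNatural h.χ_natural
  ω_naturality f g k := by
    refine ext_of_agree <| ν.allOb_ob <| ν.allOb_ob <| σ.allOb_obj fun _ p => σ.allOb_obj
      fun _ q => σ.allOb_obj fun _ r => ?_
    -- Points over the images of `f`, `g`, `k` come from points over these 1-cells themselves;
    -- everything after them is forced.
    refine allMor_comp <| ν.allMor_hom <| ν.allMor_hom <| σ.allMor_map fun _ _ _ P =>
      σ.allMor_map fun _ _ _ Q => σ.allMor_map fun _ _ _ O => ?_
    refine allMor_comp <| ν.allMor_a <| allMor_comp <| ν.allMor_hom <| allMor_id <|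
      σ.allMor_χ <| σ.allMor_χ <| agree_of ?_
    exact h.ω_naturality _ _ _
  γ_naturality f := by
    refine ext_of_agree <| ν.allOb_ob <| ν.allOb_unit <| σ.allOb_obj fun _ p => ?_
    refine allMor_comp <| ν.allMor_hom <| allMor_id <| σ.allMor_map fun _ _ _ P => ?_
    refine ν.allMor_l <| agree_of ?_
    exact h.γ_naturality _
  δ_naturality f := by
    refine ext_of_agree <| σ.allOb_obj fun _ p => allMor_comp <| σ.allMor_map fun _ _ _ P => ?_
    refine allMor_comp <| ν.allMor_r <| allMor_comp <| ν.allMor_hom <| allMor_id <|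
      σ.allMor_ι <| σ.allMor_χ <| agree_of ?_
    exact h.δ_naturality _
  associativity X Y Z U := by
    refine ext_of_agree <| ν.allOb_ob <| ν.allOb_ob <| ν.allOb_ob <| σ.allOb_obj fun _ p =>
      σ.allOb_obj fun _ q => σ.allOb_obj fun _ r => σ.allOb_obj fun _ o => ?_
    -- The source consists of associativities and of copies of `χ` tensored with identities, so the
    -- four chosen points of 0-cells determine the rest.
    refine allMor_comp <| ν.allMor_hom <| ν.allMor_a <| allMor_id <| allMor_comp <| ν.allMor_a ?_
    refine allMor_comp <| ν.allMor_hom <| allMor_id <| ν.allMor_a ?_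
    refine allMor_comp <| ν.allMor_hom <| allMor_id <| ν.allMor_hom <| allMor_id <| σ.allMor_χ ?_
    refine allMor_comp <| ν.allMor_hom <| allMor_id <| σ.allMor_χ <| σ.allMor_χ <| agree_of ?_
    exact h.associativity _ _ _ _
  unitality X Y := by
    refine ext_of_agree <| ν.allOb_ob <| σ.allOb_obj fun _ p => σ.allOb_obj fun _ q => ?_
    refine allMor_comp <| ν.allMor_hom <| ν.allMor_r <| allMor_id <| allMor_comp <| ν.allMor_a ?_
    refine allMor_comp <| ν.allMor_hom <| allMor_id <| ν.allMor_l <| σ.allMor_χ <| agree_of ?_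
    exact h.unitality _ _

end MonoidalLaxFunctorRelation

end LaxRelations

/-! ### The relation between `Span|V` and `V` given by points and labels -/

section SpanRelation

variable {V : Type u} [Bicategory.{w, v} V]

/-- The points of a labelled set with a given label. -/
structure LabelledSet.Point (X : LabelledSet.{s} V) (x : V) : Type s where
  pt : X.carrier
  label : X.label pt = x

/-- The points of the apex of a labelled span with given endpoints and a given label. -/
structure LabelledSpan.Point {X Y : LabelledSet.{s} V} {x y : V} (A : LabelledSpan X Y)
    (p : X.Point x) (q : Y.Point y) (a : x ⟶ y) : Type s where
  pt : A.apex
  r : A.r pt = p.pt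
  l : A.l pt = q.pt
  lab : A.lab pt r l ≍ a

/-- A map of labelled spans sends a point to a point with a given 2-cell as label. -/
def SpanMap.Sends {X Y : LabelledSet.{s} V} {x y : V} {p : X.Point x} {q : Y.Point y}
    {A B : LabelledSpan X Y} {a b : x ⟶ y} (f : SpanMap A B) (P : A.Point p q a)
    (Q : B.Point p q b) (φ : a ⟶ b) : Prop :=
  f.map P.pt = Q.pt ∧ f.lab P.pt P.r P.l ≍ φ

/-- Uniqueness of inverses when the endpoint is known only up to a propositional equality. Such an
equality appears because going along a map of spans and back returns to the original point only
propositionally. -/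
theorem CategoryTheory.Iso.heq_inv_of_heq_id {C : Type*} [Category C] {a b c : C} (φ : a ≅ b)
    (ψ : b ⟶ c) (h : c = a) (h' : φ.hom ≫ ψ ≍ 𝟙 a) : ψ ≍ φ.inv := by
  subst h
  exact heq_of_eq ((Iso.hom_comp_eq_id φ).1 (eq_of_heq h'))

namespace LabelledSpan

variable {X Y Z : LabelledSet.{s} V} {x y z : V} {p : X.Point x} {q : Y.Point y} {r : Z.Point z}

/-- The point of a composite of labelled spans given by two points. -/
def Point.comp {A : LabelledSpan X Y} {B : LabelledSpan Y Z} {a : x ⟶ y} {b : y ⟶ z}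
    (P : A.Point p q a) (Q : B.Point q r b) : (A.comp B).Point p r (a ≫ b) where
  pt := ⟨Q.pt, P.pt, q.pt, Q.r, P.l⟩
  r := P.r
  l := Q.l
  lab := by
    obtain ⟨i, rfl⟩ := p
    obtain ⟨j, rfl⟩ := q
    obtain ⟨k, rfl⟩ := r
    obtain ⟨c, hr, hl, h⟩ := P
    obtain ⟨d, hr', hl', h'⟩ := Q
    cases h
    cases h'
    rfl

end LabelledSpan

namespace SpanMap

variable {X Y : LabelledSet.{s} V} {x y : V} {p : X.Point x} {q : Y.Point y}

/-- The inverse of an invertible span map need not have usable labels, so only the identity `f.hom ≫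
f.inv = 𝟙` is used: read at the given point, it says where the inverse sends the image and that its
label there is inverse to `φ`. -/
theorem Sends.inv {A B : X ⟶ Y} {a b : x ⟶ y} {P : LabelledSpan.Point A p q a}
    {Q : LabelledSpan.Point B p q b} {f : A ≅ B} {φ : a ≅ b} (h : Sends f.hom P Q φ.hom) :
    Sends f.inv Q P φ.inv := by
  obtain ⟨i, rfl⟩ := p
  obtain ⟨j, rfl⟩ := q
  obtain ⟨c, hr, hl, h₁⟩ := P
  obtain ⟨d, hr', hl', h₂⟩ := Q
  cases h₁
  cases h₂
  obtain ⟨h₁, h₂⟩ := h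
  cases h₁
  -- Equal span maps agree at `c`; the labels are compared heterogeneously, as their types involve
  -- the image of `c`.
  have key : ∀ {f g : SpanMap A A}, f = g → f.map c = g.map c ∧ f.lab c hr hl ≍ g.lab c hr hl := by
    rintro f _ rfl
    exact ⟨rfl, HEq.rfl⟩
  obtain ⟨k₁, k₂⟩ := key f.hom_inv_id
  refine ⟨k₁, Iso.heq_inv_of_heq_id φ _ (lab_congr k₁ _ _) ?_⟩
  rw [← eq_of_heq h₂]
  exact k₂

end SpanMap

/-- The relation between the cells of `Span|V` and those of `V` given by points and labels. -/
def spanRelation (V : Type u) [Bicategory.{w, v} V] : CellRelation.{s} (LabelledSet.{s} V) V where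
  Ob X x := X.Point x
  Mor A p q a := LabelledSpan.Point A p q a
  Two f P Q φ := SpanMap.Sends f P Q φ
  id {X x} p :=
    { pt := p.pt
      r := rfl
      l := rfl
      lab := by obtain ⟨i, rfl⟩ := p; rfl }
  comp P Q := P.comp Q
  two_id {_ _ _ _ p q _ _} P := by
    -- The pattern of all the checks below: eliminating the equations that express labels turns
    -- heterogeneous equalities into equalities that hold by definition.
    obtain ⟨i, rfl⟩ := p
    obtain ⟨j, rfl⟩ := q
    obtain ⟨c, hr, hl, h⟩ := P
    cases h
    exact ⟨rfl, HEq.rfl⟩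
  two_comp {_ _ _ _ p q _ _ _ _ _ _ P Q R _ _ _ _} hf hg := by
    obtain ⟨i, rfl⟩ := p
    obtain ⟨j, rfl⟩ := q
    obtain ⟨c, hr, hl, h⟩ := P
    obtain ⟨d, hr', hl', h'⟩ := Q
    obtain ⟨e, hr'', hl'', h''⟩ := R
    cases h
    cases h'
    cases h''
    obtain ⟨h₁, h₂⟩ := hf
    obtain ⟨h₁', h₂'⟩ := hg
    cases h₁
    cases h₂
    cases h₁'
    cases h₂'
    exact ⟨rfl, HEq.rfl⟩
  two_inv h := h.inv
  whiskerLeft {_ _ _ _ _ _ p q r _ _ _ _ _ _} P Q Q' _ _ hf := by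
    obtain ⟨i, rfl⟩ := p
    obtain ⟨j, rfl⟩ := q
    obtain ⟨k, rfl⟩ := r
    obtain ⟨c, hr, hl, h⟩ := P
    obtain ⟨d, hr', hl', h'⟩ := Q
    obtain ⟨e, hr'', hl'', h''⟩ := Q'
    cases h
    cases h'
    cases h''
    obtain ⟨h₁, h₂⟩ := hf
    cases h₁
    cases h₂
    exact ⟨rfl, HEq.rfl⟩
  whiskerRight {_ _ _ _ _ _ p q r _ _ _ _ _ _ P P'} Q _ _ hf := by
    obtain ⟨i, rfl⟩ := p
    obtain ⟨j, rfl⟩ := q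
    obtain ⟨k, rfl⟩ := r
    obtain ⟨c, hr, hl, h⟩ := P
    obtain ⟨d, hr', hl', h'⟩ := P'
    obtain ⟨e, hr'', hl'', h''⟩ := Q
    cases h
    cases h'
    cases h''
    obtain ⟨h₁, h₂⟩ := hf
    cases h₁
    cases h₂
    exact ⟨rfl, HEq.rfl⟩
  associator {_ _ _ _ _ _ _ _ p q r o _ _ _ _ _ _} P Q T := by
    obtain ⟨i, rfl⟩ := p
    obtain ⟨j, rfl⟩ := q
    obtain ⟨k, rfl⟩ := r
    obtain ⟨m, rfl⟩ := o
    obtain ⟨c, hr, hl, h⟩ := P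
    obtain ⟨d, hr', hl', h'⟩ := Q
    obtain ⟨e, hr'', hl'', h''⟩ := T
    cases h
    cases h'
    cases h''
    exact ⟨rfl, HEq.rfl⟩
  leftUnitor {_ _ _ _ p q _ _} P := by
    obtain ⟨i, rfl⟩ := p
    obtain ⟨j, rfl⟩ := q
    obtain ⟨c, hr, hl, h⟩ := P
    cases h
    exact ⟨rfl, HEq.rfl⟩
  rightUnitor {_ _ _ _ p q _ _} P := by
    obtain ⟨i, rfl⟩ := p
    obtain ⟨j, rfl⟩ := q
    obtain ⟨c, hr, hl, h⟩ := P
    cases h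
    exact ⟨rfl, HEq.rfl⟩
  id_cases {X x p C} h := by
    obtain ⟨i, rfl⟩ := p
    rintro _ ⟨j, rfl⟩ a ⟨c, hr, hl, h'⟩
    -- Both legs of the trivial span are the identity, so the two endpoints of the point coincide
    -- with it.
    change c = i at hr
    change c = j at hl
    subst hr
    subst hl
    cases h'
    exact h
  comp_cases {X Y Z x p A B C} h := by
    obtain ⟨i, rfl⟩ := p
    rintro _ ⟨j, rfl⟩ a ⟨⟨d, c, m, h₁, h₂⟩, hr, hl, h'⟩
    cases h'
    -- The common value recorded in the pullback serves as the intermediate point, with its own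
    -- label.
    exact h _ ⟨m, rfl⟩ _ ⟨c, hr, h₂, HEq.rfl⟩ _ ⟨j, rfl⟩ _ ⟨d, h₁, hl, HEq.rfl⟩
  push {_ _ _ _ p q _ _ _} f P := by
    obtain ⟨i, rfl⟩ := p
    obtain ⟨j, rfl⟩ := q
    obtain ⟨c, hr, hl, h⟩ := P
    cases h
    exact ⟨_, ⟨SpanMap.map f c, (f.r_map c).trans hr, (f.l_map c).trans hl, HEq.rfl⟩, _, rfl,
      HEq.rfl⟩
  ext {X Y A B f g} h := by
    -- Labels are indexed by endpoints with equations, so agreement is shown for arbitrary `i` and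
    -- `j`, as extensionality of span maps demands.
    have key : ∀ c {i j} (hr : LabelledSpan.r A c = i) (hl : LabelledSpan.l A c = j),
        SpanMap.map f c = SpanMap.map g c ∧ SpanMap.lab f c hr hl ≍ SpanMap.lab g c hr hl := by
      intro c i j hr hl
      obtain ⟨b, Q, φ, ⟨h₁, h₂⟩, h₃, h₄⟩ := h _ ⟨i, rfl⟩ _ ⟨j, rfl⟩ _ ⟨c, hr, hl, HEq.rfl⟩
      exact ⟨h₁.trans h₃.symm, h₂.trans h₄.symm⟩
    exact SpanMap.ext_lab (fun c => (key c rfl rfl).1) fun c _ _ hi hj => (key c hi hj).2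

end SpanRelation

/-! ### The monoidal structure of `Span|V` -/

section SpanMonoidal

variable {V : Type u} [Bicategory.{w, v} V]

/-- The relation of `Span|V` and `V` is compatible with tensor products. -/
noncomputable def TensorData.spanRelation (T : TensorData V) :
    TensorRelation (spanRelation.{s} V) T.spanTensor T where
  unit := ⟨PUnit.unit, rfl⟩
  ob p q := ⟨(p.pt, q.pt), congrArg₂ T.ob p.label q.label⟩
  hom {_ _ _ _ _ _ _ _ p p' q q' _ _ _ _} P Q :=
    { pt := (P.pt, Q.pt)
      r := Prod.ext P.r Q.r
      l := Prod.ext P.l Q.l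
      lab := by
        obtain ⟨i, rfl⟩ := p
        obtain ⟨i', rfl⟩ := p'
        obtain ⟨j, rfl⟩ := q
        obtain ⟨j', rfl⟩ := q'
        obtain ⟨c, hr, hl, h⟩ := P
        obtain ⟨d, hr', hl', h'⟩ := Q
        cases h
        cases h'
        rfl }
  hom₂ {_ _ _ _ _ _ _ _ p p' q q' _ _ _ _ _ _ _ _ P P' Q Q' _ _ _ _} hf hg := by
    obtain ⟨i, rfl⟩ := p
    obtain ⟨i', rfl⟩ := p'
    obtain ⟨j, rfl⟩ := q
    obtain ⟨j', rfl⟩ := q'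
    obtain ⟨c, hr, hl, h⟩ := P
    obtain ⟨c', hr', hl', h'⟩ := P'
    obtain ⟨d, kr, kl, k⟩ := Q
    obtain ⟨d', kr', kl', k'⟩ := Q'
    cases h
    cases h'
    cases k
    cases k'
    obtain ⟨h₁, h₂⟩ := hf
    obtain ⟨k₁, k₂⟩ := hg
    cases h₁
    cases h₂
    cases k₁
    cases k₂
    exact ⟨rfl, HEq.rfl⟩
  idIso p q := by
    obtain ⟨i, rfl⟩ := p
    obtain ⟨j, rfl⟩ := q
    exact ⟨rfl, HEq.rfl⟩
  compIso {_ _ _ _ _ _ _ _ _ _ _ _ p p' p'' q q' q'' _ _ _ _ _ _ _ _} P P' Q Q' := by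
    obtain ⟨i, rfl⟩ := p
    obtain ⟨i', rfl⟩ := p'
    obtain ⟨i'', rfl⟩ := p''
    obtain ⟨j, rfl⟩ := q
    obtain ⟨j', rfl⟩ := q'
    obtain ⟨j'', rfl⟩ := q''
    obtain ⟨c, hr, hl, h⟩ := P
    obtain ⟨c', hr', hl', h'⟩ := P'
    obtain ⟨d, kr, kl, k⟩ := Q
    obtain ⟨d', kr', kl', k'⟩ := Q'
    cases h
    cases h'
    cases k
    cases k'
    exact ⟨rfl, HEq.rfl⟩
  ob_cases {X Y C} h := by
    rintro _ ⟨⟨i, j⟩, rfl⟩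
    exact h _ ⟨i, rfl⟩ _ ⟨j, rfl⟩
  hom_cases {X X' Y Y' x y p q A B C} h := by
    obtain ⟨i, rfl⟩ := p
    obtain ⟨j, rfl⟩ := q
    rintro _ ⟨⟨i', j'⟩, rfl⟩ _ ⟨⟨c, d⟩, hr, hl, h'⟩
    cases h'
    exact h _ ⟨i', rfl⟩ _ ⟨c, congrArg Prod.fst hr, congrArg Prod.fst hl, HEq.rfl⟩ _ ⟨j', rfl⟩ _
      ⟨d, congrArg Prod.snd hr, congrArg Prod.snd hl, HEq.rfl⟩

/-- The right leg of a graph is the identity, so the source fixes the point, and with it the target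
and the label. This gives the case principles for associativity, unitality, `χ` and `ι`. -/
theorem LabelledSpan.Point.graph_cases {X Y : LabelledSet.{s} V} {f : X.carrier → Y.carrier}
    {a : ∀ i, X.label i ⟶ Y.label (f i)} {i : X.carrier}
    {C : ∀ y (q : Y.Point y) b, LabelledSpan.Point (LabelledSpan.graph f a) ⟨i, rfl⟩ q b → Prop}
    (h : C _ ⟨f i, rfl⟩ (a i) ⟨i, rfl, rfl, HEq.rfl⟩) : ∀ y q b P, C y q b P := by
  rintro _ ⟨j, rfl⟩ b ⟨c, hr, hl, h'⟩
  change c = i at hr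
  change f c = j at hl
  subst hr
  subst hl
  cases h'
  exact h

/-- The relation of `Span|V` and `V` is compatible with associativity and unitality. -/
noncomputable def PremonoidalData.spanRelation (M : PremonoidalData V) :
    PremonoidalRelation (spanRelation.{s} V) M.spanPremonoidal M where
  toTensorRelation := M.toTensorData.spanRelation
  a p q r :=
    { pt := ((p.pt, q.pt), r.pt)
      r := rfl
      l := rfl
      lab := by
        obtain ⟨i, rfl⟩ := p
        obtain ⟨j, rfl⟩ := q
        obtain ⟨k, rfl⟩ := r
        rfl }
  aNat {_ _ _ _ _ _ _ _ _ _ _ _ p p' q q' r r' _ _ _ _ _ _} P Q O := by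
    obtain ⟨i, rfl⟩ := p
    obtain ⟨i', rfl⟩ := p'
    obtain ⟨j, rfl⟩ := q
    obtain ⟨j', rfl⟩ := q'
    obtain ⟨k, rfl⟩ := r
    obtain ⟨k', rfl⟩ := r'
    obtain ⟨c, hr, hl, h⟩ := P
    cases h
    -- The labels of the naturality 2-cell are defined by eliminating endpoint equations, so they
    -- reduce once the endpoints are literal values of the legs.
    cases hr
    cases hl
    obtain ⟨d, hr, hl, h'⟩ := Q
    cases h'
    cases hr
    cases hl
    obtain ⟨e, hr, hl, h''⟩ := O
    cases h''
    cases hr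
    cases hl
    exact ⟨rfl, HEq.rfl⟩
  a_cases {X Y Z _ _ _ p q r C} h := by
    obtain ⟨i, rfl⟩ := p
    obtain ⟨j, rfl⟩ := q
    obtain ⟨k, rfl⟩ := r
    exact LabelledSpan.Point.graph_cases (X := M.spanOb (M.spanOb X Y) Z)
      (Y := M.spanOb X (M.spanOb Y Z)) (f := fun k => (k.1.1, (k.1.2, k.2)))
      (a := fun _ => M.a _ _ _) (i := ((i, j), k)) (C := C) h
  l p :=
    { pt := (PUnit.unit, p.pt)
      r := rfl
      l := rfl
      lab := by
        obtain ⟨i, rfl⟩ := p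
        rfl }
  lNat {_ _ _ _ p p' _ _} P := by
    obtain ⟨i, rfl⟩ := p
    obtain ⟨i', rfl⟩ := p'
    obtain ⟨c, hr, hl, h⟩ := P
    cases h
    cases hr
    cases hl
    exact ⟨rfl, HEq.rfl⟩
  l_cases {X _ p C} h := by
    obtain ⟨i, rfl⟩ := p
    exact LabelledSpan.Point.graph_cases (X := M.spanOb M.spanTensor.unit X) (Y := X)
      (f := fun k => k.2) (a := fun _ => M.l _) (i := (PUnit.unit, i)) (C := C) h
  r p :=
    { pt := p.pt
      r := rfl
      l := rfl
      lab := by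
        obtain ⟨i, rfl⟩ := p
        rfl }
  rNat {_ _ _ _ p p' _ _} P := by
    obtain ⟨i, rfl⟩ := p
    obtain ⟨i', rfl⟩ := p'
    obtain ⟨c, hr, hl, h⟩ := P
    cases h
    cases hr
    cases hl
    exact ⟨rfl, HEq.rfl⟩
  r_cases {X _ p C} h := by
    obtain ⟨i, rfl⟩ := p
    exact LabelledSpan.Point.graph_cases (X := X) (Y := M.spanOb X M.spanTensor.unit)
      (f := fun k => (k, PUnit.unit)) (a := fun _ => M.r _) (i := i) (C := C) h
  unit_cases {C} h := by
    rintro _ ⟨⟨⟩, rfl⟩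
    exact h

/-- The relation of `Span|V` and `V` is compatible with the monoidal structure. -/
noncomputable def MonoidalBicategoryData.spanRelation (M : MonoidalBicategoryData V) :
    MonoidalRelation (spanRelation.{s} V) M.span M where
  toPremonoidalRelation := M.toPremonoidalData.spanRelation
  π p q r o := by
    obtain ⟨i, rfl⟩ := p
    obtain ⟨j, rfl⟩ := q
    obtain ⟨k, rfl⟩ := r
    obtain ⟨m, rfl⟩ := o
    exact ⟨rfl, HEq.rfl⟩
  μ p q := by
    obtain ⟨i, rfl⟩ := p
    obtain ⟨j, rfl⟩ := q
    exact ⟨rfl, HEq.rfl⟩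
  lam p q := by
    obtain ⟨i, rfl⟩ := p
    obtain ⟨j, rfl⟩ := q
    exact ⟨rfl, HEq.rfl⟩
  rho p q := by
    obtain ⟨i, rfl⟩ := p
    obtain ⟨j, rfl⟩ := q
    exact ⟨rfl, HEq.rfl⟩

/-- A labelled span whose underlying span is the graph of a bijection and whose labels are
equivalences is an equivalence. -/
theorem LabelledSpan.isEquivalenceCell_graph {X Y : LabelledSet.{s} V} {f : X.carrier → Y.carrier}
    (hf : Function.Bijective f) {a : ∀ i, X.label i ⟶ Y.label (f i)}
    (ha : ∀ i, IsEquivalenceCell (a i)) :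
    IsEquivalenceCell (a := X) (b := Y) (LabelledSpan.graph f a) := by
  choose e he using ha
  obtain rfl : (fun i => (e i).hom) = a := funext he
  -- The candidate inverse is the reversed span with inverse labels; no inverse of the map `f` has
  -- to be chosen.
  let B : Y ⟶ X := LabelledSpan.mk X.carrier (fun i => i) f fun i _ _ hi hj => match hi, hj with
    | rfl, rfl => (e i).inv
  let A : X ⟶ Y := LabelledSpan.graph f fun i => (e i).hom
  -- The right legs of `A` and `B` are bijective, hence so are those of their composites, and any
  -- map between spans with bijective right legs is bijective. This is how the unit and counit
  -- become invertible.
  have hB : Function.Bijective (LabelledSpan.r B) := hf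
  have hA : Function.Bijective (LabelledSpan.r A) := Function.bijective_id
  let ηA : 𝟙 X ⟶ A ≫ B := SpanMap.mk (fun i => ⟨i, i, f i, rfl, rfl⟩) (fun _ => rfl) (fun _ => rfl)
    fun i _ _ hi hj => match hi, hj with
      | rfl, rfl => (e i).unit.hom
  -- The legs matched in this pullback are identities, so its points are diagonal and either
  -- coordinate could be sent through `f`.
  let εA : B ≫ A ⟶ 𝟙 Y := SpanMap.mk (fun p => f p.fst)
    (fun _ => rfl)
    (fun p => congrArg f (show p.fst = p.snd from p.fst_r.trans p.snd_l.symm))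
    fun p i j hi hj => by
      obtain ⟨d, c, m, h, h'⟩ := p
      change d = m at h
      change c = m at h'
      subst h
      subst h'
      change f c = i at hi
      change f c = j at hj
      subst hi
      subst hj
      exact (e c).counit.hom
  -- Adjusting the counit supplies the triangle identity, so it need not be verified for the chosen
  -- unit and counit.
  refine ⟨Equivalence.mkOfAdjointifyCounit (f := A) (g := B)
    (ηA.iso (SpanMap.bijective_of_r _ Function.bijective_id
      (LabelledSpan.comp_r_bijective _ _ hA hB)) ?_)
    (εA.iso (SpanMap.bijective_of_r _ (LabelledSpan.comp_r_bijective _ _ hB hA)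
      Function.bijective_id) ?_), rfl⟩
  · rintro i _ _ rfl rfl
    exact inferInstanceAs (IsIso (e i).unit.hom)
  · rintro ⟨d, c, m, h, h'⟩ i j hi hj
    change d = m at h
    change c = m at h'
    subst h
    subst h'
    change f c = i at hi
    change f c = j at hj
    subst hi
    subst hj
    exact inferInstanceAs (IsIso (e c).counit.hom)

/-- A monoidal structure on `V` induces one on `Span|V`. -/
theorem MonoidalBicategoryData.IsMonoidalBicategory.span {M : MonoidalBicategoryData V}
    (h : M.IsMonoidalBicategory) :
    (M.span : MonoidalBicategoryData (LabelledSet.{s} V)).IsMonoidalBicategory :=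
  M.spanRelation.isMonoidalBicategory h
    (fun X Y Z => LabelledSpan.isEquivalenceCell_graph (M.spanA_l_bijective X Y Z)
      fun _ => h.assoc.equivalence ((_, _), _))
    (fun X => LabelledSpan.isEquivalenceCell_graph (M.spanL_l_bijective X)
      fun _ => h.left.equivalence _)
    fun X => LabelledSpan.isEquivalenceCell_graph (M.spanR_l_bijective X)
      fun _ => h.right.equivalence _

end SpanMonoidal

/-! ### Functoriality of `Span|F` and its monoidal structure -/

section SpanFunctoriality

variable {V : Type u₁} [Bicategory.{w₁, v₁} V] {W : Type u₂} [Bicategory.{w₂, v₂} W]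

/-- The relations of `Span|V` and `V` and of `Span|W` and `W` are compatible with `Span|F`. -/
def LaxFunctorData.spanRelation (F : LaxFunctorData V W) :
    LaxFunctorRelation (spanRelation.{s} V) (spanRelation.{s} W) F.span F where
  obj p := ⟨p.pt, congrArg F.obj p.label⟩
  map {_ _ _ _ p q _ _} P :=
    { pt := P.pt
      r := P.r
      l := P.l
      lab := by
        obtain ⟨i, rfl⟩ := p
        obtain ⟨j, rfl⟩ := q
        obtain ⟨c, hr, hl, h⟩ := P
        cases h
        rfl }
  map₂ {_ _ _ _ p q _ _ _ _ P Q _ _} hf := by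
    obtain ⟨i, rfl⟩ := p
    obtain ⟨j, rfl⟩ := q
    obtain ⟨c, hr, hl, h⟩ := P
    obtain ⟨d, hr', hl', h'⟩ := Q
    cases h
    cases h'
    obtain ⟨h₁, h₂⟩ := hf
    cases h₁
    cases h₂
    exact ⟨rfl, HEq.rfl⟩
  mapId p := by
    obtain ⟨i, rfl⟩ := p
    exact ⟨rfl, HEq.rfl⟩
  mapComp {_ _ _ _ _ _ p q r _ _ _ _} P Q := by
    obtain ⟨i, rfl⟩ := p
    obtain ⟨j, rfl⟩ := q
    obtain ⟨k, rfl⟩ := r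
    obtain ⟨c, hr, hl, h⟩ := P
    obtain ⟨d, hr', hl', h'⟩ := Q
    cases h
    cases h'
    exact ⟨rfl, HEq.rfl⟩
  obj_cases {X C} h := by
    rintro _ ⟨i, rfl⟩
    -- The point is kept and regarded in the original labelled set, where it has its label before
    -- `F` is applied.
    exact h _ ⟨i, rfl⟩
  map_cases {X Y x p A C} h := by
    obtain ⟨i, rfl⟩ := p
    rintro _ ⟨j, rfl⟩ _ ⟨c, hr, hl, h'⟩
    cases h'
    exact h _ ⟨j, rfl⟩ _ ⟨c, hr, hl, HEq.rfl⟩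

/-- `Span|F` is a lax functor if `F` is one. -/
theorem LaxFunctorData.IsLaxFunctor.span {F : LaxFunctorData V W} (h : F.IsLaxFunctor) :
    (F.span : LaxFunctorData (LabelledSet.{s} V) (LabelledSet.{s} W)).IsLaxFunctor :=
  F.spanRelation.isLaxFunctor h

theorem SpanMap.isIso {X Y : LabelledSet.{s} V} {A B : X ⟶ Y} (f : A ⟶ B)
    (hf : Function.Bijective (SpanMap.map f))
    (h : ∀ c {i j} (hi : LabelledSpan.r A c = i) (hj : LabelledSpan.l A c = j),
      IsIso (SpanMap.lab f c hi hj)) : IsIso f :=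
  inferInstanceAs (IsIso (SpanMap.iso f hf h).hom)

/-- `Span|F` is a pseudofunctor if `F` is one. -/
theorem LaxFunctorData.IsPseudofunctor.span {F : LaxFunctorData V W} (h : F.IsPseudofunctor) :
    (F.span : LaxFunctorData (LabelledSet.{s} V) (LabelledSet.{s} W)).IsPseudofunctor := by
  have hF : F.IsLaxFunctor := by
    obtain ⟨G, rfl⟩ := h
    exact ⟨G.toLax, rfl⟩
  -- The lax laws being known, only invertibility of the comparison 2-cells is left; their
  -- underlying maps are identities up to repackaging, and their labels are comparison 2-cells of
  -- `F`.
  refine hF.span.isPseudofunctor (fun X => ?_) fun A B => ?_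
  · refine SpanMap.isIso _ Function.bijective_id fun k i j hi hj => ?_
    change k = i at hi
    change k = j at hj
    subst hi
    subst hj
    exact h.isIso.1 _
  -- The two pullbacks have the same components but are formed over different labelled spans, so the
  -- inverse only repackages them.
  · exact SpanMap.isIso _ (Function.bijective_iff_has_inverse.2
      ⟨fun p => ⟨p.fst, p.snd, p.mid, p.fst_r, p.snd_l⟩, fun _ => rfl, fun _ => rfl⟩) fun _ _ _ _ _ => h.isIso.2 _ _

namespace MonoidalLaxFunctorData

variable {M : MonoidalBicategoryData V} {N : MonoidalBicategoryData W}
  (H : MonoidalLaxFunctorData M N)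

/-- The relations of `Span|V` and `V` and of `Span|W` and `W` are compatible with the monoidal
structure of `Span|F`. -/
noncomputable def spanRelation :
    MonoidalLaxFunctorRelation (M.spanRelation.{s}) (N.spanRelation.{s}) H.span H where
  toLaxFunctorRelation := H.F.spanRelation
  χ p q :=
    { pt := (p.pt, q.pt)
      r := rfl
      l := rfl
      lab := by
        obtain ⟨i, rfl⟩ := p
        obtain ⟨j, rfl⟩ := q
        rfl }
  χNat {_ _ _ _ _ _ _ _ p p' q q' _ _ _ _} P Q := by
    obtain ⟨i, rfl⟩ := p
    obtain ⟨i', rfl⟩ := p'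
    obtain ⟨j, rfl⟩ := q
    obtain ⟨j', rfl⟩ := q'
    obtain ⟨c, hr, hl, h⟩ := P
    cases h
    cases hr
    cases hl
    obtain ⟨d, hr, hl, h'⟩ := Q
    cases h'
    cases hr
    cases hl
    exact ⟨rfl, HEq.rfl⟩
  χ_cases {X Y _ _ p q C} h := by
    obtain ⟨i, rfl⟩ := p
    obtain ⟨j, rfl⟩ := q
    exact LabelledSpan.Point.graph_cases (X := N.spanOb (H.F.span.obj X) (H.F.span.obj Y))
      (Y := H.F.span.obj (M.spanOb X Y)) (f := fun k => k) (a := fun _ => H.χ.comp _ _)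
      (i := (i, j)) (C := C) h
  ι :=
    { pt := PUnit.unit
      r := rfl
      l := rfl
      lab := HEq.rfl }
  ι_cases {C} h := LabelledSpan.Point.graph_cases (X := N.span.unit)
    (Y := H.F.span.obj M.span.unit) (f := fun k => k) (a := fun _ => H.ι) (i := PUnit.unit)
    (C := C) h
  ω p q r := by
    obtain ⟨i, rfl⟩ := p
    obtain ⟨j, rfl⟩ := q
    obtain ⟨k, rfl⟩ := r
    exact ⟨rfl, HEq.rfl⟩
  γ p := by
    obtain ⟨i, rfl⟩ := p
    exact ⟨rfl, HEq.rfl⟩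
  δ p := by
    obtain ⟨i, rfl⟩ := p
    exact ⟨rfl, HEq.rfl⟩

/-- A monoidal structure on `F` induces one on `Span|F`. -/
theorem IsMonoidalLaxFunctor.span {H : MonoidalLaxFunctorData M N}
    (h : H.IsMonoidalLaxFunctor) :
    (H.span : MonoidalLaxFunctorData (M.span : MonoidalBicategoryData (LabelledSet.{s} V))
      N.span).IsMonoidalLaxFunctor :=
  H.spanRelation.isMonoidalLaxFunctor h

/-- Followed by the first projection of its target, this map is the second projection of its source.
Both projections are bijective because the legs of the span of `χ` are. -/
theorem spanχNat_bijective {X X' Y Y' : LabelledSet.{s} V} (A : X ⟶ X') (B : Y ⟶ Y') :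
    Function.Bijective (SpanMap.map (H.spanχNat A B)) :=
  Function.Bijective.of_comp_left (f := SpanPullback.fst)
    (LabelledSpan.snd_bijective _ (H.spanχApp X' Y') Function.bijective_id)
    (LabelledSpan.fst_bijective (H.spanχApp X Y) _ Function.bijective_id).1

/-- The product compatibility of `Span|F` is pseudonatural if that of `F` is. -/
theorem isIso_spanχNat (h : ∀ {A A' B B' : V} (f : A ⟶ A') (g : B ⟶ B'), IsIso (H.χ.nat f g))
    {X X' Y Y' : LabelledSet.{s} V} (A : X ⟶ X') (B : Y ⟶ Y') : IsIso (H.spanχNat A B) := by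
  refine SpanMap.isIso _ (H.spanχNat_bijective A B) fun p i j hi hj => ?_
  -- Eliminating the pullback and endpoint equations reduces the label to a naturality 2-cell of the
  -- original `χ`.
  obtain ⟨k, ⟨a, b⟩, m, h₁, h₂⟩ := p
  change k = m at h₁
  subst h₁
  change (LabelledSpan.l A a, LabelledSpan.l B b) = k at h₂
  subst h₂
  change (LabelledSpan.r A a, LabelledSpan.r B b) = i at hi
  subst hi
  change (LabelledSpan.l A a, LabelledSpan.l B b) = j at hj
  subst hj
  exact h _ _

end MonoidalLaxFunctorData

end SpanFunctoriality

theorem mainTheorem1 {V : Type u₁} [Bicategory.{w₁, v₁} V] {W : Type u₂} [Bicategory.{w₂, v₂} W] :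
    -- `Span|V`, with its explicit operations, is a bicategory
    (∃ B : Bicategory.{max w₁ s, max v₁ (s + 1)} (LabelledSet.{s} V),
      BicategoryData.of B = LabelledSet.bicategoryData V ∧ B = LabelledSet.bicategory) ∧
    -- a monoidal structure on `V` induces a monoidal structure on `Span|V`
    (∀ M : MonoidalBicategoryData V, M.IsMonoidalBicategory →
      (M.span : MonoidalBicategoryData (LabelledSet.{s} V)).IsMonoidalBicategory) ∧
    -- a lax functor `F` induces a lax functor `Span|F`
    (∀ F : V ⥤ᴸ W, ((LaxFunctorData.of F).span :
      LaxFunctorData (LabelledSet.{s} V) (LabelledSet.{s} W)).IsLaxFunctor) ∧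
    -- `Span|F` is a pseudofunctor when `F` is one
    (∀ F : V ⥤ᴸ W, (LaxFunctorData.of F).IsPseudofunctor → ((LaxFunctorData.of F).span :
      LaxFunctorData (LabelledSet.{s} V) (LabelledSet.{s} W)).IsPseudofunctor) ∧
    -- a monoidal structure on a lax functor `F` induces a monoidal structure on `Span|F`; its
    -- product compatibility is pseudonatural when that of `F` is
    (∀ (M : MonoidalBicategoryData V) (N : MonoidalBicategoryData W),
      M.IsMonoidalBicategory → N.IsMonoidalBicategory →
      ∀ H : MonoidalLaxFunctorData M N, H.IsMonoidalLaxFunctor →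
        (H.span : MonoidalLaxFunctorData (M.span : MonoidalBicategoryData (LabelledSet.{s} V))
          (N.span : MonoidalBicategoryData (LabelledSet.{s} W))).IsMonoidalLaxFunctor ∧
        ((∀ {A A' B B' : V} (f : A ⟶ A') (g : B ⟶ B'), IsIso (H.χ.nat f g)) →
          ∀ {X X' Y Y' : LabelledSet.{s} V} (f : X ⟶ X') (g : Y ⟶ Y'),
            IsIso (H.span.χ.nat f g))) :=

  -- The explicit operations agree by definition: forming an isomorphism from a span map keeps that
  -- map as its forward direction, and horizontal composition unfolds to the two whiskerings.
  ⟨⟨LabelledSet.bicategory, rfl, rfl⟩, fun _ hM => hM.span,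
    fun F => LaxFunctorData.IsLaxFunctor.span ⟨F, rfl⟩, fun _ hF => hF.span,
    fun _ _ _ _ H hH => ⟨hH.span, fun h _ _ _ _ f g => H.isIso_spanχNat h f g⟩⟩
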